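/- Let $T=\mathbb R^n$ with its Euclidean metric, let $M$ be a real analytic (Hausdorff) $n$-manifold and $\pi\colon F\to M$ its bundle of frames $u\colon T\to T_xM$, with tautological form $\theta_u=u^{-1}\circ d\pi_u$. Let $\iota\colon\Lambda^*T\to\Omega(F)$, $\iota(\alpha)_u=\alpha(\theta_u\,\cdot,\dots,\theta_u\,\cdot)$ (vectors and covectors on $T$ are identified by the metric). For a graded subspace $A\subset\Lambda^*T$, a \emph{differential operator} on $A$ is a linear map $f\colon A\to A$ of degree $1$ with $f^2=0$ that satisfies the graded Leibniz rule, and $\mathcal I_{A,f}(F)\subset\Omega(F)$ denotes the ideal generated by the forms $d\iota(\alpha)-\iota(f(\alpha))$ and $d\iota(f(\alpha))$, $\alpha\in A$. A subspace $E\subset T_uF$ is an \emph{integral element} of an ideal $\mathcal I$ if all forms in $\mathcal I$ restrict to zero on $E$, and it is \emph{$\pi$-transverse} if $E\cap\ker d\pi_u=0$. If $v_1,\dots,v_k$ is a basis of $E$, its polar equations are $\mathcal E(E)=\{(v_1\wedge\dots\wedge v_k)\lrcorner\,\alpha_u\mid\alpha\in\mathcal I\cap\Omega^{k+1}(F)\}\subset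 T_u^*F$. An $n$-dimensional integral element $E$ is \emph{ordinary} if there is a flag $0=E_0\subsetneq E_1\subsetneq\dots\subsetneq E_n=E$ such that, for every $k<n$, $\dim\mathcal E(E')$ is constant as $E'$ ranges over the integral elements in some neighbourhood of $E_k$ in the Grassmannian bundle $Gr_k(TF)$. The system $\mathcal I$ is \emph{involutive} if over every $u\in F$ there is a $\pi$-transverse $n$-dimensional integral element, and every $\pi$-transverse $n$-dimensional integral element is ordinary. Let $\rho\in\Lambda^3\mathbb R^8$ be the $\mathrm{PSU}(3)$-invariant form \[\rho=e^{123}+\tfrac12e^1\wedge(e^{47}-e^{56})+\tfrac12e^2\wedge(e^{46}+e^{57})+\tfrac12e^3\wedge(e^{45}-e^{67})+\tfrac{\sqrt3}2e^8\wedge(e^{45}+e^{67}),\] and $*\rho\in\Lambda^5\mathbb R^8$ its Hodge dual. Let $Sp(2)Sp(1)$ act on $\mathbb R^8=\mathbb H^2$ by $x\mapsto Axq^{-1}$; let $Spin(7)\subset SO(8)$ be the stabilizer of the Cayley form $e^{1234}+e^{1256}+e^{1278}+e^{1357}-e^{1368}-e^{1458}-e^{1467}-e^{2358}-e^{2367}-e^{2457}+e^{2468}+e^{3456}+e^{3478}+e^{5678}$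 and $\mathrm G_2\subset SO(7)$ the stabilizer of $e^{123}+e^{145}+e^{167}+e^{246}-e^{257}-e^{347}-e^{356}$; let $SU(k)$ act in the standard way on $\mathbb R^{2k}=\mathbb C^k$ and on $\mathbb R^{2k+1}=\mathbb C^k\oplus\mathbb R$, trivially on the last summand. \textbf{Theorem.} (i) If $A$ is one of $(\Lambda^*\mathbb R^8)^{Sp(2)Sp(1)}$, $(\Lambda^*\mathbb R^8)^{Spin(7)}$, $\mathbb R\rho$, $\mathbb R(*\rho)$, then $\mathcal I_{A,0}(F)$ is involutive for the frame bundle $F$ of every real analytic $8$-manifold. (ii) If $A$ is one of $(\Lambda^*\mathbb R^7)^{\mathrm G_2}$, $(\Lambda^*\mathbb R^{2k})^{SU(k)}$, $(\Lambda^*\mathbb R^{2k+1})^{SU(k)}$ with $k\ge1$, and $n=7,2k,2k+1$ respectively, then $\mathcal I_{A,f}(F)$ is involutive for the frame bundle $F$ of every real analytic $n$-manifold and every differential operator $f$ on $A$ that extends to a degree $1$ derivation of $\Lambda^*\mathbb R^n$. -/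

import Mathlib

open scoped Manifold ContDiff Topology Quaternion Nat

universe u

namespace DGAGeometry

/-! ### Exterior algebra of `T = ℝⁿ` -/

/-- The model space `T = ℝⁿ` with its Euclidean metric. -/
abbrev Euc (n : ℕ) := EuclideanSpace ℝ (Fin n)

/-- The bilinear product `(v₁, …, v_{p+q}) ↦ α(v₁, …, v_p) β(v_{p+1}, …, v_{p+q})`. -/
def tensorForm {V : Type*} [AddCommGroup V] [Module ℝ V] [TopologicalSpace V] {p q r : ℕ}
    (h : p + q = r) (α : V [⋀^Fin p]→L[ℝ] ℝ) (β : V [⋀^Fin q]→L[ℝ] ℝ) :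
    ContinuousMultilinearMap ℝ (fun _ : Fin r => V) ℝ where
  toFun v := α (fun i => v (Fin.cast h (Fin.castAdd q i))) *
    β (fun j => v (Fin.cast h (Fin.natAdd p j)))
  map_update_add' := by
    subst h
    intro inst v i x y
    have hinst : inst = instDecidableEqFin (p + q) := Subsingleton.elim _ _
    subst hinst
    have hl : ∀ (i : Fin p) (z : V), (fun k => Function.update v (Fin.castAdd q i) z
        (Fin.castAdd q k)) = Function.update (fun k => v (Fin.castAdd q k)) i z := fun i z =>
      Function.update_comp_eq_of_injective v (Fin.castAdd_injective p q) i z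
    have hr : ∀ (i : Fin q) (z : V), (fun k => Function.update v (Fin.natAdd p i) z
        (Fin.natAdd p k)) = Function.update (fun k => v (Fin.natAdd p k)) i z := fun i z =>
      Function.update_comp_eq_of_injective v (Fin.natAdd_injective q p) i z
    have hlr : ∀ (i : Fin p) (z : V) (k : Fin q), Function.update v (Fin.castAdd q i) z
        (Fin.natAdd p k) = v (Fin.natAdd p k) := fun i z k =>
      Function.update_of_ne (by intro e; have := congrArg Fin.val e; simp at this; omega) _ _
    have hrl : ∀ (i : Fin q) (z : V) (k : Fin p), Function.update v (Fin.natAdd p i) z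
        (Fin.castAdd q k) = v (Fin.castAdd q k) := fun i z k =>
      Function.update_of_ne (by intro e; have := congrArg Fin.val e; simp at this; omega) _ _
    refine Fin.addCases (fun i => ?_) (fun i => ?_) i
    · simp [hl, hlr, add_mul]
    · simp [hr, hrl, mul_add]
  map_update_smul' := by
    subst h
    intro inst v i c x
    have hinst : inst = instDecidableEqFin (p + q) := Subsingleton.elim _ _
    subst hinst
    have hl : ∀ (i : Fin p) (z : V), (fun k => Function.update v (Fin.castAdd q i) z
        (Fin.castAdd q k)) = Function.update (fun k => v (Fin.castAdd q k)) i z := fun i z =>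
      Function.update_comp_eq_of_injective v (Fin.castAdd_injective p q) i z
    have hr : ∀ (i : Fin q) (z : V), (fun k => Function.update v (Fin.natAdd p i) z
        (Fin.natAdd p k)) = Function.update (fun k => v (Fin.natAdd p k)) i z := fun i z =>
      Function.update_comp_eq_of_injective v (Fin.natAdd_injective q p) i z
    have hlr : ∀ (i : Fin p) (z : V) (k : Fin q), Function.update v (Fin.castAdd q i) z
        (Fin.natAdd p k) = v (Fin.natAdd p k) := fun i z k =>
      Function.update_of_ne (by intro e; have := congrArg Fin.val e; simp at this; omega) _ _
    have hrl : ∀ (i : Fin q) (z : V) (k : Fin p), Function.update v (Fin.natAdd p i) z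
        (Fin.castAdd q k) = v (Fin.castAdd q k) := fun i z k =>
      Function.update_of_ne (by intro e; have := congrArg Fin.val e; simp at this; omega) _ _
    refine Fin.addCases (fun i => ?_) (fun i => ?_) i
    · simp [hl, hlr, mul_assoc]
    · simp [hr, hrl, mul_left_comm]
  cont := by fun_prop

/-- The wedge product of alternating forms, normalised by
`(α ∧ β)(v) = (p! q!)⁻¹ ∑ σ, sgn σ α(v_{σ 1}, …, v_{σ p}) β(v_{σ (p+1)}, …, v_{σ (p+q)})`.
The degree of the product is a variable `r` with a proof of `p + q = r`. -/
noncomputable def wedge {V : Type*} [AddCommGroup V] [Module ℝ V] [TopologicalSpace V]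
    {p q r : ℕ} (h : p + q = r) (α : V [⋀^Fin p]→L[ℝ] ℝ) (β : V [⋀^Fin q]→L[ℝ] ℝ) :
    V [⋀^Fin r]→L[ℝ] ℝ :=
  ((p ! * q ! : ℕ) : ℝ)⁻¹ • ContinuousMultilinearMap.alternatization (tensorForm h α β)

theorem wedge_apply {V : Type*} [AddCommGroup V] [Module ℝ V] [TopologicalSpace V]
    {p q r : ℕ} (h : p + q = r) (α : V [⋀^Fin p]→L[ℝ] ℝ) (β : V [⋀^Fin q]→L[ℝ] ℝ) (v : Fin r → V) :
    wedge h α β v = ((p ! * q ! : ℕ) : ℝ)⁻¹ * ∑ σ : Equiv.Perm (Fin r), Equiv.Perm.sign σ •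
      (α (fun i => v (σ (Fin.cast h (Fin.castAdd q i)))) *
        β (fun j => v (σ (Fin.cast h (Fin.natAdd p j))))) := by
  unfold wedge
  rw [ContinuousAlternatingMap.smul_apply, ContinuousMultilinearMap.alternatization_apply_apply]
  rfl

/-- The form `e^{I₁} ∧ ⋯ ∧ e^{I_p}` on `ℝⁿ`, indices running from `0` to `n - 1`. -/
noncomputable def coordForm {n p : ℕ} (I : Fin p → Fin n) : Euc n [⋀^Fin p]→L[ℝ] ℝ :=
  { (Matrix.detRowAlternating (R := ℝ) (n := Fin p)).compLinearMap
      (LinearMap.pi fun b => (EuclideanSpace.proj (𝕜 := ℝ) (I b)).toLinearMap) with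
    toFun := fun v => Matrix.det (Matrix.of fun a b => v a (I b))
    cont := by
      refine Continuous.matrix_det ?_
      fun_prop }

theorem coordForm_apply {n p : ℕ} (I : Fin p → Fin n) (v : Fin p → Euc n) :
    coordForm I v = Matrix.det (Matrix.of fun a b => v a (I b)) := rfl

/-- The Hodge star `Λᵖ → Λ^q` on oriented Euclidean `ℝ^{p+q}`:
`*α = (p! q!)⁻¹ ∑ σ, sgn σ α(e_{σ 1}, …, e_{σ p}) e^{σ (p+1)} ∧ ⋯ ∧ e^{σ (p+q)}`. -/
noncomputable def hodgeStar {p q : ℕ} (α : Euc (p + q) [⋀^Fin p]→L[ℝ] ℝ) :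
    Euc (p + q) [⋀^Fin q]→L[ℝ] ℝ :=
  ((p ! * q ! : ℕ) : ℝ)⁻¹ • ∑ σ : Equiv.Perm (Fin (p + q)),
    ((Equiv.Perm.sign σ : ℤ) : ℝ) •
      (α fun i => EuclideanSpace.single (σ (Fin.castAdd q i)) (1 : ℝ)) •
        coordForm fun j => σ (Fin.natAdd p j)

/-- A graded linear subspace of `Λ*T`. -/
abbrev GradedSubspace (n : ℕ) := ∀ p : ℕ, Submodule ℝ (Euc n [⋀^Fin p]→L[ℝ] ℝ)

/-- The line `ℝ α ⊂ Λ*T` spanned by a homogeneous form. -/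
def lineSpan {n p : ℕ} (α : Euc n [⋀^Fin p]→L[ℝ] ℝ) : GradedSubspace n := fun q =>
  Submodule.span ℝ {β | (⟨q, β⟩ : Σ m, Euc n [⋀^Fin m]→L[ℝ] ℝ) = ⟨p, α⟩}

/-- The algebra `(Λ*T)^G` of the forms fixed by all transformations in `G`. -/
def invariants {n : ℕ} (G : Set (Euc n →L[ℝ] Euc n)) : GradedSubspace n := fun p =>
  { carrier := {α | ∀ g ∈ G, α.compContinuousLinearMap g = α}
    add_mem' := by
      intro a b ha hb g hg
      ext v
      have h1 := DFunLike.congr_fun (ha g hg) v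
      have h2 := DFunLike.congr_fun (hb g hg) v
      simp at h1 h2 ⊢
      rw [h1, h2]
    zero_mem' := by intro g _; ext v; simp
    smul_mem' := by
      intro c a ha g hg
      ext v
      have h1 := DFunLike.congr_fun (ha g hg) v
      simp at h1 ⊢
      rw [h1]; simp }

/-- `(A, f)` is a differential graded algebra: `f` is linear of degree `1`, `f² = 0` and the graded
Leibniz rule holds. -/
def IsDifferentialOperator {n : ℕ} (A : GradedSubspace n) (f : ∀ p, A p →ₗ[ℝ] A (p + 1)) : Prop :=
  (∀ p (a : A p), f (p + 1) (f p a) = 0) ∧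
  ∀ (p q r : ℕ) (h : p + q = r) (a : A p) (b : A q) (c : A r),
    (c : Euc n [⋀^Fin r]→L[ℝ] ℝ) = wedge h a.1 b.1 →
    (f r c).1 = wedge (by omega) (f p a).1 b.1 + (-1 : ℝ) ^ p • wedge (by omega) a.1 (f q b).1

/-- `D` is a derivation of degree one of the graded algebra `Λ*T`. -/
def IsDerivation {n : ℕ}
    (D : ∀ p, (Euc n [⋀^Fin p]→L[ℝ] ℝ) →ₗ[ℝ] (Euc n [⋀^Fin (p + 1)]→L[ℝ] ℝ)) : Prop :=
  ∀ (p q r : ℕ) (h : p + q = r) (a : Euc n [⋀^Fin p]→L[ℝ] ℝ) (b : Euc n [⋀^Fin q]→L[ℝ] ℝ),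
    D r (wedge h a b) =
      wedge (by omega) (D p a) b + (-1 : ℝ) ^ p • wedge (by omega) a (D q b)

/-- `f` extends to a derivation of degree one of `Λ*T`. -/
def ExtendsToDerivation {n : ℕ} (A : GradedSubspace n) (f : ∀ p, A p →ₗ[ℝ] A (p + 1)) : Prop :=
  ∃ D : ∀ p, (Euc n [⋀^Fin p]→L[ℝ] ℝ) →ₗ[ℝ] (Euc n [⋀^Fin (p + 1)]→L[ℝ] ℝ),
    IsDerivation D ∧ ∀ p (a : A p), D p a.1 = (f p a).1

/-! ### The groups and forms -/

/-- The complex coordinates `z_j = x_{2j-1} + i x_{2j}`, `j = 1, …, k`, on `ℝⁿ`, `2k ≤ n`. -/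
def complexCoord {n k : ℕ} (h : 2 * k ≤ n) (x : Euc n) (j : Fin k) : ℂ :=
  ⟨x ⟨2 * j, by omega⟩, x ⟨2 * j + 1, by omega⟩⟩

/-- `SU(k)` acting on `ℝⁿ = ℂᵏ ⊕ ℝ^{n-2k}`, trivially on the second summand. -/
def SU (k : ℕ) {n : ℕ} (h : 2 * k ≤ n) : Set (Euc n →L[ℝ] Euc n) :=
  {g | (∃ U ∈ Matrix.specialUnitaryGroup (Fin k) ℂ,
      ∀ x, complexCoord h (g x) = U.mulVec (complexCoord h x)) ∧
    ∀ x (i : Fin n), 2 * k ≤ i → g x i = x i}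

/-- The quaternionic coordinates on `ℝ⁸ = ℍ²`. -/
def quatCoord (x : Euc 8) (j : Fin 2) : ℍ[ℝ] :=
  ⟨x ⟨4 * j, by omega⟩, x ⟨4 * j + 1, by omega⟩, x ⟨4 * j + 2, by omega⟩, x ⟨4 * j + 3, by omega⟩⟩

/-- `Sp(2)Sp(1)`: the maps `x ↦ A x q⁻¹` of `ℍ² = ℝ⁸`, `A ∈ Sp(2)` and `q ∈ Sp(1)`. -/
def Sp2Sp1 : Set (Euc 8 →L[ℝ] Euc 8) :=
  {g | ∃ A ∈ unitary (Matrix (Fin 2) (Fin 2) ℍ[ℝ]), ∃ q ∈ unitary ℍ[ℝ],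
    ∀ x j, quatCoord (g x) j = (∑ l, A j l * quatCoord x l) * star q}

/-- The stabiliser of a form `α` in `GL(n, ℝ)`. -/
def stabilizer {n p : ℕ} (α : Euc n [⋀^Fin p]→L[ℝ] ℝ) : Set (Euc n →L[ℝ] Euc n) :=
  {g | g.IsInvertible ∧ α.compContinuousLinearMap g = α}

/-- The standard `3`-form
`e¹²³ + e¹⁴⁵ + e¹⁶⁷ + e²⁴⁶ - e²⁵⁷ - e³⁴⁷ - e³⁵⁶` on `ℝ⁷`, with stabiliser `G₂`. -/
noncomputable def g2Form : Euc 7 [⋀^Fin 3]→L[ℝ] ℝ :=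
  coordForm ![0, 1, 2] + coordForm ![0, 3, 4] + coordForm ![0, 5, 6] + coordForm ![1, 3, 5]
    - coordForm ![1, 4, 6] - coordForm ![2, 3, 6] - coordForm ![2, 4, 5]

/-- The compact group `G₂ ⊂ SO(7)`. -/
def G2 : Set (Euc 7 →L[ℝ] Euc 7) := stabilizer g2Form

/-- The Cayley `4`-form
`e¹²³⁴ + e¹²⁵⁶ + e¹²⁷⁸ + e¹³⁵⁷ - e¹³⁶⁸ - e¹⁴⁵⁸ - e¹⁴⁶⁷ - e²³⁵⁸ - e²³⁶⁷ - e²⁴⁵⁷ + e²⁴⁶⁸ + e³⁴⁵⁶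
+ e³⁴⁷⁸ + e⁵⁶⁷⁸` on `ℝ⁸`, with stabiliser `Spin(7)`. -/
noncomputable def cayleyForm : Euc 8 [⋀^Fin 4]→L[ℝ] ℝ :=
  coordForm ![0, 1, 2, 3] + coordForm ![0, 1, 4, 5] + coordForm ![0, 1, 6, 7]
    + coordForm ![0, 2, 4, 6] - coordForm ![0, 2, 5, 7] - coordForm ![0, 3, 4, 7]
    - coordForm ![0, 3, 5, 6] - coordForm ![1, 2, 4, 7] - coordForm ![1, 2, 5, 6]
    - coordForm ![1, 3, 4, 6] + coordForm ![1, 3, 5, 7] + coordForm ![2, 3, 4, 5]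
    + coordForm ![2, 3, 6, 7] + coordForm ![4, 5, 6, 7]

/-- The compact group `Spin(7) ⊂ SO(8)`. -/
def Spin7 : Set (Euc 8 →L[ℝ] Euc 8) := stabilizer cayleyForm

/-- The `PSU(3)`-invariant form
`ρ = e¹²³ + ½ e¹(e⁴⁷ - e⁵⁶) + ½ e²(e⁴⁶ + e⁵⁷) + ½ e³(e⁴⁵ - e⁶⁷) + (√3/2) e⁸(e⁴⁵ + e⁶⁷)` on `ℝ⁸`,
that is `ρ(X, Y, Z) = ⟨[X, Y], Z⟩` on `𝔰𝔲(3)` with the Gell-Mann basis. -/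
noncomputable def rho : Euc 8 [⋀^Fin 3]→L[ℝ] ℝ :=
  coordForm ![0, 1, 2]
    + (1 / 2 : ℝ) • (coordForm ![0, 3, 6] - coordForm ![0, 4, 5])
    + (1 / 2 : ℝ) • (coordForm ![1, 3, 5] + coordForm ![1, 4, 6])
    + (1 / 2 : ℝ) • (coordForm ![2, 3, 4] - coordForm ![2, 5, 6])
    + (√3 / 2 : ℝ) • (coordForm ![7, 3, 4] + coordForm ![7, 5, 6])

/-- The Hodge dual `*ρ ∈ Λ⁵ℝ⁸`. -/
noncomputable def starRho : Euc 8 [⋀^Fin 5]→L[ℝ] ℝ := hodgeStar (p := 3) (q := 5) rho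

/-! ### Exterior differential systems on a manifold without boundary -/

section EDS

variable {E : Type*} [NormedAddCommGroup E] [NormedSpace ℝ E]
  {H : Type*} [TopologicalSpace H] (I : ModelWithCorners ℝ E H)
  (P : Type*) [TopologicalSpace P] [ChartedSpace H P]

/-- Differential `k`-forms on `P`, without any regularity. -/
abbrev MForm (k : ℕ) := ∀ p : P, TangentSpace I p [⋀^Fin k]→L[ℝ] ℝ

variable {I P}

/-- The expression of a form in the preferred chart at `p`. -/
noncomputable def MForm.inChart {k : ℕ} (α : MForm I P k) (p : P) : E → E [⋀^Fin k]→L[ℝ] ℝ :=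
  fun y => (α ((extChartAt I p).symm y)).compContinuousLinearMap
    (mfderiv 𝓘(ℝ, E) I (extChartAt I p).symm y)

/-- The form is of class `C^∞`. -/
def MForm.IsSmooth {k : ℕ} (α : MForm I P k) : Prop :=
  ∀ p : P, ContDiffAt ℝ ∞ (α.inChart p) (extChartAt I p p)

/-- The exterior derivative, computed in the preferred chart at each point. -/
noncomputable def MForm.d {k : ℕ} (α : MForm I P k) : MForm I P (k + 1) := fun p =>
  (extDeriv (α.inChart p) (extChartAt I p p)).compContinuousLinearMap
    (mfderiv I 𝓘(ℝ, E) (extChartAt I p) p)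

/-- The homogeneous part of degree `m` of the ideal of `Ω(P)` generated by a set of homogeneous
forms. -/
noncomputable def generatedIdeal (S : ∀ k, MForm I P k → Prop) (m : ℕ) :
    Submodule ℝ (MForm I P m) :=
  Submodule.span ℝ {η | ∃ (p q : ℕ) (h : p + q = m) (γ : MForm I P p) (β : MForm I P q),
    γ.IsSmooth ∧ S q β ∧ η = fun x => wedge h (γ x) (β x)}

/-- `F` is an integral element at `p` of the exterior differential system `𝓘`: all forms in the
ideal restrict to zero on `F`. -/
def IsIntegralElement (𝓘 : ∀ k, Submodule ℝ (MForm I P k)) (p : P)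
    (F : Submodule ℝ (TangentSpace I p)) : Prop :=
  ∀ k, ∀ η ∈ 𝓘 k, ∀ v : Fin k → TangentSpace I p, (∀ i, v i ∈ F) → η p v = 0

variable (I P) in
/-- The Grassmannian bundle `Gr_k(TP)`. -/
structure Gr (k : ℕ) where
  base : P
  space : Submodule ℝ (TangentSpace I base)
  finrank_space : Module.finrank ℝ space = k

variable (I P) in
/-- The bundle of injective linear maps `ℝᵏ → T_pP`, with its topology as a subspace of the vector
bundle `Hom(ℝᵏ, TP)`. -/
abbrev KFrame [IsManifold I 1 P] (k : ℕ) :=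
  {w : Bundle.TotalSpace ((Fin k → ℝ) →L[ℝ] E)
    (fun p : P => Bundle.Trivial P (Fin k → ℝ) p →L[ℝ] TangentSpace I p) //
      Function.Injective w.2}

/-- The span of a `k`-frame. -/
noncomputable def KFrame.toGr [IsManifold I 1 P] {k : ℕ} (w : KFrame I P k) : Gr I P k where
  base := w.1.1
  space := LinearMap.range (w.1.2 : (Fin k → ℝ) →ₗ[ℝ] TangentSpace I w.1.1)
  finrank_space := by
    rw [LinearMap.finrank_range_of_inj w.2]
    simp

/-- The topology of `Gr_k(TP)`: the quotient topology from the bundle of `k`-frames. -/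
noncomputable instance [IsManifold I 1 P] (k : ℕ) : TopologicalSpace (Gr I P k) :=
  TopologicalSpace.coinduced (KFrame.toGr (I := I) (P := P) (k := k)) inferInstance

/-- The polar equations of `F ∈ Gr_k(TP)`: the `1`-forms `(v₁ ∧ ⋯ ∧ v_k) ⌟ η_p` with
`v₁, …, v_k ∈ F` and `η` in the ideal. -/
noncomputable def polarEquations (𝓘 : ∀ k, Submodule ℝ (MForm I P k)) {k : ℕ} (F : Gr I P k) :
    Submodule ℝ (Module.Dual ℝ (TangentSpace I F.base)) :=
  Submodule.span ℝ {ξ | ∃ η ∈ 𝓘 (k + 1), ∃ v : Fin k → TangentSpace I F.base,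
    (∀ i, v i ∈ F.space) ∧
      ∀ w, ξ w = η F.base (Fin.snoc (α := fun _ => TangentSpace I F.base) v w)}

/-- An `n`-dimensional integral element at `p` is ordinary if it is the terminus of an ordinary flag
`0 = W₀ ⊂ ⋯ ⊂ W_n`: for each `k < n` the dimension of the polar equations is constant on the
integral elements in a neighbourhood of `W_k` in `Gr_k(TP)`. -/
def IsOrdinary [IsManifold I 1 P] (𝓘 : ∀ k, Submodule ℝ (MForm I P k)) (n : ℕ) (p : P)
    (F : Submodule ℝ (TangentSpace I p)) : Prop :=
  IsIntegralElement 𝓘 p F ∧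
  ∃ (W : Fin (n + 1) → Submodule ℝ (TangentSpace I p))
    (hW : ∀ k, Module.finrank ℝ (W k) = (k : ℕ)),
    Monotone W ∧ W (Fin.last n) = F ∧
    ∀ k : Fin n, ∀ᶠ F' in 𝓝 (⟨p, W k.castSucc, hW k.castSucc⟩ : Gr I P k),
      IsIntegralElement 𝓘 F'.base F'.space →
        Module.finrank ℝ (polarEquations 𝓘 F') =
          Module.finrank ℝ (polarEquations 𝓘 (⟨p, W k.castSucc, hW k.castSucc⟩ : Gr I P k))

end EDS

/-! ### The frame bundle and the system `𝓘_{A,f}` -/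

section Frame

variable (n : ℕ) (M : Type*) [TopologicalSpace M] [ChartedSpace (Euc n) M] [IsManifold (𝓡 n) ω M]

/-- The vector bundle `Hom(ℝⁿ, TM)`. -/
abbrev HomBundle := Bundle.TotalSpace (Euc n →L[ℝ] Euc n)
  (fun x : M => Bundle.Trivial M (Euc n) x →L[ℝ] TangentSpace (𝓡 n) x)

/-- The model with corners of `Hom(ℝⁿ, TM)` and of the frame bundle. -/
noncomputable abbrev frameModel := (𝓡 n).prod 𝓘(ℝ, Euc n →L[ℝ] Euc n)

theorem isOpen_invertible : IsOpen {u : HomBundle n M | u.2.IsInvertible} := by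
  rw [isOpen_iff_mem_nhds]
  intro u hu
  set e := trivializationAt (Euc n →L[ℝ] Euc n)
    (fun x : M => Bundle.Trivial M (Euc n) x →L[ℝ] TangentSpace (𝓡 n) x) u.1 with he
  have hue : u ∈ e.source := by
    rw [e.mem_source]; exact FiberBundle.mem_baseSet_trivializationAt' u.1
  have key : ∀ w : HomBundle n M, w ∈ e.source → (w.2.IsInvertible ↔ (e w).2.IsInvertible) := by
    intro w hw
    have hw' : w.1 ∈ (trivializationAt (Euc n) (Bundle.Trivial M (Euc n)) u.1).baseSet ∧
        w.1 ∈ (trivializationAt (Euc n) (TangentSpace (𝓡 n) : M → Type _) u.1).baseSet := by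
      simpa [he] using hw
    rw [he, hom_trivializationAt_apply]
    simp only
    rw [ContinuousLinearMap.inCoordinates_eq hw'.1 hw'.2]
    simp
  have hopen : IsOpen {g : Euc n →L[ℝ] Euc n | g.IsInvertible} :=
    ContinuousLinearEquiv.isOpen (𝕜 := ℝ) (E := Euc n) (F := Euc n)
  have h1 : e.source ∩ e ⁻¹' (Prod.snd ⁻¹' {g | g.IsInvertible}) ∈ 𝓝 u :=
    (e.continuousOn_toFun.isOpen_inter_preimage e.open_source
      (hopen.preimage continuous_snd)).mem_nhds ⟨hue, (key u hue).1 hu⟩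
  filter_upwards [h1] with w hw
  exact (key w hw.1).2 hw.2

/-- The bundle of frames `u : ℝⁿ ≃ T_xM`, an open submanifold of `Hom(ℝⁿ, TM)`. -/
def FrameBundle : TopologicalSpace.Opens (HomBundle n M) where
  carrier := {u | u.2.IsInvertible}
  is_open' := isOpen_invertible n M

variable {n M}

/-- The differential of the projection `π : F → M` of the frame bundle. -/
noncomputable def dProj (u : FrameBundle n M) :
    TangentSpace (frameModel n) u →L[ℝ] TangentSpace (𝓡 n) u.1.1 :=
  mfderiv (frameModel n) (𝓡 n) (fun w : FrameBundle n M => w.1.1) u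

/-- The tautological `T`-valued form `θ_u = u⁻¹ ∘ dπ_u` of the frame bundle. -/
noncomputable def tautologicalForm (u : FrameBundle n M) :
    TangentSpace (frameModel n) u →L[ℝ] Euc n :=
  (ContinuousLinearMap.inverse u.1.2 : TangentSpace (𝓡 n) u.1.1 →L[ℝ] Euc n) ∘L dProj u

variable (M) in
/-- The map `ι : Λ*T → Ω(F)`. -/
noncomputable def iota {p : ℕ} (α : Euc n [⋀^Fin p]→L[ℝ] ℝ) :
    MForm (frameModel n) (FrameBundle n M) p :=
  fun u => α.compContinuousLinearMap (tautologicalForm u)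

variable (M) in
/-- The generators `dι(α) - ι(f(α))` and `dι(f(α))`, `α ∈ A` homogeneous. -/
inductive IsGenerator (A : GradedSubspace n) (f : ∀ p, A p →ₗ[ℝ] A (p + 1)) :
    ∀ k, MForm (frameModel n) (FrameBundle n M) k → Prop
  | structureEq (p : ℕ) (α : A p) :
      IsGenerator A f (p + 1) ((iota M α.1).d - iota M (f p α).1)
  | derivedEq (p : ℕ) (α : A p) :
      IsGenerator A f (p + 1 + 1) (iota M (f p α).1).d

variable (M) in
/-- The exterior differential system `𝓘_{A,f}(F)` on the frame bundle `F` of `M`. -/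
noncomputable def frameEDS (A : GradedSubspace n) (f : ∀ p, A p →ₗ[ℝ] A (p + 1)) (k : ℕ) :
    Submodule ℝ (MForm (frameModel n) (FrameBundle n M) k) :=
  generatedIdeal (IsGenerator M A f) k

/-- `V_n(𝓘)` at `u`: the `n`-dimensional integral elements at `u` that are transverse to `π`. -/
def IsTransverseIntegral (𝓘 : ∀ k, Submodule ℝ (MForm (frameModel n) (FrameBundle n M) k))
    (u : FrameBundle n M) (F : Submodule ℝ (TangentSpace (frameModel n) u)) : Prop :=
  Module.finrank ℝ F = n ∧ (∀ v ∈ F, dProj u v = 0 → v = 0) ∧ IsIntegralElement 𝓘 u F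

/-- The system `𝓘` on the frame bundle, with transversality to `π` as independence condition, is
involutive: over every point of `F` there is a `π`-transverse `n`-dimensional integral element, and
each such element is ordinary. -/
def IsInvolutive (𝓘 : ∀ k, Submodule ℝ (MForm (frameModel n) (FrameBundle n M) k)) : Prop :=
  ∀ u : FrameBundle n M, (∃ F, IsTransverseIntegral 𝓘 u F) ∧
    ∀ F, IsTransverseIntegral 𝓘 u F → IsOrdinary 𝓘 n u F

end Frame

/-- `𝓘_{A,f}(F)` is involutive for the frame bundle `F` of every real analytic (Hausdorff)
`n`-manifold. -/
def InvolutiveOnAllManifolds {n : ℕ} (A : GradedSubspace n) (f : ∀ p, A p →ₗ[ℝ] A (p + 1)) : Prop :=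
  ∀ (M : Type u) [TopologicalSpace M] [T2Space M] [ChartedSpace (Euc n) M] [IsManifold (𝓡 n) ω M],
    IsInvolutive (frameEDS M A f)

/-- For every differential operator `f` on `A` that extends to a derivation of degree one of
`Λ*ℝⁿ`, the system `𝓘_{A,f}(F)` is involutive for every real analytic `n`-manifold. -/
def InvolutiveForAllOperators {n : ℕ} (A : GradedSubspace n) : Prop :=
  ∀ f : ∀ p, A p →ₗ[ℝ] A (p + 1), IsDifferentialOperator A f → ExtendsToDerivation A f →
    InvolutiveOnAllManifolds.{u} A f

end DGAGeometry

/-!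
Everything reduces to linear algebra on `T = ℝⁿ`. In the frame bundle a chart provides vertical
components `ω` such that the tangent spaces are `T × 𝔤𝔩(T)` by `(θ, ω)` and
`dι(α) = ∑ᵢ (-1)ⁱ (ω(vᵢ) · α)(θ v₀, …, θ v̂ᵢ, …, θ v_p)` (`exists_structureEquations`). If `f` extends
to a derivation, this derivation is the alternation of some `ω₀ : T → 𝔤𝔩(T)`
(`exists_torsion_of_derivation`), and after the change of coframe `ω ↦ ω - ω₀(θ)` the generators of
`𝓘_{A,f}` look as for `f = 0` (`exists_coframe`). The horizontal space of this coframe is therefore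
an integral element, and all transverse ones are the graphs of the maps `δ : T → 𝔤𝔩(T)` with
`torsion δ α = 0` for `α ∈ A`, the space `closedConnections A`. The polar space of an integral element
over `W ⊆ T` is governed by `polarKernel A W`, the endomorphisms `B` such that `B · α` vanishes on `W`
for all `α ∈ A`.

Cartan's test says that `dim (closedConnections A) ≤ ∑ dim (polarKernel A W_j)`, `j < n`, for every
flag `W_j` of `T`. A flag with equality is called regular. For such a flag, integral elements over
`W_j` extend to integral elements over `T` (`exists_extension`), so that the rank of their polar
equations depends on `W_j` only (`polarSpace_iff`). As the dimension of `polarKernel` is upper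
semicontinuous, nearby flags are regular with the same ranks (`exists_isOpen_regular`). Since a
transverse integral element is isomorphic to `T` by `θ`, one regular flag in `T` makes all of them
ordinary (`isInvolutive_frameEDS`). The theorem thus follows from a regular flag for each `A`.

For `ρ`, `*ρ`, `Spin(7)`, `Sp(2)Sp(1)` and `G₂` the relevant forms have, in a suitable basis, integral
coefficients up to a common factor, and the flag of this basis is regular: explicit dual families of
endomorphisms bound the polar kernels from above, while the number of equations bounds the space of
closed connections from below (`isRegularFlag_of_functionals`). For `G₂` seven linear relations
between the torsions of `φ` and `*φ` have to be taken into account (`g2_torsion_identity`). That the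
groups have no further invariant forms in degrees other than `0` and `n`, which contribute nothing,
is seen from their signed permutations and, for `Sp(2)Sp(1)`, one rotation by `π/4`.

For `SU(k)` the flag of the basis `e_1, …, e_k, ie_1, …, ie_k`, completed in odd dimension, is regular
(`isRegularFlag_su`). The Kähler form and the holomorphic volume form restrict the polar directions
so much that each of them is, up to symmetric connections, which have no torsion, the value of a
connection with values in `𝔰𝔲(k)`, and such connections are closed (`isRegularFlag_of_tableau`).
-/

namespace DGAGeometry

/-! ### The frame bundle in coordinates -/

section DerivationAction

variable {E : Type*} [NormedAddCommGroup E] [NormedSpace ℝ E]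

/-- The derivation action `(B, α) ↦ ∑ᵢ α(…, B xᵢ, …)` of endomorphisms on forms. -/
noncomputable def act {p : ℕ} (α : E [⋀^Fin p]→L[ℝ] ℝ) :
    (E →L[ℝ] E) →L[ℝ] E [⋀^Fin p]→L[ℝ] ℝ :=
  α.fderivCompContinuousLinearMap (.id ℝ _)

theorem act_apply {p : ℕ} (α : E [⋀^Fin p]→L[ℝ] ℝ) (B : E →L[ℝ] E)
    (v : Fin p → E) : act α B v = ∑ i, α (Function.update v i (B (v i))) := by
  rw [act, ContinuousAlternatingMap.fderivCompContinuousLinearMap_apply]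
  refine Finset.sum_congr rfl fun i _ => congrArg α (funext fun j => ?_)
  rcases eq_or_ne j i with rfl | h
  · simp
  · simp [h]

end DerivationAction

section FrameCoordinates

variable {n : ℕ} {M : Type*} [TopologicalSpace M] [ChartedSpace (Euc n) M]
  [IsManifold (𝓡 n) ω M]

/-- The matrix of the frame `w` in the chart of `M` at the base point of `u₀`. -/
noncomputable def frameCoord (u₀ w : FrameBundle n M) : Euc n →L[ℝ] Euc n :=
  (trivializationAt (Euc n →L[ℝ] Euc n)
    (fun x : M => Bundle.Trivial M (Euc n) x →L[ℝ] TangentSpace (𝓡 n) x) u₀.1.1 w.1).2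

theorem extChartAt_frameBundle (u₀ w : FrameBundle n M) :
    extChartAt (frameModel n) u₀ w = (extChartAt (𝓡 n) u₀.1.1 w.1.1, frameCoord u₀ w) := by
  have h := FiberBundle.extChartAt (IB := 𝓡 n) (F := Euc n →L[ℝ] Euc n)
    (E := fun x : M => Bundle.Trivial M (Euc n) x →L[ℝ] TangentSpace (𝓡 n) x) u₀.1
  have h2 : extChartAt (frameModel n) u₀ w = extChartAt (frameModel n) u₀.1 w.1 := rfl
  rw [h2, h]
  rfl

theorem mem_extChartAt_source_frameBundle (u₀ w : FrameBundle n M) :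
    w ∈ (extChartAt (frameModel n) u₀).source ↔ w.1.1 ∈ (chartAt (Euc n) u₀.1.1).source := by
  rw [extChartAt_source, TopologicalSpace.Opens.chartAt_eq,
    OpenPartialHomeomorph.subtypeRestr_source, Set.mem_preimage, FiberBundle.chartedSpace_chartAt]
  simp
  exact id

theorem frameCoord_eq {u₀ w : FrameBundle n M} (hw : w.1.1 ∈ (chartAt (Euc n) u₀.1.1).source) :
    frameCoord u₀ w = (mfderiv (𝓡 n) 𝓘(ℝ, Euc n) (extChartAt (𝓡 n) u₀.1.1) w.1.1 :
      TangentSpace (𝓡 n) w.1.1 →L[ℝ] Euc n) ∘L (w.1.2 : Euc n →L[ℝ] TangentSpace (𝓡 n) w.1.1) := by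
  have : IsManifold (𝓡 n) 1 M := IsManifold.of_le (n := ω) le_top
  rw [← TangentBundle.continuousLinearMapAt_trivializationAt hw]
  ext1 v
  rw [frameCoord, hom_trivializationAt_apply]
  simp [ContinuousLinearMap.inCoordinates]
  rfl

theorem mdifferentiable_proj :
    MDifferentiable (frameModel n) (𝓡 n) (fun w : FrameBundle n M => w.1.1) := by
  have h1 : ContMDiff (frameModel n) (𝓡 n) 1 (fun w : HomBundle n M => w.1) :=
    Bundle.contMDiff_proj _
  have h2 : ContMDiff (frameModel n) (frameModel n) 1
    (Subtype.val : FrameBundle n M → HomBundle n M) := contMDiff_subtype_val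
  exact (h1.comp h2).mdifferentiable one_ne_zero

theorem mfderiv_extChartAt_comp_dProj {u₀ w : FrameBundle n M}
    (hw : w.1.1 ∈ (chartAt (Euc n) u₀.1.1).source) :
    (mfderiv (𝓡 n) 𝓘(ℝ, Euc n) (extChartAt (𝓡 n) u₀.1.1) w.1.1 :
      TangentSpace (𝓡 n) w.1.1 →L[ℝ] Euc n) ∘L dProj w =
    (ContinuousLinearMap.fst ℝ (Euc n) (Euc n →L[ℝ] Euc n)) ∘L
      (mfderiv (frameModel n) 𝓘(ℝ, Euc n × (Euc n →L[ℝ] Euc n))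
        (extChartAt (frameModel n) u₀) w :
        TangentSpace (frameModel n) w →L[ℝ] Euc n × (Euc n →L[ℝ] Euc n)) := by
  have : IsManifold (𝓡 n) 1 M := IsManifold.of_le (n := ω) le_top
  have hw' : w ∈ (chartAt (ModelProd (Euc n) (Euc n →L[ℝ] Euc n)) u₀).source := by
    rw [← extChartAt_source (frameModel n)]
    exact (mem_extChartAt_source_frameBundle u₀ w).2 hw
  have h1 := mfderiv_comp w (mdifferentiableAt_extChartAt (I := 𝓡 n) hw)
    (mdifferentiable_proj (n := n) (M := M) w)
  have h2 := mfderiv_comp w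
    ((ContinuousLinearMap.fst ℝ (Euc n) (Euc n →L[ℝ] Euc n)).differentiableAt.mdifferentiableAt)
    (mdifferentiableAt_extChartAt (I := frameModel n) hw')
  have h3 : (extChartAt (𝓡 n) u₀.1.1 ∘ fun w : FrameBundle n M => w.1.1) =
      (ContinuousLinearMap.fst ℝ (Euc n) (Euc n →L[ℝ] Euc n)) ∘
        extChartAt (frameModel n) u₀ := by
    funext z
    rw [Function.comp_apply, Function.comp_apply, extChartAt_frameBundle]
    rfl
  rw [h3, h2] at h1
  rw [mfderiv_eq_fderiv, ContinuousLinearMap.fderiv] at h1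
  exact h1.symm

theorem isInvertible_frameCoord {u₀ w : FrameBundle n M}
    (hw : w.1.1 ∈ (chartAt (Euc n) u₀.1.1).source) : (frameCoord u₀ w).IsInvertible := by
  have : IsManifold (𝓡 n) 1 M := IsManifold.of_le (n := ω) le_top
  rw [frameCoord_eq hw]
  have h := isInvertible_mfderiv_extChartAt (I := 𝓡 n) (x := u₀.1.1) (y := w.1.1)
    (by rwa [extChartAt_source])
  exact h.comp w.2

theorem tautologicalForm_eq {u₀ w : FrameBundle n M}
    (hw : w.1.1 ∈ (chartAt (Euc n) u₀.1.1).source) :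
    tautologicalForm w = (frameCoord u₀ w).inverse ∘L
      (ContinuousLinearMap.fst ℝ (Euc n) (Euc n →L[ℝ] Euc n)) ∘L
      (mfderiv (frameModel n) 𝓘(ℝ, Euc n × (Euc n →L[ℝ] Euc n))
        (extChartAt (frameModel n) u₀) w :
        TangentSpace (frameModel n) w →L[ℝ] Euc n × (Euc n →L[ℝ] Euc n)) := by
  have : IsManifold (𝓡 n) 1 M := IsManifold.of_le (n := ω) le_top
  ext1 v
  refine ((isInvertible_frameCoord hw).inverse_apply_eq.2 ?_).symm
  have h1 : (w.1.2 : Euc n →L[ℝ] TangentSpace (𝓡 n) w.1.1) (tautologicalForm w v) = dProj w v :=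
    ((ContinuousLinearMap.IsInvertible.inverse_apply_eq (f := w.1.2) w.2).1 rfl).symm
  have h2 := DFunLike.congr_fun (mfderiv_extChartAt_comp_dProj hw) v
  have h3 := DFunLike.congr_fun (frameCoord_eq hw) (tautologicalForm w v)
  rw [h3]
  refine h2.symm.trans ?_
  exact congrArg (mfderiv (𝓡 n) 𝓘(ℝ, Euc n) (extChartAt (𝓡 n) u₀.1.1) w.1.1) h1.symm

/-- Evaluation of alternating forms on the tuples of vectors of a finite basis. -/
noncomputable def evalBasis {E ι : Type*} [AddCommGroup E] [Module ℝ E] [TopologicalSpace E]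
    (b : Module.Basis ι ℝ E) (k : ℕ) : (E [⋀^Fin k]→L[ℝ] ℝ) →ₗ[ℝ] ((Fin k → ι) → ℝ) where
  toFun α s := α (fun i => b (s i))
  map_add' _ _ := rfl
  map_smul' _ _ := rfl

theorem evalBasis_injective {E ι : Type*} [AddCommGroup E] [Module ℝ E] [TopologicalSpace E]
    (b : Module.Basis ι ℝ E) (k : ℕ) : Function.Injective (evalBasis b k) := by
  intro α β h
  refine ContinuousAlternatingMap.toAlternatingMap_injective ?_
  exact b.ext_alternating fun v _ => congrFun h v

/-- On a finite-dimensional space a map into alternating forms is smooth as soon as its values on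
all tuples of vectors are. -/
theorem contDiffAt_of_forall_apply {X E : Type*} [NormedAddCommGroup X] [NormedSpace ℝ X]
    [NormedAddCommGroup E] [NormedSpace ℝ E] [FiniteDimensional ℝ E] {k : ℕ} {m : ℕ∞ω}
    {h : X → E [⋀^Fin k]→L[ℝ] ℝ} {x : X} (H : ∀ v, ContDiffAt ℝ m (fun y => h y v) x) :
    ContDiffAt ℝ m h x := by
  let b := Module.finBasis ℝ E
  let L := evalBasis b k
  have hL : LinearMap.ker L = ⊥ := LinearMap.ker_eq_bot.2 (evalBasis_injective b k)
  obtain ⟨g, hg⟩ := LinearMap.exists_leftInverse_of_injective L hL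
  have h1 : h = fun y => (LinearMap.toContinuousLinearMap g) (L (h y)) := by
    funext y
    exact (LinearMap.congr_fun hg (h y)).symm
  rw [h1]
  refine (LinearMap.toContinuousLinearMap g).contDiff.contDiffAt.comp x ?_
  exact contDiffAt_pi.2 fun s => H _

/-- In the frame coordinates `(y, g)` the tautological form is `g⁻¹ dy`. -/
theorem inChart_iota (u₀ : FrameBundle n M) {p : ℕ} (α : Euc n [⋀^Fin p]→L[ℝ] ℝ)
    {y : Euc n × (Euc n →L[ℝ] Euc n)} (hy : y ∈ (extChartAt (frameModel n) u₀).target) :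
    (iota M α).inChart u₀ y = α.compContinuousLinearMap
      (y.2.inverse ∘L ContinuousLinearMap.fst ℝ (Euc n) (Euc n →L[ℝ] Euc n)) := by
  set w := (extChartAt (frameModel n) u₀).symm y with hwdef
  have hw : w ∈ (extChartAt (frameModel n) u₀).source :=
    (extChartAt (frameModel n) u₀).map_target hy
  have hw' := (mem_extChartAt_source_frameBundle u₀ w).1 hw
  have hgy : frameCoord u₀ w = y.2 := by
    have h := extChartAt_frameBundle u₀ w
    rw [hwdef, (extChartAt (frameModel n) u₀).right_inv hy, ← hwdef] at h
    rw [h]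
  have hid := mfderiv_extChartAt_comp_mfderivWithin_extChartAt_symm (I := frameModel n) hy
  rw [ModelWithCorners.range_eq_univ, mfderivWithin_univ] at hid
  ext v
  refine congrArg α (funext fun i => ?_)
  have h1 := DFunLike.congr_fun hid (v i)
  change tautologicalForm w _ = _
  rw [tautologicalForm_eq hw', hgy]
  exact congrArg (fun z : Euc n × (Euc n →L[ℝ] Euc n) => y.2.inverse z.1) h1

theorem mem_target_nhds (u₀ : FrameBundle n M) :
    ∀ᶠ y in 𝓝 (extChartAt (frameModel n) u₀ u₀), y ∈ (extChartAt (frameModel n) u₀).target :=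
  extChartAt_target_mem_nhds u₀

theorem isInvertible_snd_extChartAt (u₀ : FrameBundle n M) :
    (extChartAt (frameModel n) u₀ u₀).2.IsInvertible := by
  rw [extChartAt_frameBundle]
  exact isInvertible_frameCoord (mem_chart_source _ _)

theorem contDiffAt_coframe (y₀ : Euc n × (Euc n →L[ℝ] Euc n)) (hy : y₀.2.IsInvertible)
    {m : ℕ∞ω} : ContDiffAt ℝ m (fun y : Euc n × (Euc n →L[ℝ] Euc n) =>
      y.2.inverse ∘L ContinuousLinearMap.fst ℝ (Euc n) (Euc n →L[ℝ] Euc n)) y₀ := by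
  have h : ContDiffAt ℝ m (fun y : Euc n × (Euc n →L[ℝ] Euc n) => y.2.inverse) y₀ :=
    (ContinuousLinearMap.IsInvertible.contDiffAt_map_inverse hy).comp y₀ contDiffAt_snd
  exact h.clm_comp contDiffAt_const

theorem isSmooth_iota {p : ℕ} (α : Euc n [⋀^Fin p]→L[ℝ] ℝ) : (iota M α).IsSmooth := by
  intro u
  have h : (iota M α).inChart u =ᶠ[𝓝 (extChartAt (frameModel n) u u)]
      fun y : Euc n × (Euc n →L[ℝ] Euc n) => α.compContinuousLinearMap
      (y.2.inverse ∘L ContinuousLinearMap.fst ℝ (Euc n) (Euc n →L[ℝ] Euc n)) := by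
    filter_upwards [mem_target_nhds u] with y hy using inChart_iota u α hy
  refine ContDiffAt.congr_of_eventuallyEq ?_ h
  refine contDiffAt_of_forall_apply fun v => ?_
  simp only [ContinuousAlternatingMap.compContinuousLinearMap_apply]
  refine (ContinuousMultilinearMap.contDiff α.toContinuousMultilinearMap).contDiffAt.comp _ ?_
  refine contDiffAt_pi.2 fun i => ?_
  exact (contDiffAt_coframe _ (isInvertible_snd_extChartAt u)).clm_apply contDiffAt_const

end FrameCoordinates

/-! ### Frames of planes -/

section KFrames

variable {E : Type*} [NormedAddCommGroup E] [NormedSpace ℝ E]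
  {H : Type*} [TopologicalSpace H] {I : ModelWithCorners ℝ E H}
  {P : Type*} [TopologicalSpace P] [ChartedSpace H P] [IsManifold I 1 P]

theorem KFrame.continuous_base (k : ℕ) : Continuous fun w : KFrame I P k => w.1.1 :=
  (FiberBundle.continuous_proj _ _).comp continuous_subtype_val

theorem KFrame.continuousAt_inChart {k : ℕ} (w₀ : KFrame I P k) :
    ContinuousAt (fun w : KFrame I P k =>
      ((mfderiv I 𝓘(ℝ, E) (extChartAt I w₀.1.1) w.1.1 : TangentSpace I w.1.1 →L[ℝ] E) ∘L
        (w.1.2 : (Fin k → ℝ) →L[ℝ] TangentSpace I w.1.1) : (Fin k → ℝ) →L[ℝ] E)) w₀ := by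
  set e := trivializationAt ((Fin k → ℝ) →L[ℝ] E)
    (fun p : P => Bundle.Trivial P (Fin k → ℝ) p →L[ℝ] TangentSpace I p) w₀.1.1 with he
  have he2 : ContinuousAt (fun w : KFrame I P k => (e w.1).2) w₀ := by
    have h : w₀.1 ∈ e.source := by
      rw [e.mem_source]; exact FiberBundle.mem_baseSet_trivializationAt' w₀.1.1
    exact (ContinuousAt.comp (f := fun w : KFrame I P k => w.1) (e.continuousAt h)
      continuous_subtype_val.continuousAt).snd
  refine he2.congr ?_
  have hsrc : ∀ᶠ w : KFrame I P k in 𝓝 w₀, w.1.1 ∈ (chartAt H w₀.1.1).source :=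
    (KFrame.continuous_base k).continuousAt.eventually
      ((chartAt H w₀.1.1).open_source.mem_nhds (mem_chart_source _ _))
  filter_upwards [hsrc] with w hw
  rw [he, hom_trivializationAt_apply, ← TangentBundle.continuousLinearMapAt_trivializationAt hw]
  ext1 v
  simp [ContinuousLinearMap.inCoordinates]

end KFrames

/-! ### The structure equations of the forms `ι(α)` -/

section StructureEquations

variable {n : ℕ} {M : Type*} [TopologicalSpace M] [ChartedSpace (Euc n) M]
  [IsManifold (𝓡 n) ω M]

theorem hasFDerivAt_coframe (y₀ : Euc n × (Euc n →L[ℝ] Euc n)) (hy : y₀.2.IsInvertible) :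
    ∃ L : Euc n × (Euc n →L[ℝ] Euc n) →L[ℝ] (Euc n × (Euc n →L[ℝ] Euc n) →L[ℝ] Euc n),
    HasFDerivAt (fun y : Euc n × (Euc n →L[ℝ] Euc n) =>
      y.2.inverse ∘L ContinuousLinearMap.fst ℝ (Euc n) (Euc n →L[ℝ] Euc n)) L y₀ ∧
    ∀ h v, L h v = -(y₀.2.inverse (h.2 (y₀.2.inverse v.1))) := by
  obtain ⟨e, he⟩ := hy
  have h1 := hasFDerivAt_ringInverse (𝕜 := ℝ) (ContinuousLinearEquiv.toUnit e)
  rw [ContinuousLinearMap.ringInverse_eq_inverse] at h1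
  have h0 : (ContinuousLinearEquiv.toUnit e : Euc n →L[ℝ] Euc n) = y₀.2 := he
  rw [h0] at h1
  have h2 := h1.comp y₀ (hasFDerivAt_snd (𝕜 := ℝ) (p := y₀))
  have h3 := h2.clm_comp (hasFDerivAt_const
    (ContinuousLinearMap.fst ℝ (Euc n) (Euc n →L[ℝ] Euc n)) y₀)
  refine ⟨_, h3, fun h v => ?_⟩
  have h4 : y₀.2.inverse = e.symm := by rw [← he]; exact ContinuousLinearMap.inverse_equiv e
  rw [h4]
  simp
  rfl

theorem extDeriv_coframe (y₀ : Euc n × (Euc n →L[ℝ] Euc n)) (e : Euc n ≃L[ℝ] Euc n)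
    (he : (e : Euc n →L[ℝ] Euc n) = y₀.2) {p : ℕ} (α : Euc n [⋀^Fin p]→L[ℝ] ℝ)
    (v : Fin (p + 1) → Euc n × (Euc n →L[ℝ] Euc n)) :
    extDeriv (fun y : Euc n × (Euc n →L[ℝ] Euc n) => α.compContinuousLinearMap
      (y.2.inverse ∘L ContinuousLinearMap.fst ℝ (Euc n) (Euc n →L[ℝ] Euc n))) y₀ v =
    ∑ i : Fin (p + 1), (-1 : ℝ) ^ (i : ℕ) *
      act α (-((e.symm : Euc n →L[ℝ] Euc n) ∘L (v i).2))
        (i.removeNth fun j => e.symm (v j).1) := by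
  obtain ⟨L, hL, hLv⟩ := hasFDerivAt_coframe y₀ ⟨e, he⟩
  have h4 : y₀.2.inverse = e.symm := by rw [← he]; exact ContinuousLinearMap.inverse_equiv e
  rw [extDeriv,
    ((hasFDerivAt_const α y₀).continuousAlternatingMapCompContinuousLinearMap hL).fderiv,
    ContinuousLinearMap.comp_zero, zero_add, ContinuousAlternatingMap.alternatizeUncurryFin_apply]
  refine Finset.sum_congr rfl fun i _ => ?_
  rw [zsmul_eq_mul]
  congr 1
  · simp
  · rw [act_apply]
    rw [ContinuousLinearMap.comp_apply,
      ContinuousAlternatingMap.fderivCompContinuousLinearMap_apply]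
    refine Finset.sum_congr rfl fun j _ => congrArg α (funext fun l => ?_)
    rcases eq_or_ne l j with rfl | h
    · rw [Function.update_self, Function.update_self, hLv, h4]
      simp [Fin.removeNth]
    · rw [Function.update_of_ne h, Function.update_of_ne h, h4]
      simp [Fin.removeNth]

theorem exists_equiv_prod {X : Type*} [AddCommGroup X] [Module ℝ X]
    (D : X ≃ₗ[ℝ] Euc n × (Euc n →L[ℝ] Euc n)) (e : Euc n ≃L[ℝ] Euc n) :
    ∃ Ψ : X ≃ₗ[ℝ] Euc n × (Euc n →L[ℝ] Euc n), ∀ v, (Ψ v).1 = e.symm (D v).1 ∧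
      (Ψ v).2 = -((e.symm : Euc n →L[ℝ] Euc n) ∘L (D v).2) := by
  let Λ : (Euc n →L[ℝ] Euc n) ≃ₗ[ℝ] (Euc n →L[ℝ] Euc n) :=
    { toFun := fun h => -((e.symm : Euc n →L[ℝ] Euc n) ∘L h)
      invFun := fun h => -((e : Euc n →L[ℝ] Euc n) ∘L h)
      map_add' := fun a b => by ext; simp; ring
      map_smul' := fun c a => by ext; simp
      left_inv := fun a => by ext; simp
      right_inv := fun a => by ext; simp }
  exact ⟨D.trans (e.symm.toLinearEquiv.prodCongr Λ), fun v => ⟨rfl, rfl⟩⟩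

/-- The differential of the chart at `u₀` of the frame bundle. -/
noncomputable def chartDeriv (u₀ w : FrameBundle n M) :
    TangentSpace (frameModel n) w →L[ℝ] Euc n × (Euc n →L[ℝ] Euc n) :=
  mfderiv (frameModel n) 𝓘(ℝ, Euc n × (Euc n →L[ℝ] Euc n)) (extChartAt (frameModel n) u₀) w

theorem tautologicalForm_apply {u₀ w : FrameBundle n M}
    (hw : w.1.1 ∈ (chartAt (Euc n) u₀.1.1).source) (v : TangentSpace (frameModel n) w) :
    tautologicalForm w v = (frameCoord u₀ w).inverse (chartDeriv u₀ w v).1 :=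
  DFunLike.congr_fun (tautologicalForm_eq hw) v

theorem exists_chartDeriv_equiv (u : FrameBundle n M) :
    ∃ D : TangentSpace (frameModel n) u ≃ₗ[ℝ] Euc n × (Euc n →L[ℝ] Euc n),
      ∀ v, D v = chartDeriv u u v := by
  obtain ⟨D, hD⟩ := isInvertible_mfderiv_extChartAt (I := frameModel n) (mem_extChartAt_source u)
  exact ⟨D.toLinearEquiv, fun v => DFunLike.congr_fun hD v⟩

theorem d_iota_apply (u : FrameBundle n M) {p : ℕ} (α : Euc n [⋀^Fin p]→L[ℝ] ℝ)
    (v : Fin (p + 1) → TangentSpace (frameModel n) u) :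
    (iota M α).d u v = extDeriv (fun y : Euc n × (Euc n →L[ℝ] Euc n) =>
      α.compContinuousLinearMap
        (y.2.inverse ∘L ContinuousLinearMap.fst ℝ (Euc n) (Euc n →L[ℝ] Euc n)))
      (extChartAt (frameModel n) u u) (fun i => chartDeriv u u (v i)) := by
  have h : (iota M α).inChart u =ᶠ[𝓝 (extChartAt (frameModel n) u u)]
      fun y : Euc n × (Euc n →L[ℝ] Euc n) => α.compContinuousLinearMap
        (y.2.inverse ∘L ContinuousLinearMap.fst ℝ (Euc n) (Euc n →L[ℝ] Euc n)) := by
    filter_upwards [mem_target_nhds u] with y hy using inChart_iota u α hy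
  rw [← h.extDeriv_eq]
  rfl

/-- The horizontal and vertical components `(θ, ω)` of the tangent vectors of the frame bundle, in
which the exterior derivative of the forms `ι(α)` has constant coefficients. The component `ω` is
minus the connection form `g⁻¹ dg` of the flat connection of a chart. -/
theorem exists_structureEquations (u : FrameBundle n M) :
    ∃ Ψ : TangentSpace (frameModel n) u ≃ₗ[ℝ] Euc n × (Euc n →L[ℝ] Euc n),
      (∀ v, (Ψ v).1 = tautologicalForm u v) ∧
      ∀ (p : ℕ) (α : Euc n [⋀^Fin p]→L[ℝ] ℝ) (v : Fin (p + 1) → TangentSpace (frameModel n) u),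
        (iota M α).d u v = ∑ i : Fin (p + 1), (-1 : ℝ) ^ (i : ℕ) *
          act α (Ψ (v i)).2 (i.removeNth fun j => tautologicalForm u (v j)) := by
  obtain ⟨D, hD⟩ := exists_chartDeriv_equiv u
  have hg : frameCoord u u = (extChartAt (frameModel n) u u).2 := by rw [extChartAt_frameBundle]
  obtain ⟨e, he⟩ := isInvertible_snd_extChartAt u
  have h4 : (frameCoord u u).inverse = e.symm := by
    rw [hg, ← he]; exact ContinuousLinearMap.inverse_equiv e
  have hθ : ∀ v, tautologicalForm u v = e.symm (D v).1 := by
    intro v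
    rw [hD, tautologicalForm_apply (mem_chart_source _ _), h4]
    rfl
  obtain ⟨Ψ, hΨ⟩ := exists_equiv_prod D e
  refine ⟨Ψ, fun v => ?_, fun p α v => ?_⟩
  · rw [hθ, (hΨ v).1]
  · rw [d_iota_apply, extDeriv_coframe _ e he]
    refine Finset.sum_congr rfl fun i _ => ?_
    rw [(hΨ (v i)).2, hD]
    simp_rw [hθ, hD]

theorem dProj_eq_zero_iff (u : FrameBundle n M) (v : TangentSpace (frameModel n) u) :
    dProj u v = 0 ↔ tautologicalForm u v = 0 := by
  have h : tautologicalForm u v = ContinuousLinearMap.inverse u.1.2 (dProj u v) := rfl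
  obtain ⟨e, he⟩ := u.2
  have h1 : (ContinuousLinearMap.inverse u.1.2 : TangentSpace (𝓡 n) u.1.1 →L[ℝ] Euc n) = e.symm := by
    rw [← he]; exact ContinuousLinearMap.inverse_equiv e
  rw [h, h1]
  exact (map_eq_zero_iff e.symm e.symm.injective).symm

end StructureEquations

/-! ### The topology of the Grassmannian bundle -/

section GrassmannTopology

variable {E : Type*} [NormedAddCommGroup E] [NormedSpace ℝ E]
  {H : Type*} [TopologicalSpace H] {I : ModelWithCorners ℝ E H}
  {P : Type*} [TopologicalSpace P] [ChartedSpace H P]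
  {T : Type*} [NormedAddCommGroup T] [NormedSpace ℝ T]

/-- A field of linear maps from the tangent spaces to a fixed space is continuous: near each point
it is a continuous function in the trivialisation given by the preferred chart. -/
def IsContinuousField (θ : ∀ p : P, TangentSpace I p →L[ℝ] T) : Prop :=
  ∀ p₀ : P, ∃ G : P → E →L[ℝ] T, ContinuousAt G p₀ ∧ ∀ᶠ p in 𝓝 p₀, ∀ v,
    θ p v = G p ((mfderiv I 𝓘(ℝ, E) (extChartAt I p₀) p : TangentSpace I p →L[ℝ] E) v)

variable [IsManifold I 1 P]

theorem KFrame.continuous_comp {θ : ∀ p : P, TangentSpace I p →L[ℝ] T} (hθ : IsContinuousField θ)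
    (k : ℕ) : Continuous fun w : KFrame I P k =>
      (θ w.1.1 ∘L (w.1.2 : (Fin k → ℝ) →L[ℝ] TangentSpace I w.1.1) : (Fin k → ℝ) →L[ℝ] T) := by
  rw [continuous_iff_continuousAt]
  intro w₀
  obtain ⟨G, hG, hG2⟩ := hθ w₀.1.1
  have h1 : ContinuousAt (fun w : KFrame I P k => G w.1.1) w₀ :=
    ContinuousAt.comp (f := fun w : KFrame I P k => w.1.1) hG (KFrame.continuous_base k).continuousAt
  refine (h1.clm_comp (KFrame.continuousAt_inChart w₀)).congr ?_
  filter_upwards [(KFrame.continuous_base k).continuousAt.eventually hG2] with w hw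
  ext1 v
  exact (hw _).symm

/-- An open condition on the `θ`-image of a `k`-frame which only depends on its span is an open
condition on `k`-planes. -/
theorem Gr.eventually_of_isOpen {θ : ∀ p : P, TangentSpace I p →L[ℝ] T} (hθ : IsContinuousField θ)
    {k : ℕ} {O : Set ((Fin k → ℝ) →L[ℝ] T)} (hO : IsOpen O)
    (hinv : ∀ X ∈ O, ∀ h : (Fin k → ℝ) ≃L[ℝ] (Fin k → ℝ), X ∘L (h : (Fin k → ℝ) →L[ℝ] _) ∈ O)
    (F₀ : Gr I P k) (w₀ : (Fin k → ℝ) →L[ℝ] TangentSpace I F₀.base)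
    (hinj : Function.Injective w₀) (hw₀ : LinearMap.range w₀.toLinearMap = F₀.space)
    (hO₀ : (θ F₀.base ∘L w₀ : (Fin k → ℝ) →L[ℝ] T) ∈ O) :
    ∀ᶠ F' in 𝓝 F₀, ∃ w : (Fin k → ℝ) →L[ℝ] TangentSpace I F'.base,
      Function.Injective w ∧ LinearMap.range w.toLinearMap = F'.space ∧
      (θ F'.base ∘L w : (Fin k → ℝ) →L[ℝ] T) ∈ O := by
  refine IsOpen.mem_nhds (s := {F' : Gr I P k | ∃ w : (Fin k → ℝ) →L[ℝ] TangentSpace I F'.base,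
      Function.Injective w ∧ LinearMap.range w.toLinearMap = F'.space ∧
      (θ F'.base ∘L w : (Fin k → ℝ) →L[ℝ] T) ∈ O}) ?_ ⟨w₀, hinj, hw₀, hO₀⟩
  rw [isOpen_coinduced]
  convert hO.preimage (KFrame.continuous_comp hθ k) using 1
  ext w
  constructor
  · rintro ⟨(w' : (Fin k → ℝ) →L[ℝ] TangentSpace I w.1.1), hinj', hr, hw'⟩
    replace hr : LinearMap.range w'.toLinearMap =
      LinearMap.range (w.1.2 : (Fin k → ℝ) →L[ℝ] TangentSpace I w.1.1).toLinearMap := hr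
    let e' := LinearEquiv.ofInjective w'.toLinearMap hinj'
    let e := LinearEquiv.ofInjective (w.1.2 : (Fin k → ℝ) →L[ℝ] TangentSpace I w.1.1).toLinearMap w.2
    let h : (Fin k → ℝ) ≃ₗ[ℝ] (Fin k → ℝ) := (e.trans (LinearEquiv.ofEq _ _ hr.symm)).trans e'.symm
    have key : ∀ v, w' (h v) = w.1.2 v := by
      intro v
      have h1 : (e' (h v) : TangentSpace I w.1.1) = (e v : TangentSpace I w.1.1) := by
        simp only [h, LinearEquiv.trans_apply, LinearEquiv.apply_symm_apply]
        rfl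
      exact h1
    have := hinv _ hw' h.toContinuousLinearEquiv
    have h2 : ((θ w.1.1 ∘L w') ∘L (h.toContinuousLinearEquiv : (Fin k → ℝ) →L[ℝ] _) :
        (Fin k → ℝ) →L[ℝ] T) = θ w.1.1 ∘L w.1.2 := by
      ext1 v
      exact congrArg (θ w.1.1) (key v)
    rw [Set.mem_preimage, ← h2]
    exact this
  · intro hw
    exact ⟨w.1.2, w.2, rfl, hw⟩

end GrassmannTopology

section FrameContinuity

variable {n : ℕ} {M : Type*} [TopologicalSpace M] [ChartedSpace (Euc n) M]
  [IsManifold (𝓡 n) ω M]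

theorem isContinuousField_tautologicalForm :
    IsContinuousField (I := frameModel n) (P := FrameBundle n M) tautologicalForm := by
  intro u₀
  refine ⟨fun u => (frameCoord u₀ u).inverse ∘L
    ContinuousLinearMap.fst ℝ (Euc n) (Euc n →L[ℝ] Euc n), ?_, ?_⟩
  · have hg : ContinuousAt (fun w : FrameBundle n M => frameCoord u₀ w) u₀ := by
      have h := (continuousAt_extChartAt (I := frameModel n) u₀).snd
      refine h.congr ?_
      filter_upwards with w
      rw [extChartAt_frameBundle]
    have h1 : (frameCoord u₀ u₀).IsInvertible := isInvertible_frameCoord (mem_chart_source _ _)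
    have h2 : ContinuousAt ContinuousLinearMap.inverse (frameCoord u₀ u₀) :=
      (ContinuousLinearMap.IsInvertible.contDiffAt_map_inverse (n := 0) (𝕜 := ℝ) h1).continuousAt
    exact (ContinuousAt.comp (f := fun w : FrameBundle n M => frameCoord u₀ w) h2 hg).clm_comp
      continuousAt_const
  · filter_upwards [extChartAt_source_mem_nhds (I := frameModel n) u₀] with w hw v
    exact tautologicalForm_apply ((mem_extChartAt_source_frameBundle u₀ w).1 hw) v

end FrameContinuity

/-! ### Cartan's test -/

section CartanTest

variable {n : ℕ} {E : Type*} [NormedAddCommGroup E] [NormedSpace ℝ E]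

/-- The alternation `δ ↦ ∑ᵢ (-1)ⁱ (δ(vᵢ) · α)(v₀, …, v̂ᵢ, …, v_p)`, that is the form `dι(α)` on the
integral element with vertical component `δ`. -/
noncomputable def torsion {p : ℕ} (δ : E →L[ℝ] E →L[ℝ] E)
    (α : E [⋀^Fin p]→L[ℝ] ℝ) : E [⋀^Fin (p + 1)]→L[ℝ] ℝ :=
  ContinuousAlternatingMap.alternatizeUncurryFin (act α ∘L δ)

theorem torsion_apply {p : ℕ} (δ : E →L[ℝ] E →L[ℝ] E)
    (α : E [⋀^Fin p]→L[ℝ] ℝ) (v : Fin (p + 1) → E) :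
    torsion δ α v =
      ∑ i : Fin (p + 1), (-1 : ℝ) ^ (i : ℕ) * act α (δ (v i)) (i.removeNth v) := by
  rw [torsion, ContinuousAlternatingMap.alternatizeUncurryFin_apply]
  refine Finset.sum_congr rfl fun i _ => ?_
  rw [zsmul_eq_mul]
  simp

theorem torsion_add {p : ℕ} (δ ε : E →L[ℝ] E →L[ℝ] E)
    (α : E [⋀^Fin p]→L[ℝ] ℝ) : torsion (δ + ε) α = torsion δ α + torsion ε α := by
  ext v
  simp [torsion_apply, mul_add, Finset.sum_add_distrib]

theorem torsion_smul {p : ℕ} (c : ℝ) (δ : E →L[ℝ] E →L[ℝ] E)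
    (α : E [⋀^Fin p]→L[ℝ] ℝ) : torsion (c • δ) α = c • torsion δ α := by
  ext v
  simp [torsion_apply, Finset.mul_sum, mul_left_comm]

theorem act_smul {p : ℕ} (c : ℝ) (α : E [⋀^Fin p]→L[ℝ] ℝ) : act (c • α) = c • act α := by
  ext B v
  simp [act_apply, Finset.mul_sum]

theorem act_add {p : ℕ} (α β : E [⋀^Fin p]→L[ℝ] ℝ) : act (α + β) = act α + act β := by
  ext B v
  simp [act_apply, Finset.sum_add_distrib]

theorem torsion_zero {p : ℕ} (α : E [⋀^Fin p]→L[ℝ] ℝ) : torsion 0 α = 0 := by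
  ext v
  simp [torsion_apply]

/-- The linear maps `δ : T → 𝔤𝔩(T)` whose graphs, translated by a fixed integral element, are the
`π`-transverse integral elements. -/
noncomputable def closedConnections (A : ∀ p, Submodule ℝ (E [⋀^Fin p]→L[ℝ] ℝ)) :
    Submodule ℝ (E →L[ℝ] E →L[ℝ] E) where
  carrier := {δ | ∀ p, ∀ α ∈ A p, torsion δ α = 0}
  add_mem' := fun ha hb p α hα => by rw [torsion_add, ha p α hα, hb p α hα, add_zero]
  zero_mem' := fun p α _ => torsion_zero α
  smul_mem' := fun c a ha p α hα => by rw [torsion_smul, ha p α hα, smul_zero]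

/-- The vertical directions annihilated by the polar equations of an integral element with
horizontal projection `W`. -/
noncomputable def polarKernel (A : ∀ p, Submodule ℝ (E [⋀^Fin p]→L[ℝ] ℝ)) (W : Submodule ℝ E) :
    Submodule ℝ (E →L[ℝ] E) where
  carrier := {B | ∀ p, ∀ α ∈ A p, ∀ v : Fin p → E, (∀ i, v i ∈ W) → act α B v = 0}
  add_mem' := fun ha hb p α hα v hv => by simp [ha p α hα v hv, hb p α hα v hv]
  zero_mem' := fun p α _ v _ => by simp
  smul_mem' := fun c a ha p α hα v hv => by simp [ha p α hα v hv]

/-- The span of the first `j` vectors of a tuple. -/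
def flag (x : Fin n → E) (j : ℕ) : Submodule ℝ E :=
  Submodule.span ℝ (x '' {i | (i : ℕ) < j})

/-- The dimension of the polar kernel of the `j`-th member of a flag. -/
noncomputable def polarNullity (A : ∀ p, Submodule ℝ (E [⋀^Fin p]→L[ℝ] ℝ)) (x : Fin n → E)
    (j : ℕ) : ℕ :=
  Module.finrank ℝ (polarKernel A (flag x j))

/-- Cartan's test for the flag of a basis: the dimension of the space of integral elements is at
least the sum of the dimensions of the polar kernels. (The opposite inequality always holds.) -/
def IsRegularFlag (A : ∀ p, Submodule ℝ (E [⋀^Fin p]→L[ℝ] ℝ)) (x : Fin n → E) : Prop :=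
  LinearIndependent ℝ x ∧
    ∑ j ∈ Finset.range n, polarNullity A x j ≤ Module.finrank ℝ (closedConnections A)

theorem mem_flag (x : Fin n → E) {j : ℕ} (i : Fin n) (h : (i : ℕ) < j) : x i ∈ flag x j :=
  Submodule.subset_span ⟨i, h, rfl⟩

theorem flag_mono (x : Fin n → E) : Monotone (flag x) := fun _ _ h =>
  Submodule.span_mono (Set.image_mono fun _ hi => lt_of_lt_of_le hi h)

theorem finrank_flag {x : Fin n → E} (hx : LinearIndependent ℝ x) {j : ℕ} (hj : j ≤ n) :
    Module.finrank ℝ (flag x j) = j := by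
  have h1 : (x '' {i : Fin n | (i : ℕ) < j}) = Set.range (x ∘ Fin.castLE hj) := by
    rw [Set.range_comp]
    congr 1
    ext i
    exact ⟨fun h => ⟨⟨i, h⟩, rfl⟩, by rintro ⟨k, rfl⟩; exact k.2⟩
  rw [flag, h1, finrank_span_eq_card (hx.comp _ (Fin.castLE_injective hj)), Fintype.card_fin]

theorem flag_succ (x : Fin n → E) (j : Fin n) :
    flag x (j + 1) = flag x j ⊔ Submodule.span ℝ {x j} := by
  rw [flag, flag, ← Submodule.span_union, ← Set.image_singleton, ← Set.image_union]
  congr 2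
  ext i
  simp only [Set.mem_ofPred_eq, Set.mem_union, Set.mem_singleton_iff, Fin.ext_iff]
  omega

theorem finrank_le_of_ker {V W : Type*} [AddCommGroup V] [Module ℝ V] [FiniteDimensional ℝ V]
    [AddCommGroup W] [Module ℝ W] [FiniteDimensional ℝ W] (f : V →ₗ[ℝ] W) {S S' : Submodule ℝ V}
    {Z : Submodule ℝ W} (hf : ∀ s ∈ S, f s ∈ Z) (hS : ∀ s, s ∈ S' ↔ s ∈ S ∧ f s = 0) :
    Module.finrank ℝ S ≤ Module.finrank ℝ Z + Module.finrank ℝ S' ∧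
    (Module.finrank ℝ S = Module.finrank ℝ Z + Module.finrank ℝ S' →
      ∀ z ∈ Z, ∃ s ∈ S, f s = z) := by
  let g : S →ₗ[ℝ] Z := (f.comp S.subtype).codRestrict Z fun s => hf _ s.2
  have hle : S' ≤ S := fun s hs => ((hS s).1 hs).1
  have hker : LinearMap.ker g = S'.comap S.subtype := by
    ext s
    simp [g, hS]
  have h1 := LinearMap.finrank_range_add_finrank_ker g
  rw [hker, (Submodule.comapSubtypeEquivOfLe hle).finrank_eq] at h1
  have h2 := Submodule.finrank_le (LinearMap.range g)
  refine ⟨by omega, fun h B hB => ?_⟩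
  have h3 : LinearMap.range g = ⊤ := Submodule.eq_top_of_finrank_eq (by omega)
  obtain ⟨δ, hδ⟩ := LinearMap.range_eq_top.1 h3 ⟨B, hB⟩
  exact ⟨δ.1, δ.2, congrArg Subtype.val hδ⟩

theorem act_eq_zero_of_torsion {A : ∀ p, Submodule ℝ (E [⋀^Fin p]→L[ℝ] ℝ)} {W : Submodule ℝ E}
    {δ : E →L[ℝ] E →L[ℝ] E} (hδ : ∀ v ∈ W, δ v = 0) {y : E}
    (h : ∀ p, ∀ α ∈ A p, ∀ v : Fin p → E, (∀ i, v i ∈ W) →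
      torsion δ α (Fin.cons y v : Fin (p + 1) → E) = 0) : δ y ∈ polarKernel A W := by
  intro p α hα v hv
  have h1 := h p α hα v hv
  rw [torsion_apply, Fin.sum_univ_succ, Finset.sum_eq_zero] at h1
  · simpa using h1
  · intro i _
    rw [Fin.cons_succ, hδ _ (hv i)]
    simp

variable [FiniteDimensional ℝ E]

theorem flag_eq_top (hE : Module.finrank ℝ E = n) (x : Fin n → E)
    (hx : LinearIndependent ℝ x) : flag x n = ⊤ := by
  have : (x '' {i : Fin n | (i : ℕ) < n}) = Set.range x := by
    rw [← Set.image_univ]; congr 1; ext i; simp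
  rw [flag, this]
  exact hx.span_eq_top_of_card_eq_finrank' (by simp [hE])

/-- The elements of `closedConnections A` which vanish on the first `j` vectors of `x`. -/
noncomputable def closedFiltration (A : ∀ p, Submodule ℝ (E [⋀^Fin p]→L[ℝ] ℝ)) (x : Fin n → E)
    (j : ℕ) : Submodule ℝ (E →L[ℝ] E →L[ℝ] E) where
  carrier := {δ | δ ∈ closedConnections A ∧ ∀ v ∈ flag x j, δ v = 0}
  add_mem' := fun ha hb => ⟨add_mem ha.1 hb.1, fun v hv => by simp [ha.2 v hv, hb.2 v hv]⟩
  zero_mem' := ⟨zero_mem _, fun v _ => by simp⟩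
  smul_mem' := fun c a ha => ⟨Submodule.smul_mem _ c ha.1, fun v hv => by simp [ha.2 v hv]⟩

theorem finrank_closedFiltration_le (A : ∀ p, Submodule ℝ (E [⋀^Fin p]→L[ℝ] ℝ)) (x : Fin n → E)
    (j : Fin n) :
    Module.finrank ℝ (closedFiltration A x j) ≤
      Module.finrank ℝ (polarKernel A (flag x j)) +
        Module.finrank ℝ (closedFiltration A x (j + 1)) ∧
    (Module.finrank ℝ (closedFiltration A x j) =
      Module.finrank ℝ (polarKernel A (flag x j)) +
        Module.finrank ℝ (closedFiltration A x (j + 1)) →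
      ∀ B ∈ polarKernel A (flag x j), ∃ δ ∈ closedFiltration A x j, δ (x j) = B) := by
  let ev : (E →L[ℝ] E →L[ℝ] E) →ₗ[ℝ] (E →L[ℝ] E) :=
    { toFun := fun δ => δ (x j)
      map_add' := fun _ _ => rfl
      map_smul' := fun _ _ => rfl }
  refine finrank_le_of_ker ev (fun δ hδ => act_eq_zero_of_torsion hδ.2
        fun p α hα v _ => by rw [hδ.1 p α hα]; rfl) fun δ => ⟨fun h => ⟨⟨h.1, fun v hv =>
          h.2 v (flag_mono x (Nat.le_succ _) hv)⟩, h.2 _ (mem_flag x j (Nat.lt_succ_self _))⟩,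
          fun h => ⟨h.1.1, fun v hv => ?_⟩⟩
  have h0 : δ (x j) = 0 := h.2
  rw [flag_succ, Submodule.mem_sup] at hv
  obtain ⟨y, hy, z, hz, rfl⟩ := hv
  obtain ⟨c, rfl⟩ := Submodule.mem_span_singleton.1 hz
  rw [map_add, map_smul, h0, h.1.2 y hy]
  simp

/-- A telescoping estimate is an equality only if each of its steps is one. -/
theorem eq_of_sum_le {d z : ℕ → ℕ} {n : ℕ} (h : ∀ j < n, d j ≤ z j + d (j + 1)) (hn : d n = 0) :
    d 0 ≤ ∑ j ∈ Finset.range n, z j ∧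
      (∑ j ∈ Finset.range n, z j ≤ d 0 → ∀ j < n, d j = z j + d (j + 1)) := by
  have key : ∀ m ≤ n, d 0 ≤ ∑ j ∈ Finset.range m, z j + d m ∧
      (∑ j ∈ Finset.range m, z j + d m ≤ d 0 → ∀ j < m, d j = z j + d (j + 1)) := by
    intro m
    induction m with
    | zero => intro _; simp
    | succ m ih =>
      intro hm
      have h1 := ih (by omega)
      have h2 := h m (by omega)
      rw [Finset.sum_range_succ]
      refine ⟨by omega, fun h3 j hj => ?_⟩
      rcases Nat.lt_succ_iff_lt_or_eq.1 hj with h4 | rfl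
      · exact h1.2 (by omega) j h4
      · omega
  have := key n le_rfl
  simpa [hn] using this

/-- The inequality in Cartan's test. In the case of equality each polar direction `B` over a member
of the flag is attained by a closed connection which vanishes on that member. -/
theorem finrank_closedConnections_le (hE : Module.finrank ℝ E = n)
    (A : ∀ p, Submodule ℝ (E [⋀^Fin p]→L[ℝ] ℝ)) {x : Fin n → E} (hx : LinearIndependent ℝ x) :
    Module.finrank ℝ (closedConnections A) ≤
      ∑ j ∈ Finset.range n, Module.finrank ℝ (polarKernel A (flag x j)) ∧
    (∑ j ∈ Finset.range n, Module.finrank ℝ (polarKernel A (flag x j)) ≤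
        Module.finrank ℝ (closedConnections A) →
      ∀ j : Fin n, ∀ B ∈ polarKernel A (flag x j), ∃ δ ∈ closedFiltration A x j, δ (x j) = B) := by
  have h0 : closedFiltration A x 0 = closedConnections A := by
    ext δ
    refine ⟨fun h => h.1, fun h => ⟨h, fun v hv => ?_⟩⟩
    have : v = 0 := by simpa [flag] using hv
    rw [this, map_zero]
  have hn : Module.finrank ℝ (closedFiltration A x n) = 0 := by
    have : closedFiltration A x n = ⊥ := by
      rw [eq_bot_iff]
      intro δ hδ
      refine (Submodule.mem_bot ℝ).2 ?_
      ext1 v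
      exact hδ.2 v (by rw [flag_eq_top hE x hx]; trivial)
    rw [this, finrank_bot]
  have h1 := eq_of_sum_le (d := fun j => Module.finrank ℝ (closedFiltration A x j))
    (z := fun j => Module.finrank ℝ (polarKernel A (flag x j))) (n := n)
    (fun j hj => (finrank_closedFiltration_le A x ⟨j, hj⟩).1) hn
  beta_reduce at h1
  rw [h0] at h1
  refine ⟨h1.1, fun h j B hB => ?_⟩
  refine (finrank_closedFiltration_le A x j).2 ?_ B hB
  exact h1.2 h j j.2

/-- Equality in Cartan's test: every infinitesimal integral element over a member of the flag is
the restriction of one over `T`. -/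
theorem exists_extension (hE : Module.finrank ℝ E = n)
    {A : ∀ p, Submodule ℝ (E [⋀^Fin p]→L[ℝ] ℝ)} {x : Fin n → E} (h : IsRegularFlag A x) {j : ℕ} (hj : j ≤ n)
    (δ : E →L[ℝ] E →L[ℝ] E)
    (hδ : ∀ p, ∀ α ∈ A p, ∀ v : Fin (p + 1) → E, (∀ i, v i ∈ flag x j) → torsion δ α v = 0) :
    ∃ ε ∈ closedConnections A, ∀ v ∈ flag x j, ε v = δ v := by
  induction j with
  | zero =>
    refine ⟨0, zero_mem _, fun v hv => ?_⟩
    have : v = 0 := by simpa [flag] using hv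
    rw [this, map_zero, map_zero]
  | succ j ih =>
    obtain ⟨ε, hε, hεδ⟩ := ih (by omega) fun p α hα v hv =>
      hδ p α hα v fun i => flag_mono x (Nat.le_succ _) (hv i)
    let jj : Fin n := ⟨j, hj⟩
    have hB : (δ - ε) (x jj) ∈ polarKernel A (flag x jj) := by
      refine act_eq_zero_of_torsion (fun v hv => by simp [hεδ v hv]) fun p α hα v hv => ?_
      rw [sub_eq_add_neg, ← neg_one_smul ℝ ε, torsion_add, torsion_smul, hε p α hα, smul_zero,
        add_zero]
      refine hδ p α hα _ fun i => ?_
      refine Fin.cases (mem_flag x jj (Nat.lt_succ_self _)) (fun i => ?_) i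
      exact flag_mono x (Nat.le_succ _) (hv i)
    -- the error at the next vector is a polar direction, and is corrected by a closed connection
    obtain ⟨κ, hκ, hκB⟩ := (finrank_closedConnections_le hE A h.1).2 h.2 jj _ hB
    refine ⟨ε + κ, add_mem hε hκ.1, fun v hv => ?_⟩
    have hs := flag_succ x jj
    rw [hs, Submodule.mem_sup] at hv
    obtain ⟨y, hy, z, hz, rfl⟩ := hv
    obtain ⟨c, rfl⟩ := Submodule.mem_span_singleton.1 hz
    simp only [map_add, map_smul, add_apply, hκB, hκ.2 y hy, hεδ y hy]
    simp

end CartanTest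

/-! ### Semicontinuity of the ranks of the polar equations -/

section Semicontinuity

/-- A multilinear map which vanishes on the tuples of elements of a set vanishes on the tuples of
elements of its span. -/
theorem apply_eq_zero_of_span {E : Type*} [AddCommGroup E] [Module ℝ E] {p : ℕ}
    (f : MultilinearMap ℝ (fun _ : Fin p => E) ℝ) {S : Set E}
    (h : ∀ v : Fin p → E, (∀ i, v i ∈ S) → f v = 0) (v : Fin p → E)
    (hv : ∀ i, v i ∈ Submodule.span ℝ S) : f v = 0 := by
  have key : ∀ s : Finset (Fin p), ∀ v : Fin p → E, (∀ i, v i ∈ Submodule.span ℝ S) →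
      (∀ i ∉ s, v i ∈ S) → f v = 0 := by
    intro s
    induction s using Finset.induction_on with
    | empty => exact fun v _ hv => h v fun i => hv i (Finset.notMem_empty i)
    | insert a s _ ih =>
      intro v hv hvs
      have h1 : ∀ y ∈ Submodule.span ℝ S, f (Function.update v a y) = 0 := by
        intro y hy
        induction hy using Submodule.span_induction with
        | mem y hy =>
          refine ih _ (fun i => ?_) fun i hi => ?_
          · rcases eq_or_ne i a with rfl | hia
            · simpa using Submodule.subset_span hy
            · simpa [hia] using hv i
          · rcases eq_or_ne i a with rfl | hia
            · simpa using hy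
            · simpa [hia] using hvs i (by simp [hia, hi])
        | zero => exact f.map_update_zero v a
        | add y z _ _ hy hz => rw [f.map_update_add, hy, hz, add_zero]
        | smul c y _ hy => rw [f.map_update_smul, hy, smul_zero]
      have := h1 (v a) (hv a)
      rwa [Function.update_eq_self] at this
  exact key Finset.univ v hv fun i hi => absurd (Finset.mem_univ i) hi

/-- The dimension of a closed family of subspaces is upper semicontinuous. -/
theorem eventually_finrank_le {X V : Type*} [TopologicalSpace X] [NormedAddCommGroup V]
    [NormedSpace ℝ V] [FiniteDimensional ℝ V] {Z : X → Submodule ℝ V}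
    (hZ : IsClosed {q : X × V | q.2 ∈ Z q.1}) (x₀ : X) :
    ∀ᶠ x in 𝓝 x₀, Module.finrank ℝ (Z x) ≤ Module.finrank ℝ (Z x₀) := by
  -- a complement of `Z x₀` remains transverse to `Z x`, as its unit sphere is compact
  obtain ⟨C, hC⟩ := (Z x₀).exists_isCompl
  have hK : IsCompact (Metric.sphere (0 : V) 1 ∩ C) :=
    (isCompact_sphere 0 1).inter_right C.closed_of_finiteDimensional
  have h1 : ∀ B ∈ Metric.sphere (0 : V) 1 ∩ C, ∀ᶠ q : X × V in 𝓝 (x₀, B), q.2 ∉ Z q.1 := by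
    intro B hB
    refine hZ.isOpen_compl.mem_nhds ?_
    intro hBZ
    have : B = 0 := (Submodule.disjoint_def.1 hC.disjoint) B hBZ hB.2
    have h2 := hB.1
    simp [this] at h2
  filter_upwards [hK.eventually_forall_of_forall_eventually (P := fun x B => B ∉ Z x) h1] with x hx
  have hdisj : Disjoint (Z x) C := by
    rw [Submodule.disjoint_def]
    intro B hBZ hBC
    by_contra hB
    refine hx (‖B‖⁻¹ • B) ⟨?_, C.smul_mem _ hBC⟩ ((Z x).smul_mem _ hBZ)
    simp [norm_smul, hB]
  have h3 := Submodule.finrank_add_finrank_le_of_disjoint hdisj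
  have h4 := Submodule.finrank_add_eq_of_isCompl hC
  omega

variable {n : ℕ} {E : Type*} [NormedAddCommGroup E] [NormedSpace ℝ E]

theorem mem_polarKernel_flag {A : ∀ p, Submodule ℝ (E [⋀^Fin p]→L[ℝ] ℝ)} {x : Fin n → E} {j : ℕ}
    {B : E →L[ℝ] E} : B ∈ polarKernel A (flag x j) ↔ ∀ p, ∀ α ∈ A p, ∀ J : Fin p → Fin n,
      (∀ i, (J i : ℕ) < j) → act α B (fun i => x (J i)) = 0 := by
  constructor
  · exact fun h p α hα J hJ => h p α hα _ fun i => mem_flag x _ (hJ i)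
  · intro h p α hα v hv
    refine apply_eq_zero_of_span (act α B).toMultilinearMap (fun v hv => ?_) v hv
    choose J hJ hJv using hv
    have := h p α hα J hJ
    simp_rw [hJv] at this
    exact this

variable [FiniteDimensional ℝ E]

theorem eventually_finrank_polarKernel_le (A : ∀ p, Submodule ℝ (E [⋀^Fin p]→L[ℝ] ℝ))
    (x : Fin n → E) (j : ℕ) : ∀ᶠ x' in 𝓝 x,
      Module.finrank ℝ (polarKernel A (flag x' j)) ≤
        Module.finrank ℝ (polarKernel A (flag x j)) := by
  refine eventually_finrank_le (Z := fun x => polarKernel A (flag x j)) ?_ x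
  have : {q : (Fin n → E) × (E →L[ℝ] E) | q.2 ∈ polarKernel A (flag q.1 j)} =
      ⋂ (p : ℕ) (α : A p) (J : {J : Fin p → Fin n // ∀ i, (J i : ℕ) < j}),
        {q | act α.1 q.2 (fun i => q.1 (J.1 i)) = 0} := by
    ext q
    simp [mem_polarKernel_flag]
  rw [this]
  refine isClosed_iInter fun p => isClosed_iInter fun α => isClosed_iInter fun J => ?_
  refine isClosed_eq ?_ continuous_const
  simp only [act_apply]
  refine continuous_finsetSum _ fun i _ => ?_
  refine α.1.cont.comp (continuous_pi fun l => ?_)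
  rcases eq_or_ne l i with rfl | h
  · simp only [Function.update_self]
    fun_prop
  · simp only [Function.update_of_ne h]
    fun_prop

/-- The bases for which Cartan's test is satisfied form a neighbourhood of each of them, on which
the ranks of the polar equations of the flag are constant. -/
theorem exists_isOpen_regular (hE : Module.finrank ℝ E = n)
    {A : ∀ p, Submodule ℝ (E [⋀^Fin p]→L[ℝ] ℝ)} {b : Fin n → E} (h : IsRegularFlag A b) :
    ∃ U : Set (Fin n → E), IsOpen U ∧ b ∈ U ∧ ∀ x ∈ U, IsRegularFlag A x ∧
      ∀ j < n, polarNullity A x j = polarNullity A b j := by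
  obtain ⟨hb, h⟩ := h
  have h1 : ∀ᶠ x in 𝓝 b, LinearIndependent ℝ x := isOpen_setOfPred_linearIndependent.mem_nhds hb
  have h2 : ∀ᶠ x in 𝓝 b, ∀ j ∈ Finset.range n, Module.finrank ℝ (polarKernel A (flag x j)) ≤
        Module.finrank ℝ (polarKernel A (flag b j)) :=
    (Filter.eventually_all_finset _).2 fun j _ => eventually_finrank_polarKernel_le A b j
  obtain ⟨U, hU, hUo, hbU⟩ := eventually_nhds_iff.1 (h1.and h2)
  refine ⟨U, hUo, hbU, fun x hx => ?_⟩
  obtain ⟨hx1, hx2⟩ := hU x hx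
  -- the ranks can only drop near `b`, but the inequality in Cartan's test bounds their sum below
  have h3 := Finset.sum_le_sum hx2
  have h4 := (finrank_closedConnections_le hE A hx1).1
  refine ⟨⟨hx1, h3.trans h⟩, fun j hj => ?_⟩
  exact (Finset.sum_eq_sum_iff_of_le hx2).1 (le_antisymm h3 (h.trans h4)) j (Finset.mem_range.2 hj)

end Semicontinuity

/-! ### Polar equations of a generated ideal -/

section Wedge

variable {V : Type*} [AddCommGroup V] [Module ℝ V] [TopologicalSpace V]

/-- The permutations which preserve the two blocks are the products of permutations of the
blocks. -/
theorem exists_perm_blocks {p q : ℕ} (σ : Equiv.Perm (Fin (p + q)))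
    (hσ : ∀ (i : Fin p) (j : Fin q), σ (Fin.castAdd q i) ≠ Fin.natAdd p j) :
    ∃ (σ₁ : Equiv.Perm (Fin p)) (σ₂ : Equiv.Perm (Fin q)),
      (∀ i, σ (Fin.castAdd q i) = Fin.castAdd q (σ₁ i)) ∧
      (∀ i, σ (Fin.natAdd p i) = Fin.natAdd p (σ₂ i)) ∧
      Equiv.Perm.sign σ = Equiv.Perm.sign σ₁ * Equiv.Perm.sign σ₂ := by
  let e : Fin p ⊕ Fin q ≃ Fin (p + q) := finSumFinEquiv
  let τ : Equiv.Perm (Fin p ⊕ Fin q) := (e.trans σ).trans e.symm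
  have hτ : τ ∈ (Equiv.Perm.sumCongrHom (Fin p) (Fin q)).range := by
    refine Equiv.Perm.mem_sumCongrHom_range_of_perm_mapsTo_inl ?_
    rintro _ ⟨i, rfl⟩
    rcases h : τ (Sum.inl i) with i' | j
    · exact ⟨i', rfl⟩
    · refine absurd ?_ (hσ i j)
      have h2 : e (τ (Sum.inl i)) = e (Sum.inr j) := by rw [h]
      simpa [τ, e] using h2
  obtain ⟨⟨σ₁, σ₂⟩, hs⟩ := hτ
  have hs' : Equiv.sumCongr σ₁ σ₂ = τ := hs
  refine ⟨σ₁, σ₂, fun i => ?_, fun i => ?_, ?_⟩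
  · have h2 : e (τ (Sum.inl i)) = e (Sum.inl (σ₁ i)) := by rw [← hs']; rfl
    simpa [τ, e] using h2
  · have h2 : e (τ (Sum.inr i)) = e (Sum.inr (σ₂ i)) := by rw [← hs']; rfl
    simpa [τ, e] using h2
  · rw [← Equiv.Perm.sign_sumCongr]
    have : Equiv.Perm.sign (Equiv.Perm.sumCongr σ₁ σ₂) = Equiv.Perm.sign τ := by rw [← hs']
    rw [this]
    exact (Equiv.Perm.sign_symm_trans_trans σ e.symm).symm

theorem sign_mul_apply_of_mapsTo {p q : ℕ} (α : V [⋀^Fin p]→L[ℝ] ℝ) (β : V [⋀^Fin q]→L[ℝ] ℝ)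
    (v : Fin (p + q) → V) (σ : Equiv.Perm (Fin (p + q)))
    (hσ : ∀ (i : Fin p) (j : Fin q), σ (Fin.castAdd q i) ≠ Fin.natAdd p j) :
    Equiv.Perm.sign σ • (α (fun i => v (σ (Fin.castAdd q i))) *
      β (fun j => v (σ (Fin.natAdd p j)))) =
    α (fun i => v (Fin.castAdd q i)) * β (fun j => v (Fin.natAdd p j)) := by
  obtain ⟨σ₁, σ₂, h1, h2, h3⟩ := exists_perm_blocks σ hσ
  have h4 := α.toAlternatingMap.map_perm (fun i => v (Fin.castAdd q i)) σ₁
  have h5 := β.toAlternatingMap.map_perm (fun i => v (Fin.natAdd p i)) σ₂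
  simp only [ContinuousAlternatingMap.coe_toAlternatingMap, Function.comp_def] at h4 h5
  simp only [h1, h2]
  rw [h4, h5, h3]
  rcases Int.units_eq_one_or (Equiv.Perm.sign σ₁) with h6 | h6 <;>
  rcases Int.units_eq_one_or (Equiv.Perm.sign σ₂) with h7 | h7 <;> simp [h6, h7]

/-- If only the permutations which preserve the two blocks of arguments contribute to a wedge
product, then it is a positive multiple of the product of its factors. -/
theorem mul_apply_eq_zero_of_wedge {p q : ℕ} (α : V [⋀^Fin p]→L[ℝ] ℝ) (β : V [⋀^Fin q]→L[ℝ] ℝ)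
    (v : Fin (p + q) → V)
    (hv : ∀ (σ : Equiv.Perm (Fin (p + q))) (i : Fin p) (j : Fin q),
      σ (Fin.castAdd q i) = Fin.natAdd p j →
      α (fun i => v (σ (Fin.castAdd q i))) * β (fun j => v (σ (Fin.natAdd p j))) = 0)
    (h : wedge rfl α β v = 0) :
    α (fun i => v (Fin.castAdd q i)) * β (fun j => v (Fin.natAdd p j)) = 0 := by
  classical
  rw [wedge_apply] at h
  have h0 : (((p ! * q ! : ℕ) : ℝ)⁻¹) ≠ 0 := by positivity
  replace h := (mul_eq_zero.1 h).resolve_left h0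
  let N : Finset (Equiv.Perm (Fin (p + q))) := Finset.univ.filter fun σ =>
    ∀ (i : Fin p) (j : Fin q), σ (Fin.castAdd q i) ≠ Fin.natAdd p j
  have hN : (N.card : ℝ) * (α (fun i => v (Fin.castAdd q i)) * β (fun j => v (Fin.natAdd p j))) =
      0 := by
    rw [← h, ← nsmul_eq_mul, ← Finset.sum_const, Finset.sum_filter]
    refine Finset.sum_congr rfl fun σ _ => ?_
    split_ifs with hσ
    · exact (sign_mul_apply_of_mapsTo α β v σ hσ).symm
    · push Not at hσ
      obtain ⟨i, j, hij⟩ := hσ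
      have := hv σ i j hij
      simp only [Fin.cast_refl, id] at *
      rw [this, smul_zero]
  refine (mul_eq_zero.1 hN).resolve_left ?_
  have : (1 : Equiv.Perm (Fin (p + q))) ∈ N := by
    simp only [N, Finset.mem_filter, Finset.mem_univ, true_and, Equiv.Perm.one_apply]
    intro i j e
    have := congrArg Fin.val e
    simp at this
    omega
  exact_mod_cast Finset.card_ne_zero_of_mem this

end Wedge

section GeneratedIdeal

variable {E : Type*} [NormedAddCommGroup E] [NormedSpace ℝ E]
  {H : Type*} [TopologicalSpace H] {I : ModelWithCorners ℝ E H}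
  {P : Type*} [TopologicalSpace P] [ChartedSpace H P]

theorem isIntegralElement_generatedIdeal {S : ∀ k, MForm I P k → Prop} {x : P}
    {F : Submodule ℝ (TangentSpace I x)}
    (h : ∀ q β, S q β → ∀ v : Fin q → TangentSpace I x, (∀ i, v i ∈ F) → β x v = 0) :
    IsIntegralElement (generatedIdeal S) x F := by
  intro k η hη v hv
  induction hη using Submodule.span_induction with
  | mem η hη =>
    obtain ⟨p, q, hpq, γ, β, _, hβ, rfl⟩ := hη
    rw [wedge_apply, Finset.sum_eq_zero, mul_zero]
    intro σ _
    rw [h q β hβ _ fun j => hv _, mul_zero, smul_zero]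
  | zero => rfl
  | add η ζ _ _ h1 h2 =>
    change η x v + ζ x v = 0
    rw [h1, h2, add_zero]
  | smul c η _ h1 =>
    change c • η x v = 0
    rw [h1, smul_zero]

theorem IsIntegralElement.generator {S : ∀ k, MForm I P k → Prop} {x : P}
    {F : Submodule ℝ (TangentSpace I x)} (hF : IsIntegralElement (generatedIdeal S) x F)
    {γ : MForm I P 0} (hγ : γ.IsSmooth) (hγx : ∀ v, γ x v ≠ 0) {q : ℕ} {β : MForm I P q}
    (hβ : S q β) {v : Fin q → TangentSpace I x} (hv : ∀ i, v i ∈ F) : β x v = 0 := by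
  have h0 := hF q _ (Submodule.subset_span ⟨0, q, zero_add q, γ, β, hγ, hβ, rfl⟩) v hv
  have h1 := mul_apply_eq_zero_of_wedge (γ x) (β x) (fun i => v (Fin.cast (zero_add q) i))
    (fun σ i => i.elim0) (by
      rw [← h0]
      have : ∀ (r : ℕ) (h : 0 + q = r) (v : Fin r → TangentSpace I x),
        wedge rfl (γ x) (β x) (fun i => v (Fin.cast h i)) = wedge h (γ x) (β x) v := by
          intro r h v
          subst h
          rfl
      exact this q _ v)
  have h2 := (mul_eq_zero.1 h1).resolve_left (hγx _)
  simpa using h2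

variable [FiniteDimensional ℝ E]

/-- The polar space of an integral element of a generated ideal is cut out by the generators alone.
A generator `β` of degree `q + 1` contributes to the polar equations of a `k`-plane only through its
multiples `γ ∧ β` of degree `k + 1`; the hypothesis `hγ` provides factors `γ` for which the
evaluation of `γ ∧ β` reduces to a nonzero multiple of an evaluation of `β`. -/
theorem mem_dualCoannihilator_polarEquations {S : ∀ k, MForm I P k → Prop} {k : ℕ}
    {F : Gr I P k}
    (hF : IsIntegralElement (generatedIdeal S) F.base F.space)
    (hSF : ∀ q β, S q β → ∀ v : Fin q → TangentSpace I F.base, (∀ i, v i ∈ F.space) →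
      β F.base v = 0)
    (hγ : ∀ p q, p + q = k → ∀ x : Fin q → TangentSpace I F.base, LinearIndependent ℝ x →
      (∀ i, x i ∈ F.space) → ∃ γ : MForm I P p, γ.IsSmooth ∧ (∃ v, (∀ i, v i ∈ F.space) ∧
        γ F.base v ≠ 0) ∧ ∀ y i j, y i = x j → γ F.base y = 0)
    (w : TangentSpace I F.base) :
    w ∈ (polarEquations (generatedIdeal S) F).dualCoannihilator ↔
      ∀ q β, S (q + 1) β → ∀ x : Fin q → TangentSpace I F.base, (∀ i, x i ∈ F.space) →
        β F.base (Fin.snoc (α := fun _ => TangentSpace I F.base) x w) = 0 := by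
  rw [Submodule.mem_dualCoannihilator]
  constructor
  · intro h q β hβ x hx
    -- on dependent arguments `β` vanishes; on independent ones evaluate `γ ∧ β` with a factor `γ`
    -- which annihilates them
    by_cases hli : LinearIndependent ℝ x
    · have hfin : Module.Finite ℝ F.space := by
        have : FiniteDimensional ℝ (TangentSpace I F.base) := inferInstanceAs (FiniteDimensional ℝ E)
        infer_instance
      have hq : q ≤ k := by
        have h1 : LinearIndependent ℝ (fun i => (⟨x i, hx i⟩ : F.space)) :=
          LinearIndependent.of_comp F.space.subtype hli
        have := h1.fintype_card_le_finrank
        rwa [Fintype.card_fin, F.finrank_space] at this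
      obtain ⟨p, hp⟩ : ∃ p, p + q = k := ⟨k - q, by omega⟩
      obtain ⟨γ, hγs, ⟨v, hvF, hv⟩, hγ0⟩ := hγ p q hp x hli hx
      have key : ∀ v' : Fin k → TangentSpace I F.base, (∀ i, v' i ∈ F.space) →
          wedge (show p + (q + 1) = k + 1 by omega) (γ F.base) (β F.base)
            (Fin.snoc (α := fun _ => TangentSpace I F.base) v' w) = 0 := by
        intro v' hv'
        let ξ : Module.Dual ℝ (TangentSpace I F.base) :=
          ((wedge (show p + (q + 1) = k + 1 by omega) (γ F.base)
            (β F.base)).toAlternatingMap.toMultilinearMap.toLinearMap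
              (Fin.snoc (α := fun _ => TangentSpace I F.base) v' 0) (Fin.last k))
        have hξ : ∀ w, ξ w = wedge (show p + (q + 1) = k + 1 by omega) (γ F.base) (β F.base)
            (Fin.snoc (α := fun _ => TangentSpace I F.base) v' w) := by
          intro w
          rw [← Fin.update_snoc_last (α := fun _ => TangentSpace I F.base) 0 v' w]
          rfl
        rw [← hξ]
        refine h ξ (Submodule.subset_span ⟨_, Submodule.subset_span ⟨p, q + 1, by omega, γ, β, hγs,
          hβ, rfl⟩, v', hv', hξ⟩)
      subst hp
      have h1 := key (Fin.append v x) fun i => by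
        refine Fin.addCases (fun i => ?_) (fun i => ?_) i
        · rw [Fin.append_left]; exact hvF i
        · rw [Fin.append_right]; exact hx i
      set V : Fin (p + (q + 1)) → TangentSpace I F.base :=
        Fin.snoc (α := fun _ => TangentSpace I F.base) (Fin.append v x) w with hV
      have hV1 : ∀ i, V (Fin.castAdd (q + 1) i) = v i := by
        intro i
        have : (Fin.castAdd (q + 1) i) = Fin.castSucc (Fin.castAdd q i) := rfl
        rw [hV, this, Fin.snoc_castSucc, Fin.append_left]
      have hV2 : ∀ i : Fin q, V (Fin.natAdd p i.castSucc) = x i := by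
        intro i
        have : (Fin.natAdd p i.castSucc) = Fin.castSucc (Fin.natAdd p i) := rfl
        rw [hV, this, Fin.snoc_castSucc, Fin.append_right]
      have hV3 : V (Fin.natAdd p (Fin.last q)) = w := by
        have : (Fin.natAdd p (Fin.last q)) = Fin.last (p + q) := rfl
        rw [hV, this]
        exact Fin.snoc_last (α := fun _ => TangentSpace I F.base) w (Fin.append v x)
      have hVF : ∀ i, i ≠ Fin.natAdd p (Fin.last q) → V i ∈ F.space := by
        intro i hi
        have : i ≠ Fin.last (p + q) := hi
        obtain ⟨j, rfl⟩ := Fin.exists_castSucc_eq.2 this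
        rw [hV, Fin.snoc_castSucc]
        refine Fin.addCases (fun i => ?_) (fun i => ?_) j
        · rw [Fin.append_left]; exact hvF i
        · rw [Fin.append_right]; exact hx i
      have h2 := mul_apply_eq_zero_of_wedge (γ F.base) (β F.base) V (fun σ i j hij => ?_) h1
      · simp only [hV1] at h2
        have h3 := (mul_eq_zero.1 h2).resolve_left hv
        rw [← h3]
        congr 1
        funext j
        refine Fin.lastCases ?_ (fun i => ?_) j
        · rw [Fin.snoc_last, hV3]
        · rw [Fin.snoc_castSucc, hV2]
      · induction j using Fin.lastCases with
        | last =>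
          rw [hSF _ β hβ _ fun j => hVF _ fun e => ?_, mul_zero]
          rw [← hij] at e
          have := congrArg Fin.val (σ.injective e)
          simp at this
          omega
        | cast j => rw [hγ0 _ i j (by rw [hij, hV2]), zero_mul]
    · refine (β F.base).toAlternatingMap.map_linearDependent _ fun hli' => hli ?_
      have := hli'.comp Fin.castSucc (Fin.castSucc_injective q)
      simpa [Function.comp_def] using this
  · intro h ξ hξ
    -- the condition on `w` says that `F + ℝw` is an integral element
    have hint : IsIntegralElement (generatedIdeal S) F.base (F.space ⊔ Submodule.span ℝ {w}) := by
      refine isIntegralElement_generatedIdeal fun q β hβ v hv => ?_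
      have hsup : F.space ⊔ Submodule.span ℝ {w} = Submodule.span ℝ (F.space ∪ {w}) := by
        rw [Submodule.span_union, Submodule.span_eq]
      rw [hsup] at hv
      refine apply_eq_zero_of_span (β F.base).toMultilinearMap (fun v hv => ?_) v hv
      by_cases hall : ∀ i, v i ∈ F.space
      · exact hSF q β hβ v hall
      · push Not at hall
        obtain ⟨i₀, hi₀⟩ := hall
        have hvi₀ : v i₀ = w := (hv i₀).resolve_left hi₀
        obtain ⟨r, rfl⟩ : ∃ r, q = r + 1 := Nat.exists_eq_succ_of_ne_zero (by
          rintro rfl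
          exact i₀.elim0)
        by_cases hex : ∃ i₁, i₁ ≠ i₀ ∧ v i₁ ∉ F.space
        · obtain ⟨i₁, hne, hi₁⟩ := hex
          exact (β F.base).toAlternatingMap.map_eq_zero_of_eq v
            (hvi₀.trans ((hv i₁).resolve_left hi₁).symm) hne.symm
        · push Not at hex
          have h1 := (β F.base).toAlternatingMap.map_perm v (Equiv.swap i₀ (Fin.last r))
          have h2 : v ∘ Equiv.swap i₀ (Fin.last r) = Fin.snoc (α := fun _ => TangentSpace I F.base)
              (fun i => v (Equiv.swap i₀ (Fin.last r) i.castSucc)) w := by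
            funext i
            refine Fin.lastCases ?_ (fun i => ?_) i
            · simp [hvi₀]
            · simp
          have h3 : (β F.base).toAlternatingMap (v ∘ Equiv.swap i₀ (Fin.last r)) = 0 := by
            rw [h2]
            refine h r β hβ _ fun i => hex _ fun e => ?_
            rw [Equiv.swap_apply_eq_iff, Equiv.swap_apply_left] at e
            exact absurd e (Fin.castSucc_lt_last i).ne
          rw [h3] at h1
          exact (smul_eq_zero_iff_eq _).1 h1.symm
    induction hξ using Submodule.span_induction with
    | mem ξ hξ =>
      obtain ⟨η, hη, v, hv, hξ⟩ := hξ
      rw [hξ]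
      refine hint _ η hη _ fun i => ?_
      refine Fin.lastCases ?_ (fun i => ?_) i
      · rw [Fin.snoc_last]
        exact Submodule.mem_sup_right (Submodule.mem_span_singleton_self w)
      · rw [Fin.snoc_castSucc]
        exact Submodule.mem_sup_left (hv i)
    | zero => rfl
    | add ξ ζ _ _ h1 h2 => rw [LinearMap.add_apply, h1, h2, add_zero]
    | smul c ξ _ h1 => rw [LinearMap.smul_apply, h1, smul_zero]

end GeneratedIdeal

/-! ### Integral elements in a coframe -/

section CoframedSpace

variable {E : Type*} [NormedAddCommGroup E] [NormedSpace ℝ E]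
  {X : Type*} [AddCommGroup X] [Module ℝ X]

/-- The form `∑ᵢ (-1)ⁱ (ω(vᵢ) · α)(θ v₀, …, θ v̂ᵢ, …, θ v_p)` on a vector space with a coframe
`(θ, ω)`. -/
noncomputable def coframeForm (Ψ : X ≃ₗ[ℝ] E × (E →L[ℝ] E)) {p : ℕ} (α : E [⋀^Fin p]→L[ℝ] ℝ)
    (v : Fin (p + 1) → X) : ℝ :=
  ∑ i : Fin (p + 1), (-1 : ℝ) ^ (i : ℕ) * act α (Ψ (v i)).2 (i.removeNth fun j => (Ψ (v j)).1)

theorem coframeForm_eq_torsion (Ψ : X ≃ₗ[ℝ] E × (E →L[ℝ] E)) {p : ℕ} (α : E [⋀^Fin p]→L[ℝ] ℝ)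
    {v : Fin (p + 1) → X} {δ : E →L[ℝ] E →L[ℝ] E} (h : ∀ i, (Ψ (v i)).2 = δ (Ψ (v i)).1) :
    coframeForm Ψ α v = torsion δ α fun j => (Ψ (v j)).1 := by
  rw [torsion_apply]
  exact Finset.sum_congr rfl fun i _ => by rw [h]

/-- The coframe `(θ, ω - ω₀(θ))`. -/
noncomputable def shear (ω₀ : E →L[ℝ] E →L[ℝ] E) : (E × (E →L[ℝ] E)) ≃ₗ[ℝ] E × (E →L[ℝ] E) where
  toFun v := (v.1, v.2 - ω₀ v.1)
  invFun v := (v.1, v.2 + ω₀ v.1)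
  map_add' v w := by
    ext1
    · rfl
    · simp only [Prod.fst_add, Prod.snd_add, map_add]; abel
  map_smul' c v := by
    ext1
    · rfl
    · simp only [Prod.smul_fst, Prod.smul_snd, map_smul, RingHom.id_apply, smul_sub]
  left_inv v := by simp
  right_inv v := by simp

theorem coframeForm_shear (Ψ : X ≃ₗ[ℝ] E × (E →L[ℝ] E)) (ω₀ : E →L[ℝ] E →L[ℝ] E) {p : ℕ}
    (α : E [⋀^Fin p]→L[ℝ] ℝ) (v : Fin (p + 1) → X) :
    coframeForm (Ψ.trans (shear ω₀)) α v =
      coframeForm Ψ α v - torsion ω₀ α fun j => (Ψ (v j)).1 := by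
  rw [torsion_apply, coframeForm, coframeForm, ← Finset.sum_sub_distrib]
  refine Finset.sum_congr rfl fun i _ => ?_
  rw [← mul_sub]
  congr 1
  exact congrArg (fun β => β (i.removeNth fun j => (Ψ (v j)).1))
    (map_sub (act α) (Ψ (v i)).2 (ω₀ (Ψ (v i)).1))

variable [FiniteDimensional ℝ E]

/-- A transverse subspace is part of the graph of a connection. -/
theorem exists_graph (Ψ : X ≃ₗ[ℝ] E × (E →L[ℝ] E)) {F : Submodule ℝ X}
    (hF : ∀ v ∈ F, (Ψ v).1 = 0 → v = 0) :
    ∃ δ : E →L[ℝ] E →L[ℝ] E, ∀ v ∈ F, (Ψ v).2 = δ (Ψ v).1 := by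
  let θ : F →ₗ[ℝ] E := (LinearMap.fst ℝ _ _) ∘ₗ Ψ.toLinearMap ∘ₗ F.subtype
  have hθ : LinearMap.ker θ = ⊥ := by
    rw [LinearMap.ker_eq_bot']
    intro v hv
    exact Subtype.ext (hF v v.2 hv)
  obtain ⟨g, hg⟩ := LinearMap.exists_leftInverse_of_injective θ hθ
  refine ⟨((LinearMap.snd ℝ _ _) ∘ₗ Ψ.toLinearMap ∘ₗ F.subtype ∘ₗ g).toContinuousLinearMap,
    fun v hv => ?_⟩
  have h1 : g (θ ⟨v, hv⟩) = ⟨v, hv⟩ := LinearMap.congr_fun hg ⟨v, hv⟩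
  change _ = (Ψ (g (θ ⟨v, hv⟩)).1).2
  rw [h1]

/-- The polar space of an integral element which satisfies Cartan's test: in the coframe, it is the
translate by an integral element `ε` over `T` of the space of vectors with vertical component in the
polar kernel. -/
theorem polarSpace_iff {n : ℕ} (hE : Module.finrank ℝ E = n)
    {A : ∀ p, Submodule ℝ (E [⋀^Fin p]→L[ℝ] ℝ)} (Ψ : X ≃ₗ[ℝ] E × (E →L[ℝ] E))
    {F : Submodule ℝ X} (hF : ∀ v ∈ F, (Ψ v).1 = 0 → v = 0)
    (hFA : ∀ p, ∀ α ∈ A p, ∀ v : Fin (p + 1) → X, (∀ i, v i ∈ F) → coframeForm Ψ α v = 0)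
    {x : Fin n → E} (h : IsRegularFlag A x) {k : ℕ} (hk : k ≤ n)
    (hFk : ∀ y, y ∈ flag x k ↔ ∃ v ∈ F, (Ψ v).1 = y) :
    ∃ ε : E →L[ℝ] E →L[ℝ] E, ∀ w : X,
      (∀ p, ∀ α ∈ A p, ∀ y : Fin p → X, (∀ i, y i ∈ F) →
        coframeForm Ψ α (Fin.snoc (α := fun _ => X) y w) = 0) ↔
        (Ψ w).2 - ε (Ψ w).1 ∈ polarKernel A (flag x k) := by
  obtain ⟨δ, hδ⟩ := exists_graph Ψ hF
  obtain ⟨ε, hε, hεδ⟩ := exists_extension hE h hk δ fun p α hα v hv => by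
    choose v' hv' hv'' using fun i => (hFk _).1 (hv i)
    rw [← hFA p α hα v' hv', coframeForm_eq_torsion Ψ α fun i => hδ _ (hv' i)]
    simp_rw [hv'']
  -- in the coframe sheared by `ε` only the vertical component of the last argument survives
  have key : ∀ w p, ∀ α ∈ A p, ∀ y : Fin p → X, (∀ i, y i ∈ F) →
      coframeForm Ψ α (Fin.snoc (α := fun _ => X) y w) =
        (-1) ^ p * act α ((Ψ w).2 - ε (Ψ w).1) fun i => (Ψ (y i)).1 := by
    intro w p α hα y hy
    have h1 : torsion ε α (fun j => (Ψ (Fin.snoc (α := fun _ => X) y w j : X)).1) = 0 := by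
      rw [hε p α hα]
      rfl
    rw [← sub_zero (coframeForm Ψ α _), ← h1, ← coframeForm_shear, coframeForm,
      Fin.sum_univ_castSucc, Finset.sum_eq_zero, zero_add]
    · have h3 : (Fin.init fun j => (Ψ (Fin.snoc (α := fun _ => X) y w j : X)).1) =
          fun i => (Ψ (y i)).1 := by
        funext i
        simp [Fin.init]
      simp [shear, Fin.removeNth_last, h3]
    · intro i _
      have h2 : (Ψ (y i)).2 - ε (Ψ (y i)).1 = 0 := by
        rw [hδ _ (hy i), hεδ _ ((hFk _).2 ⟨y i, hy i, rfl⟩), sub_self]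
      simp [shear, h2]
  refine ⟨ε, fun w => ⟨fun h1 p α hα v hv => ?_, fun h1 p α hα y hy => ?_⟩⟩
  · choose v' hv' hv'' using fun i => (hFk _).1 (hv i)
    have h2 := h1 p α hα v' hv'
    rw [key w p α hα v' hv'] at h2
    simp_rw [hv''] at h2
    simpa using h2
  · rw [key w p α hα y hy, h1 p α hα _ fun i => (hFk _).2 ⟨y i, hy i, rfl⟩, mul_zero]

theorem finrank_polarSpace (Ψ : X ≃ₗ[ℝ] E × (E →L[ℝ] E)) (ε : E →L[ℝ] E →L[ℝ] E)
    (Z : Submodule ℝ (E →L[ℝ] E)) {S : Submodule ℝ X}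
    (hS : ∀ w, w ∈ S ↔ (Ψ w).2 - ε (Ψ w).1 ∈ Z) :
    Module.finrank ℝ S = Module.finrank ℝ E + Module.finrank ℝ Z := by
  let Ψ' : X ≃ₗ[ℝ] E × (E →L[ℝ] E) := Ψ.trans (shear ε)
  let g : (E × Z) →ₗ[ℝ] X := Ψ'.symm.toLinearMap ∘ₗ LinearMap.prodMap LinearMap.id Z.subtype
  have hg : Function.Injective g := Ψ'.symm.injective.comp
    (Function.injective_id.prodMap Z.injective_subtype)
  have h1 : S = LinearMap.range g := by
    ext w
    rw [hS, LinearMap.mem_range]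
    constructor
    · intro h
      exact ⟨((Ψ w).1, ⟨_, h⟩), Ψ'.symm_apply_eq.2 rfl⟩
    · rintro ⟨⟨y, z⟩, rfl⟩
      have h2 : Ψ' (g (y, z)) = (y, z.1) := Ψ'.apply_symm_apply _
      have h3 : (Ψ (g (y, z))).2 - ε (Ψ (g (y, z))).1 = z.1 := congrArg Prod.snd h2
      rw [h3]
      exact z.2
  rw [h1, LinearMap.finrank_range_of_inj hg, Module.finrank_prod]

/-- A decomposable form which is nonzero on a subspace and annihilates given vectors of it. -/
theorem exists_form_of_linearIndependent {W : Submodule ℝ E} {p q : ℕ}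
    (hW : Module.finrank ℝ W = p + q) {x : Fin q → E} (hx : LinearIndependent ℝ x)
    (hxW : ∀ i, x i ∈ W) : ∃ α : E [⋀^Fin p]→L[ℝ] ℝ, (∃ v, (∀ i, v i ∈ W) ∧ α v ≠ 0) ∧
      ∀ (y : Fin p → E) i j, y i = x j → α y = 0 := by
  let N : Submodule ℝ E := Submodule.span ℝ (Set.range x)
  have hNW : N ≤ W := Submodule.span_le.2 (by rintro _ ⟨i, rfl⟩; exact hxW i)
  have hN : Module.finrank ℝ N = q := by
    rw [finrank_span_eq_card hx, Fintype.card_fin]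
  have hW' : Module.finrank ℝ (W.map N.mkQ) = p := by
    have h1 := LinearMap.finrank_range_add_finrank_ker (N.mkQ ∘ₗ W.subtype)
    have h2 : LinearMap.ker (N.mkQ ∘ₗ W.subtype) = N.comap W.subtype := by
      rw [LinearMap.ker_comp, Submodule.ker_mkQ]
    rw [h2, LinearMap.range_comp, Submodule.range_subtype,
      (Submodule.comapSubtypeEquivOfLe hNW).finrank_eq] at h1
    omega
  let c : Module.Basis (Fin p) ℝ (W.map N.mkQ) := Module.finBasisOfFinrankEq ℝ _ hW'
  obtain ⟨L, hL⟩ := LinearMap.exists_extend c.equivFun.toLinearMap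
  choose v hvW hv using fun i => (Submodule.mem_map.1 (c i).2)
  let L' : E →L[ℝ] (Fin p → ℝ) := (L ∘ₗ N.mkQ).toContinuousLinearMap
  let α : E [⋀^Fin p]→L[ℝ] ℝ :=
    { (Matrix.detRowAlternating (R := ℝ) (n := Fin p)).compLinearMap L'.toLinearMap with
      toFun := fun v => Matrix.det (Matrix.of fun a b => L' (v a) b)
      cont := by
        refine Continuous.matrix_det ?_
        fun_prop }
  have hα : ∀ v, α v = Matrix.det (Matrix.of fun a b => L' (v a) b) := fun v => rfl
  refine ⟨α, ⟨v, hvW, ?_⟩, fun y i j hij => ?_⟩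
  · have h1 : (Matrix.of fun a b => L' (v a) b) = (1 : Matrix (Fin p) (Fin p) ℝ) := by
      ext a b
      have h2 : L' (v a) = c.equivFun (c a) := by
        change L (N.mkQ (v a)) = _
        rw [hv a]
        exact LinearMap.congr_fun hL (c a)
      rw [Matrix.of_apply, h2, c.equivFun_self, Matrix.one_apply]
    rw [hα, h1, Matrix.det_one]
    exact one_ne_zero
  · rw [hα]
    refine Matrix.det_eq_zero_of_row_eq_zero i fun b => ?_
    have h2 : N.mkQ (x j) = 0 := by
      rw [Submodule.mkQ_apply, Submodule.Quotient.mk_eq_zero]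
      exact Submodule.subset_span ⟨j, rfl⟩
    change L (N.mkQ (y i)) b = 0
    rw [hij, h2, map_zero]
    rfl

end CoframedSpace

section Completion

variable {E : Type*} [NormedAddCommGroup E] [NormedSpace ℝ E] {n : ℕ}

/-- The tuple which continues the images of the standard basis by the vectors of `b`. -/
noncomputable def completion (b : Fin n → E) {k : ℕ} (X : (Fin k → ℝ) →L[ℝ] E) (i : Fin n) : E :=
  if h : (i : ℕ) < k then X (Pi.single ⟨i, h⟩ 1) else b i

theorem continuous_completion (b : Fin n → E) (k : ℕ) :
    Continuous fun X : (Fin k → ℝ) →L[ℝ] E => completion b X := by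
  refine continuous_pi fun i => ?_
  unfold completion
  split_ifs with h
  · fun_prop
  · fun_prop

theorem flag_completion (b : Fin n → E) {k : ℕ} (hk : k ≤ n) (X : (Fin k → ℝ) →L[ℝ] E) :
    flag (completion b X) k = LinearMap.range (X : (Fin k → ℝ) →ₗ[ℝ] E) := by
  have h1 : (completion b X '' {i | (i : ℕ) < k}) =
      Set.range fun i : Fin k => X (Pi.single i 1) := by
    ext y
    constructor
    · rintro ⟨i, hi, rfl⟩
      exact ⟨⟨i, hi⟩, by simp [completion, show (i : ℕ) < k from hi]⟩
    · rintro ⟨i, rfl⟩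
      exact ⟨⟨i, by omega⟩, i.2, by simp [completion]⟩
  rw [flag, h1, LinearMap.range_eq_map, ← (Pi.basisFun ℝ (Fin k)).span_eq, Submodule.map_span,
    ← Set.range_comp]
  congr 2
  ext i
  simp

theorem injective_of_completion (b : Fin n → E) {k : ℕ} (hk : k ≤ n) (X : (Fin k → ℝ) →L[ℝ] E)
    (h : LinearIndependent ℝ (completion b X)) : Function.Injective X := by
  have h1 : LinearIndependent ℝ fun i : Fin k => X (Pi.single i 1) := by
    have := h.comp (Fin.castLE hk) (Fin.castLE_injective hk)
    refine (linearIndependent_equiv' (Equiv.refl _) ?_).1 this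
    funext i
    simp [completion]
  have h2 : (LinearMap.ker (X : (Fin k → ℝ) →ₗ[ℝ] E)) = ⊥ := by
    rw [LinearMap.ker_eq_bot']
    intro f hf
    rw [LinearMap.pi_apply_eq_sum_univ] at hf
    funext i
    refine Fintype.linearIndependent_iff.1 h1 f ?_ i
    rw [← hf]
    refine Finset.sum_congr rfl fun i _ => congrArg _ ?_
    exact congrArg X (funext fun j => by simp [Pi.single_apply, eq_comm])
  exact LinearMap.ker_eq_bot.1 h2

end Completion

/-! ### Ranks of the polar equations near an integral element -/

section PolarRank

variable {E : Type*} [NormedAddCommGroup E] [NormedSpace ℝ E]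
  {H : Type*} [TopologicalSpace H] {I : ModelWithCorners ℝ E H}
  {P : Type*} [TopologicalSpace P] [ChartedSpace H P]
  {T : Type*} [NormedAddCommGroup T] [NormedSpace ℝ T]

theorem exists_completion_eq {n : ℕ} (b : Fin n → T) {k : ℕ} (hk : k ≤ n) :
    ∃ L : (Fin k → ℝ) →L[ℝ] T, completion b L = b := by
  refine ⟨∑ i : Fin k, (ContinuousLinearMap.proj (R := ℝ) i).smulRight (b (Fin.castLE hk i)), ?_⟩
  funext i
  unfold completion
  split_ifs with h
  · simp [Pi.single_apply, Fin.castLE]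
  · rfl

/-- The `k`-planes near the `k`-th member of a flag are the `k`-th members of nearby flags. -/
theorem eventually_flag [IsManifold I 1 P] {n : ℕ} {θ : ∀ p : P, TangentSpace I p →L[ℝ] T}
    (hθ : IsContinuousField θ) {b : Fin n → T} {U : Set (Fin n → T)} (hU : IsOpen U)
    (hUb : ∀ x ∈ U, LinearIndependent ℝ x) {k : ℕ} (hk : k ≤ n)
    (F₀ : Gr I P k) (w₀ : (Fin k → ℝ) →L[ℝ] TangentSpace I F₀.base)
    (hinj : Function.Injective w₀) (hw₀ : LinearMap.range w₀.toLinearMap = F₀.space)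
    (hbU : completion b (θ F₀.base ∘L w₀ : (Fin k → ℝ) →L[ℝ] T) ∈ U) :
    ∀ᶠ F' in 𝓝 F₀, ∃ x ∈ U, (∀ v ∈ F'.space, θ F'.base v = 0 → v = 0) ∧
      ∀ y, y ∈ flag x k ↔ ∃ v ∈ F'.space, θ F'.base v = y := by
  let O : Set ((Fin k → ℝ) →L[ℝ] T) := ⋃ h : (Fin k → ℝ) ≃L[ℝ] (Fin k → ℝ),
    {X | completion b (X ∘L (h : (Fin k → ℝ) →L[ℝ] (Fin k → ℝ))) ∈ U}
  have hO : IsOpen O := isOpen_iUnion fun h => hU.preimage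
    ((continuous_completion b k).comp (continuous_id.clm_comp continuous_const))
  have hinv : ∀ X ∈ O, ∀ h : (Fin k → ℝ) ≃L[ℝ] (Fin k → ℝ),
      X ∘L (h : (Fin k → ℝ) →L[ℝ] (Fin k → ℝ)) ∈ O := by
    intro X hX h
    obtain ⟨h', hh'⟩ := Set.mem_iUnion.1 hX
    refine Set.mem_iUnion.2 ⟨h'.trans h.symm, ?_⟩
    have : (X ∘L (h : (Fin k → ℝ) →L[ℝ] (Fin k → ℝ))) ∘L
        ((h'.trans h.symm : (Fin k → ℝ) ≃L[ℝ] (Fin k → ℝ)) : (Fin k → ℝ) →L[ℝ] (Fin k → ℝ)) =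
          X ∘L (h' : (Fin k → ℝ) →L[ℝ] (Fin k → ℝ)) := by
      ext1 v
      simp
    rw [Set.mem_ofPred_eq, this]
    exact hh'
  have hO₀ : (θ F₀.base ∘L w₀ : (Fin k → ℝ) →L[ℝ] T) ∈ O :=
    Set.mem_iUnion.2 ⟨ContinuousLinearEquiv.refl ℝ _, hbU⟩
  filter_upwards [Gr.eventually_of_isOpen hθ hO hinv F₀ w₀ hinj hw₀ hO₀] with F' hF'
  obtain ⟨w, hw, hwF, hwO⟩ := hF'
  obtain ⟨h, hh⟩ := Set.mem_iUnion.1 hwO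
  refine ⟨_, hh, ?_, ?_⟩
  · intro v hv hv0
    rw [← hwF] at hv
    obtain ⟨X, rfl⟩ := hv
    have h1 := injective_of_completion b hk _ (hUb _ hh)
    have h2 : h.symm X = 0 := by
      refine h1 ?_
      rw [map_zero]
      simpa using hv0
    have h3 : X = 0 := by simpa using h2
    rw [h3]
    exact map_zero w
  · intro y
    rw [flag_completion b hk, ← hwF]
    constructor
    · rintro ⟨X, rfl⟩
      exact ⟨w (h X), ⟨h X, rfl⟩, rfl⟩
    · rintro ⟨_, ⟨X, rfl⟩, rfl⟩
      exact ⟨h.symm X, by simp⟩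

variable [FiniteDimensional ℝ E] [FiniteDimensional ℝ T]

/-- The rank of the polar equations of an integral element whose horizontal projection is the
member of a flag which satisfies Cartan's test, for a system whose generators are given in a
coframe by the forms in `A`. -/
theorem finrank_polarEquations_add {n : ℕ} (hT : Module.finrank ℝ T = n)
    {A : ∀ p, Submodule ℝ (T [⋀^Fin p]→L[ℝ] ℝ)}
    {S : ∀ k, MForm I P k → Prop} {k : ℕ} (hk : k ≤ n) {F : Gr I P k}
    (hF : IsIntegralElement (generatedIdeal S) F.base F.space)
    (hγ : ∀ p q, p + q = k → ∀ x : Fin q → TangentSpace I F.base, LinearIndependent ℝ x →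
      (∀ i, x i ∈ F.space) → ∃ γ : MForm I P p, γ.IsSmooth ∧ (∃ v, (∀ i, v i ∈ F.space) ∧
        γ F.base v ≠ 0) ∧ ∀ y i j, y i = x j → γ F.base y = 0)
    (Ψ : TangentSpace I F.base ≃ₗ[ℝ] T × (T →L[ℝ] T))
    {θ : TangentSpace I F.base → T} (hΨ : ∀ v, (Ψ v).1 = θ v)
    (hFθ : ∀ v ∈ F.space, θ v = 0 → v = 0)
    (hFA : ∀ p, ∀ α ∈ A p, ∀ v : Fin (p + 1) → TangentSpace I F.base, (∀ i, v i ∈ F.space) →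
        coframeForm Ψ α v = 0)
    (h1 : ∀ p, ∀ α ∈ A p, ∃ β, S (p + 1) β ∧ ∀ v, β F.base v = coframeForm Ψ α v)
    (h2 : ∀ q β, S q β → ∃ p, ∃ α ∈ A p, ∃ h : p + 1 = q, ∀ v,
        β F.base v = coframeForm Ψ α (v ∘ Fin.cast h))
    {x : Fin n → T} (h : IsRegularFlag A x)
    (hFk : ∀ y, y ∈ flag x k ↔ ∃ v ∈ F.space, θ v = y) :
    Module.finrank ℝ (polarEquations (generatedIdeal S) F) +
      (n + polarNullity A x k) = Module.finrank ℝ E := by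
  simp only [← hΨ] at hFθ hFk
  obtain ⟨ε, hε⟩ := polarSpace_iff hT Ψ hFθ hFA h hk hFk
  have hfin : FiniteDimensional ℝ (TangentSpace I F.base) :=
    inferInstanceAs (FiniteDimensional ℝ E)
  have hX : Module.finrank ℝ (TangentSpace I F.base) = Module.finrank ℝ E := rfl
  rw [← hX, ← Subspace.finrank_add_finrank_dualCoannihilator_eq
    (polarEquations (generatedIdeal S) F),
    finrank_polarSpace Ψ ε (polarKernel A (flag x k))
      (S := (polarEquations (generatedIdeal S) F).dualCoannihilator), hT]
  · rfl
  intro w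
  rw [← hε w]
  refine (mem_dualCoannihilator_polarEquations hF (fun q β hβ v hv => ?_) hγ w).trans ⟨?_, ?_⟩
  · obtain ⟨p, α, hα, hpq, hβα⟩ := h2 q β hβ
    rw [hβα]
    exact hFA p α hα _ fun i => hv _
  · intro h p α hα y hy
    obtain ⟨β, hβ, hβα⟩ := h1 p α hα
    rw [← hβα]
    exact h p β hβ y hy
  · intro h q β hβ y hy
    obtain ⟨p, α, hα, hpq, hβα⟩ := h2 _ β hβ
    obtain rfl : p = q := by omega
    rw [hβα]
    exact h p α hα y hy

end PolarRank

/-! ### Involutivity of `𝓘_{A,f}` -/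

section Involutivity

variable {n : ℕ} {M : Type*} [TopologicalSpace M] [ChartedSpace (Euc n) M]
  [IsManifold (𝓡 n) ω M]

/-- In the coframe `(θ, ω - ω₀(θ))` the generators of `𝓘_{A,f}` are given by the forms in `A`. -/
theorem exists_coframe {A : GradedSubspace n} {f : ∀ p, A p →ₗ[ℝ] A (p + 1)}
    (hff : ∀ p (a : A p), f (p + 1) (f p a) = 0) (ω₀ : Euc n →L[ℝ] Euc n →L[ℝ] Euc n)
    (hω : ∀ p (a : A p), (f p a).1 = torsion ω₀ a.1) (u : FrameBundle n M) :
    ∃ Ψ : TangentSpace (frameModel n) u ≃ₗ[ℝ] Euc n × (Euc n →L[ℝ] Euc n),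
      (∀ v, (Ψ v).1 = tautologicalForm u v) ∧
      (∀ p, ∀ α ∈ A p, ∃ β, IsGenerator M A f (p + 1) β ∧ ∀ v, β u v = coframeForm Ψ α v) ∧
      (∀ q β, IsGenerator M A f q β → ∃ p, ∃ α ∈ A p, ∃ h : p + 1 = q, ∀ v,
        β u v = coframeForm Ψ α (v ∘ Fin.cast h)) := by
  obtain ⟨Ψ, hΨ, hd⟩ := exists_structureEquations u
  have h1 : ∀ p (α : A p) v, ((iota M α.1).d - iota M (f p α).1) u v =
      coframeForm (Ψ.trans (shear ω₀)) α.1 v := by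
    intro p α v
    rw [coframeForm_shear]
    change (iota M α.1).d u v - iota M (f p α).1 u v = _
    rw [hd, hω]
    simp only [coframeForm, hΨ]
    rfl
  have h2 : ∀ p (α : A p) v, (iota M (f p α).1).d u v =
      coframeForm (Ψ.trans (shear ω₀)) (f p α).1 v := by
    intro p α v
    rw [← h1, hff]
    change _ = (iota M (f p α).1).d u v - 0
    rw [sub_zero]
  refine ⟨Ψ.trans (shear ω₀), hΨ, fun p α hα => ⟨_, .structureEq p ⟨α, hα⟩, h1 p ⟨α, hα⟩⟩, ?_⟩
  intro q β hβ
  cases hβ with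
  | structureEq p α => exact ⟨p, α.1, α.2, rfl, h1 p α⟩
  | derivedEq p α => exact ⟨p + 1, (f p α).1, (f p α).2, rfl, h2 p α⟩

/-- There are smooth forms on the frame bundle which are nonzero on a transverse subspace and
annihilate given linearly independent vectors of it: forms `ι(α)` with `α` decomposable. -/
theorem exists_smooth_form {u : FrameBundle n M} {F : Submodule ℝ (TangentSpace (frameModel n) u)}
    (hF : ∀ v ∈ F, tautologicalForm u v = 0 → v = 0) {p q : ℕ}
    (hpq : Module.finrank ℝ F = p + q)
    {x : Fin q → TangentSpace (frameModel n) u} (hx : LinearIndependent ℝ x) (hxF : ∀ i, x i ∈ F) :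
    ∃ γ : MForm (frameModel n) (FrameBundle n M) p, γ.IsSmooth ∧
      (∃ v, (∀ i, v i ∈ F) ∧ γ u v ≠ 0) ∧ ∀ y i j, y i = x j → γ u y = 0 := by
  let g : F →ₗ[ℝ] Euc n := (tautologicalForm u).toLinearMap ∘ₗ F.subtype
  have hg : Function.Injective g := by
    rw [← LinearMap.ker_eq_bot, LinearMap.ker_eq_bot']
    exact fun v hv => Subtype.ext (hF v v.2 hv)
  have hx' : LinearIndependent ℝ fun i => (⟨x i, hxF i⟩ : F) :=
    LinearIndependent.of_comp F.subtype hx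
  obtain ⟨α, ⟨v, hv, hαv⟩, hα⟩ := exists_form_of_linearIndependent (p := p)
    (W := LinearMap.range g) (by rw [LinearMap.finrank_range_of_inj hg, hpq])
    (hx'.map' g (LinearMap.ker_eq_bot.2 hg)) fun i => ⟨_, rfl⟩
  choose w hw using hv
  refine ⟨iota M α, isSmooth_iota α, ⟨fun i => (w i).1, fun i => (w i).2, ?_⟩,
    fun y i j hij => hα _ i j ?_⟩
  · have : (fun i => tautologicalForm u (w i).1) = v := funext hw
    change α (fun i => tautologicalForm u (w i).1) ≠ 0
    rwa [this]
  · change tautologicalForm u (y i) = _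
    rw [hij]
    rfl

variable {A : GradedSubspace n} {f : ∀ p, A p →ₗ[ℝ] A (p + 1)}

/-- The integral elements of `𝓘_{A,f}`, in a coframe given by `exists_coframe`. -/
theorem isIntegralElement_iff {u : FrameBundle n M}
    {Ψ : TangentSpace (frameModel n) u ≃ₗ[ℝ] Euc n × (Euc n →L[ℝ] Euc n)}
    (h1 : ∀ p, ∀ α ∈ A p, ∃ β, IsGenerator M A f (p + 1) β ∧ ∀ v, β u v = coframeForm Ψ α v)
    (h2 : ∀ q β, IsGenerator M A f q β → ∃ p, ∃ α ∈ A p, ∃ h : p + 1 = q, ∀ v,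
        β u v = coframeForm Ψ α (v ∘ Fin.cast h))
    {F : Submodule ℝ (TangentSpace (frameModel n) u)} :
    IsIntegralElement (frameEDS M A f) u F ↔ ∀ p, ∀ α ∈ A p,
      ∀ v : Fin (p + 1) → TangentSpace (frameModel n) u, (∀ i, v i ∈ F) →
        coframeForm Ψ α v = 0 := by
  constructor
  · intro hF p α hα v hv
    obtain ⟨β, hβ, hβα⟩ := h1 p α hα
    rw [← hβα]
    have hF' : IsIntegralElement (generatedIdeal (IsGenerator M A f)) u F := hF
    refine hF'.generator (isSmooth_iota (ContinuousAlternatingMap.constOfIsEmpty ℝ (Euc n) (Fin 0)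
      (1 : ℝ))) (fun v => ?_) hβ hv
    exact one_ne_zero
  · intro h
    refine isIntegralElement_generatedIdeal fun q β hβ v hv => ?_
    obtain ⟨p, α, hα, hpq, hβα⟩ := h2 q β hβ
    rw [hβα]
    exact h p α hα _ fun i => hv _

theorem finrank_polarEquations_frameEDS (hff : ∀ p (a : A p), f (p + 1) (f p a) = 0)
    (ω₀ : Euc n →L[ℝ] Euc n →L[ℝ] Euc n) (hω : ∀ p (a : A p), (f p a).1 = torsion ω₀ a.1)
    {k : ℕ} (hk : k ≤ n) (F : Gr (frameModel n) (FrameBundle n M) k)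
    (hF : IsIntegralElement (frameEDS M A f) F.base F.space)
    (hFθ : ∀ v ∈ F.space, tautologicalForm F.base v = 0 → v = 0)
    {x : Fin n → Euc n} (h : IsRegularFlag A x)
    (hFk : ∀ y, y ∈ flag x k ↔ ∃ v ∈ F.space, tautologicalForm F.base v = y) :
    Module.finrank ℝ (polarEquations (frameEDS M A f) F) +
      (n + polarNullity A x k) =
      Module.finrank ℝ (Euc n × (Euc n →L[ℝ] Euc n)) := by
  obtain ⟨Ψ, hΨ, h1, h2⟩ := exists_coframe hff ω₀ hω F.base
  have hFA := (isIntegralElement_iff h1 h2).1 hF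
  have hγ := fun (p q : ℕ) (hpq : p + q = k)
    (x : Fin q → TangentSpace (frameModel n) F.base) (hx : LinearIndependent ℝ x)
    (hxF : ∀ i, x i ∈ F.space) => exists_smooth_form hFθ (by rw [F.finrank_space, hpq]) hx hxF
  exact finrank_polarEquations_add (finrank_euclideanSpace_fin (𝕜 := ℝ) (n := n)) hk hF hγ Ψ hΨ
    hFθ hFA h1 h2 h hFk

/-- The rank of the polar equations is constant on the integral elements near one whose horizontal
projection is a member of a flag which satisfies Cartan's test. -/
theorem eventually_finrank_polarEquations (hff : ∀ p (a : A p), f (p + 1) (f p a) = 0)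
    (ω₀ : Euc n →L[ℝ] Euc n →L[ℝ] Euc n) (hω : ∀ p (a : A p), (f p a).1 = torsion ω₀ a.1)
    {b : Fin n → Euc n} (h : IsRegularFlag A b) {k : ℕ} (hk : k < n)
    (F₀ : Gr (frameModel n) (FrameBundle n M) k)
    (w₀ : (Fin k → ℝ) →L[ℝ] TangentSpace (frameModel n) F₀.base)
    (hinj : Function.Injective w₀) (hw₀ : LinearMap.range w₀.toLinearMap = F₀.space)
    (hb : completion b (tautologicalForm F₀.base ∘L w₀ : (Fin k → ℝ) →L[ℝ] Euc n) = b)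
    (hF₀ : IsIntegralElement (frameEDS M A f) F₀.base F₀.space) :
    ∀ᶠ F' in 𝓝 F₀, IsIntegralElement (frameEDS M A f) F'.base F'.space →
      Module.finrank ℝ (polarEquations (frameEDS M A f) F') =
        Module.finrank ℝ (polarEquations (frameEDS M A f) F₀) := by
  have hn : Module.finrank ℝ (Euc n) = n := finrank_euclideanSpace_fin
  obtain ⟨U, hU, hbU, hUr⟩ := exists_isOpen_regular (E := Euc n) (A := A) (b := b) hn h
  have hev := eventually_flag isContinuousField_tautologicalForm hU (fun x hx => (hUr x hx).1.1)
    hk.le F₀ w₀ hinj hw₀ (by rw [hb]; exact hbU)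
  have hself := hev.self_of_nhds
  obtain ⟨x₀, hx₀, hx₀θ, hx₀F⟩ := hself
  have hr₀ := finrank_polarEquations_frameEDS hff ω₀ hω hk.le F₀ hF₀ hx₀θ (hUr x₀ hx₀).1 hx₀F
  have h4 := (hUr x₀ hx₀).2 k hk
  filter_upwards [hev] with F' hF' hint'
  obtain ⟨x, hx, hxθ, hxF⟩ := hF'
  have hr := finrank_polarEquations_frameEDS hff ω₀ hω hk.le F' hint' hxθ (hUr x hx).1 hxF
  have h3 := (hUr x hx).2 k hk
  omega

/-- If `f` is the restriction of the derivation defined by a connection, and Cartan's test is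
satisfied by some flag, then `𝓘_{A,f}` is involutive. -/
theorem isInvolutive_frameEDS (hff : ∀ p (a : A p), f (p + 1) (f p a) = 0)
    (ω₀ : Euc n →L[ℝ] Euc n →L[ℝ] Euc n) (hω : ∀ p (a : A p), (f p a).1 = torsion ω₀ a.1)
    {b : Fin n → Euc n} (h : IsRegularFlag A b) : IsInvolutive (frameEDS M A f) := by
  have hn : Module.finrank ℝ (Euc n) = n := finrank_euclideanSpace_fin
  choose L hL using fun k : Fin n => exists_completion_eq b k.2.le
  intro u
  obtain ⟨Ψ, hΨ, h1, h2⟩ := exists_coframe hff ω₀ hω u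
  refine ⟨?_, ?_⟩
  -- in the coframe of `exists_coframe` the horizontal space `ω - ω₀(θ) = 0` is an integral element
  · let g : Euc n →ₗ[ℝ] TangentSpace (frameModel n) u :=
      Ψ.symm.toLinearMap ∘ₗ LinearMap.inl ℝ (Euc n) (Euc n →L[ℝ] Euc n)
    have hg : ∀ y, Ψ (g y) = (y, 0) := fun y => Ψ.apply_symm_apply _
    refine ⟨LinearMap.range g, ?_, ?_, (isIntegralElement_iff h1 h2).2 ?_⟩
    · rw [LinearMap.finrank_range_of_inj, hn]
      exact Ψ.symm.injective.comp LinearMap.inl_injective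
    · rintro _ ⟨y, rfl⟩ hy
      rw [dProj_eq_zero_iff, ← hΨ, hg] at hy
      have hy' : y = 0 := hy
      rw [hy', map_zero]
    · intro p α hα v hv
      rw [coframeForm_eq_torsion Ψ α (δ := 0), torsion_zero]
      · rfl
      · intro i
        obtain ⟨y, hy⟩ := hv i
        rw [← hy, hg]
        rfl
  -- a transverse integral element is isomorphic to `T` by `θ`, which transports the flag of `b`
  · rintro F ⟨hFn, hFt, hF⟩
    have hFθ : ∀ v ∈ F, tautologicalForm u v = 0 → v = 0 := fun v hv h =>
      hFt v hv ((dProj_eq_zero_iff u v).2 h)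
    let θF : F →ₗ[ℝ] Euc n := (tautologicalForm u).toLinearMap ∘ₗ F.subtype
    have hθF : Function.Injective θF := by
      rw [← LinearMap.ker_eq_bot, LinearMap.ker_eq_bot']
      exact fun v hv => Subtype.ext (hFθ v v.2 hv)
    have hfin : FiniteDimensional ℝ (TangentSpace (frameModel n) u) :=
      inferInstanceAs (FiniteDimensional ℝ (Euc n × (Euc n →L[ℝ] Euc n)))
    let e : F ≃ₗ[ℝ] Euc n := LinearEquiv.ofInjectiveOfFinrankEq θF hθF (by rw [hFn, hn])
    have he : ∀ y, tautologicalForm u (e.symm y).1 = y := fun y => e.apply_symm_apply y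
    let g : Euc n →ₗ[ℝ] TangentSpace (frameModel n) u := F.subtype ∘ₗ e.symm.toLinearMap
    have hg : Function.Injective g := F.injective_subtype.comp e.symm.injective
    have hW : ∀ k : Fin (n + 1), Module.finrank ℝ ((flag b k).map g) = k := by
      intro k
      rw [← (Submodule.equivMapOfInjective g hg (flag b k)).finrank_eq]
      exact finrank_flag h.1 (Nat.lt_succ_iff.1 k.2)
    refine ⟨hF, fun k => (flag b k).map g, hW, fun k l hkl => Submodule.map_mono
      (flag_mono b hkl), ?_, fun k => ?_⟩
    · beta_reduce
      rw [Fin.val_last, flag_eq_top hn b h.1, Submodule.map_top, LinearMap.range_comp,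
        LinearEquiv.range, Submodule.map_top, Submodule.range_subtype]
    · have hLi : Function.Injective (L k) :=
        injective_of_completion b k.2.le (L k) (by rw [hL]; exact h.1)
      have hLr : flag b k = LinearMap.range (L k).toLinearMap := by
        rw [← flag_completion b k.2.le (L k), hL]
      refine eventually_finrank_polarEquations hff ω₀ hω h k.2
        ⟨u, (flag b k.castSucc).map g, hW k.castSucc⟩
        (g ∘ₗ (L k).toLinearMap).toContinuousLinearMap (hg.comp hLi) ?_ ?_ ?_
      · rw [LinearMap.coe_toContinuousLinearMap, LinearMap.range_comp, ← hLr]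
        rfl
      · have : tautologicalForm u ∘L (g ∘ₗ (L k).toLinearMap).toContinuousLinearMap = L k := by
          ext1 X
          exact he (L k X)
        rw [this, hL]
      · intro m η hη v hv
        refine hF m η hη v fun i => ?_
        obtain ⟨y, _, hy⟩ := hv i
        rw [← hy]
        exact (e.symm y).2

end Involutivity

/-! ### Derivations of the exterior algebra -/

section WedgeAlgebra

theorem sum_sign_comp {W : Type*} {r : ℕ} (F : (Fin r → W) → ℝ) (v : Fin r → W)
    (τ : Equiv.Perm (Fin r)) :
    ∑ σ : Equiv.Perm (Fin r), ((Equiv.Perm.sign σ : ℤ) : ℝ) *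
        (((Equiv.Perm.sign τ : ℤ) : ℝ) * F (fun i => v (σ (τ i)))) =
      ∑ σ : Equiv.Perm (Fin r), ((Equiv.Perm.sign σ : ℤ) : ℝ) * F (fun i => v (σ i)) := by
  refine Eq.trans ?_ (Equiv.sum_comp (Equiv.mulRight τ) _)
  refine Finset.sum_congr rfl fun σ _ => ?_
  simp only [Equiv.coe_mulRight, Equiv.Perm.sign_mul, Units.val_mul, Int.cast_mul,
    Equiv.Perm.mul_apply, mul_assoc]

variable {V : Type*} [AddCommGroup V] [Module ℝ V] [TopologicalSpace V]

theorem sign_smul_eq {r : ℕ} (σ : Equiv.Perm (Fin r)) (x : ℝ) :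
    Equiv.Perm.sign σ • x = ((Equiv.Perm.sign σ : ℤ) : ℝ) * x := by
  rcases Int.units_eq_one_or (Equiv.Perm.sign σ) with h | h <;> simp [h]

/-- The wedge product as a bilinear map. -/
noncomputable def wedgeBilin {p q r : ℕ} (h : p + q = r) :
    (V [⋀^Fin p]→L[ℝ] ℝ) →ₗ[ℝ] (V [⋀^Fin q]→L[ℝ] ℝ) →ₗ[ℝ] (V [⋀^Fin r]→L[ℝ] ℝ) :=
  LinearMap.mk₂ ℝ (wedge h)
    (fun a a' b => by
      ext v
      simp only [wedge_apply, ContinuousAlternatingMap.add_apply, add_mul, smul_add,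
        Finset.sum_add_distrib, mul_add])
    (fun c a b => by
      ext v
      simp only [wedge_apply, ContinuousAlternatingMap.smul_apply, smul_eq_mul, sign_smul_eq,
        Finset.mul_sum]
      exact Finset.sum_congr rfl fun _ _ => by ring)
    (fun a b b' => by
      ext v
      simp only [wedge_apply, ContinuousAlternatingMap.add_apply, smul_add,
        Finset.sum_add_distrib, mul_add])
    (fun c a b => by
      ext v
      simp only [wedge_apply, ContinuousAlternatingMap.smul_apply, smul_eq_mul, sign_smul_eq,
        Finset.mul_sum]
      exact Finset.sum_congr rfl fun _ _ => by ring)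

theorem wedgeBilin_apply {p q r : ℕ} (h : p + q = r) (a : V [⋀^Fin p]→L[ℝ] ℝ)
    (b : V [⋀^Fin q]→L[ℝ] ℝ) : wedgeBilin h a b = wedge h a b := rfl

/-- The wedge product of three forms, the first two multiplied first. -/
theorem wedge_wedge_left {p q r : ℕ} (α : V [⋀^Fin p]→L[ℝ] ℝ) (β : V [⋀^Fin q]→L[ℝ] ℝ)
    (γ : V [⋀^Fin r]→L[ℝ] ℝ) (v : Fin (p + q + r) → V) :
    wedge rfl (wedge rfl α β) γ v = ((p ! : ℝ) * q ! * r !)⁻¹ *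
      ∑ σ : Equiv.Perm (Fin (p + q + r)), ((Equiv.Perm.sign σ : ℤ) : ℝ) *
        (α (fun i => v (σ (Fin.castAdd r (Fin.castAdd q i)))) *
        β (fun i => v (σ (Fin.castAdd r (Fin.natAdd p i)))) *
        γ (fun i => v (σ (Fin.natAdd (p + q) i)))) := by
  let F : (Fin (p + q + r) → V) → ℝ := fun w => α (fun i => w (Fin.castAdd r (Fin.castAdd q i))) *
        β (fun i => w (Fin.castAdd r (Fin.natAdd p i))) * γ (fun i => w (Fin.natAdd (p + q) i))
  let ext : Equiv.Perm (Fin (p + q)) → Equiv.Perm (Fin (p + q + r)) := fun τ =>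
    finSumFinEquiv.permCongr (Equiv.Perm.sumCongr τ 1)
  have h1 : ∀ τ i, ext τ (Fin.castAdd r i) = Fin.castAdd r (τ i) := by
    intro τ i
    simp [ext, Equiv.permCongr_apply]
  have h2 : ∀ τ i, ext τ (Fin.natAdd (p + q) i) = Fin.natAdd (p + q) i := by
    intro τ i
    simp [ext, Equiv.permCongr_apply]
  have h3 : ∀ τ, Equiv.Perm.sign (ext τ) = Equiv.Perm.sign τ := by
    intro τ
    simp [ext, Equiv.Perm.sign_permCongr, Equiv.Perm.sign_sumCongr]
  have h4 : ∀ σ : Equiv.Perm (Fin (p + q + r)), wedge rfl α β (fun i => v (σ (Fin.castAdd r i))) *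
      γ (fun i => v (σ (Fin.natAdd (p + q) i))) = ((p ! * q ! : ℕ) : ℝ)⁻¹ *
        ∑ τ : Equiv.Perm (Fin (p + q)), ((Equiv.Perm.sign (ext τ) : ℤ) : ℝ) *
          F (fun i => v (σ (ext τ i))) := by
    intro σ
    rw [wedge_apply, mul_assoc, Finset.sum_mul]
    congr 1
    refine Finset.sum_congr rfl fun τ _ => ?_
    simp only [F, h1, h2, h3, sign_smul_eq, Fin.cast_refl, id, mul_assoc]
  rw [wedge_apply]
  simp only [Fin.cast_refl, id, sign_smul_eq, h4, Finset.mul_sum]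
  rw [Finset.sum_comm]
  have h5 : ∀ τ : Equiv.Perm (Fin (p + q)), ∑ σ : Equiv.Perm (Fin (p + q + r)),
      (((p + q) ! * r ! : ℕ) : ℝ)⁻¹ * (((Equiv.Perm.sign σ : ℤ) : ℝ) * (((p ! * q ! : ℕ) : ℝ)⁻¹ *
        (((Equiv.Perm.sign (ext τ) : ℤ) : ℝ) * F (fun i => v (σ (ext τ i)))))) =
      (((p + q) ! * r ! : ℕ) : ℝ)⁻¹ * ((p ! * q ! : ℕ) : ℝ)⁻¹ *
        ∑ σ : Equiv.Perm (Fin (p + q + r)), ((Equiv.Perm.sign σ : ℤ) : ℝ) *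
          F (fun i => v (σ i)) := by
    intro τ
    rw [← sum_sign_comp F v (ext τ), Finset.mul_sum]
    exact Finset.sum_congr rfl fun _ _ => by ring
  rw [Finset.sum_congr rfl fun τ _ => h5 τ, Finset.sum_const, Finset.card_univ, Fintype.card_perm,
    Fintype.card_fin, nsmul_eq_mul, ← Finset.mul_sum, ← mul_assoc]
  congr 1
  push_cast
  have := Nat.factorial_ne_zero (p + q)
  field_simp

/-- The wedge product of three forms, the last two multiplied first. -/
theorem wedge_wedge_right {p q r : ℕ} (α : V [⋀^Fin p]→L[ℝ] ℝ) (β : V [⋀^Fin q]→L[ℝ] ℝ)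
    (γ : V [⋀^Fin r]→L[ℝ] ℝ) (v : Fin (p + (q + r)) → V) :
    wedge rfl α (wedge rfl β γ) v = ((p ! : ℝ) * q ! * r !)⁻¹ *
      ∑ σ : Equiv.Perm (Fin (p + (q + r))), ((Equiv.Perm.sign σ : ℤ) : ℝ) *
        (α (fun i => v (σ (Fin.castAdd (q + r) i))) *
        β (fun i => v (σ (Fin.natAdd p (Fin.castAdd r i)))) *
        γ (fun i => v (σ (Fin.natAdd p (Fin.natAdd q i))))) := by
  let F : (Fin (p + (q + r)) → V) → ℝ := fun w => α (fun i => w (Fin.castAdd (q + r) i)) *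
        β (fun i => w (Fin.natAdd p (Fin.castAdd r i))) *
        γ (fun i => w (Fin.natAdd p (Fin.natAdd q i)))
  let ext : Equiv.Perm (Fin (q + r)) → Equiv.Perm (Fin (p + (q + r))) := fun τ =>
    finSumFinEquiv.permCongr (Equiv.Perm.sumCongr 1 τ)
  have h1 : ∀ τ i, ext τ (Fin.castAdd (q + r) i) = Fin.castAdd (q + r) i := by
    intro τ i
    simp [ext, Equiv.permCongr_apply]
  have h2 : ∀ τ i, ext τ (Fin.natAdd p i) = Fin.natAdd p (τ i) := by
    intro τ i
    simp [ext, Equiv.permCongr_apply]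
  have h3 : ∀ τ, Equiv.Perm.sign (ext τ) = Equiv.Perm.sign τ := by
    intro τ
    simp [ext, Equiv.Perm.sign_permCongr, Equiv.Perm.sign_sumCongr]
  have h4 : ∀ σ : Equiv.Perm (Fin (p + (q + r))), α (fun i => v (σ (Fin.castAdd (q + r) i))) *
      wedge rfl β γ (fun i => v (σ (Fin.natAdd p i))) = ((q ! * r ! : ℕ) : ℝ)⁻¹ *
        ∑ τ : Equiv.Perm (Fin (q + r)), ((Equiv.Perm.sign (ext τ) : ℤ) : ℝ) *
          F (fun i => v (σ (ext τ i))) := by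
    intro σ
    rw [wedge_apply, mul_left_comm, Finset.mul_sum]
    congr 1
    refine Finset.sum_congr rfl fun τ _ => ?_
    simp only [F, h1, h2, h3, sign_smul_eq, Fin.cast_refl, id]
    ring
  rw [wedge_apply]
  simp only [Fin.cast_refl, id, sign_smul_eq, h4, Finset.mul_sum]
  rw [Finset.sum_comm]
  have h5 : ∀ τ : Equiv.Perm (Fin (q + r)), ∑ σ : Equiv.Perm (Fin (p + (q + r))),
      ((p ! * (q + r) ! : ℕ) : ℝ)⁻¹ * (((Equiv.Perm.sign σ : ℤ) : ℝ) * (((q ! * r ! : ℕ) : ℝ)⁻¹ *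
        (((Equiv.Perm.sign (ext τ) : ℤ) : ℝ) * F (fun i => v (σ (ext τ i)))))) =
      ((p ! * (q + r) ! : ℕ) : ℝ)⁻¹ * ((q ! * r ! : ℕ) : ℝ)⁻¹ *
        ∑ σ : Equiv.Perm (Fin (p + (q + r))), ((Equiv.Perm.sign σ : ℤ) : ℝ) *
          F (fun i => v (σ i)) := by
    intro τ
    rw [← sum_sign_comp F v (ext τ), Finset.mul_sum]
    exact Finset.sum_congr rfl fun _ _ => by ring
  rw [Finset.sum_congr rfl fun τ _ => h5 τ, Finset.sum_const, Finset.card_univ, Fintype.card_perm,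
    Fintype.card_fin, nsmul_eq_mul, ← Finset.mul_sum, ← mul_assoc]
  congr 1
  push_cast
  have := Nat.factorial_ne_zero (q + r)
  field_simp

theorem wedge_assoc {p q r s t m : ℕ} (h₁ : p + q = s) (h₂ : s + r = m) (h₃ : q + r = t)
    (h₄ : p + t = m) (α : V [⋀^Fin p]→L[ℝ] ℝ) (β : V [⋀^Fin q]→L[ℝ] ℝ)
    (γ : V [⋀^Fin r]→L[ℝ] ℝ) :
    wedge h₂ (wedge h₁ α β) γ = wedge h₄ α (wedge h₃ β γ) := by
  subst h₁ h₂ h₃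
  ext v
  have h5 : wedge h₄ α (wedge rfl β γ) v = wedge rfl α (wedge rfl β γ) (v ∘ Fin.cast h₄) := by
    have : ∀ (m : ℕ) (h : p + (q + r) = m) (v : Fin m → V), wedge h α (wedge rfl β γ) v =
        wedge rfl α (wedge rfl β γ) (v ∘ Fin.cast h) := by
      intro m h v
      subst h
      rfl
    exact this _ h₄ v
  rw [wedge_wedge_left, h5, wedge_wedge_right,
    ← Equiv.sum_comp (finCongr h₄).symm.permCongr]
  congr 1
  refine Finset.sum_congr rfl fun σ _ => ?_
  rw [Equiv.Perm.sign_permCongr]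
  have h6 : ∀ i, (v ∘ Fin.cast h₄) ((finCongr h₄).symm.permCongr σ i) = v (σ (Fin.cast h₄ i)) := by
    intro i
    simp [Equiv.permCongr_apply]
  have e1 : ∀ i, Fin.cast h₄ (Fin.castAdd (q + r) i) = Fin.castAdd r (Fin.castAdd q i) :=
    fun _ => rfl
  have e2 : ∀ i, Fin.cast h₄ (Fin.natAdd p (Fin.castAdd r i)) = Fin.castAdd r (Fin.natAdd p i) :=
    fun _ => rfl
  have e3 : ∀ i, Fin.cast h₄ (Fin.natAdd p (Fin.natAdd q i)) = Fin.natAdd (p + q) i :=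
    fun _ => Fin.ext (by simp [add_assoc])
  simp only [h6, e1, e2, e3]

end WedgeAlgebra

section Derivations

variable {E : Type*} [NormedAddCommGroup E] [NormedSpace ℝ E]

/-- A covector as a form of degree one. -/
noncomputable def oneForm (ξ : E →L[ℝ] ℝ) : E [⋀^Fin 1]→L[ℝ] ℝ :=
  ContinuousAlternatingMap.ofSubsingleton ℝ E ℝ 0 ξ

theorem oneForm_apply (ξ : E →L[ℝ] ℝ) (v : Fin 1 → E) : oneForm ξ v = ξ (v 0) := rfl

/-- Alternation over one argument compared with alternation over all of them. -/
theorem sum_sign_uncurry {p : ℕ} (f : E →L[ℝ] E [⋀^Fin p]→L[ℝ] ℝ) (v : Fin (p + 1) → E) :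
    ∑ σ : Equiv.Perm (Fin (p + 1)), ((Equiv.Perm.sign σ : ℤ) : ℝ) *
      f (v (σ 0)) (fun j => v (σ j.succ)) =
        p ! * ContinuousAlternatingMap.alternatizeUncurryFin f v := by
  set a := ContinuousAlternatingMap.alternatizeUncurryFin f with ha
  let F : (Fin (p + 1) → E) → ℝ := fun w => f (w 0) fun j => w j.succ
  have ha' : ∀ w, a w = ∑ i : Fin (p + 1), ((Equiv.Perm.sign i.cycleRange.symm : ℤ) : ℝ) *
      F fun j => w (i.cycleRange.symm j) := by
    intro w
    rw [ha, ContinuousAlternatingMap.alternatizeUncurryFin_apply]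
    refine Finset.sum_congr rfl fun i _ => ?_
    rw [Equiv.Perm.sign_symm, Fin.sign_cycleRange, zsmul_eq_mul]
    simp only [F, Fin.cycleRange_symm_zero, Fin.cycleRange_symm_succ]
    push_cast
    rfl
  have h1 : ∑ σ : Equiv.Perm (Fin (p + 1)), ((Equiv.Perm.sign σ : ℤ) : ℝ) * a (fun i => v (σ i)) =
      ((p + 1) ! : ℝ) * a v := by
    have h2 : ∀ σ : Equiv.Perm (Fin (p + 1)),
        ((Equiv.Perm.sign σ : ℤ) : ℝ) * a (fun i => v (σ i)) = a v := by
      intro σ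
      have h3 := a.toAlternatingMap.map_perm v σ
      simp only [ContinuousAlternatingMap.coe_toAlternatingMap, Function.comp_def] at h3
      rw [h3, sign_smul_eq, ← mul_assoc]
      rcases Int.units_eq_one_or (Equiv.Perm.sign σ) with h | h <;> simp [h]
    rw [Finset.sum_congr rfl fun σ _ => h2 σ, Finset.sum_const, Finset.card_univ,
      Fintype.card_perm, Fintype.card_fin, nsmul_eq_mul]
  simp only [ha', Finset.mul_sum] at h1
  rw [Finset.sum_comm, Finset.sum_congr rfl fun i _ => sum_sign_comp F v i.cycleRange.symm,
    Finset.sum_const, Finset.card_univ, Fintype.card_fin, nsmul_eq_mul, ← Finset.mul_sum, ← ha',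
    Nat.factorial_succ] at h1
  push_cast at h1
  have h2 : (p : ℝ) + 1 ≠ 0 := by positivity
  rw [mul_assoc] at h1
  exact mul_left_cancel₀ h2 h1

theorem wedge_oneForm {p : ℕ} (h : 1 + p = p + 1) (ξ : E →L[ℝ] ℝ) (β : E [⋀^Fin p]→L[ℝ] ℝ) :
    wedge h (oneForm ξ) β = ContinuousAlternatingMap.alternatizeUncurryFin (ξ.smulRight β) := by
  ext v
  rw [wedge_apply]
  have h1 : Fin.cast h (Fin.castAdd p (0 : Fin 1)) = 0 := rfl
  have h2 : ∀ j, Fin.cast h (Fin.natAdd 1 j) = j.succ := fun j => Fin.ext (by simp)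
  have h3 := sum_sign_uncurry (ξ.smulRight β) v
  simp only [ContinuousLinearMap.smulRight_apply, ContinuousAlternatingMap.smul_apply,
    smul_eq_mul] at h3
  simp only [oneForm_apply, h1, h2, sign_smul_eq]
  rw [h3, Nat.factorial_one, one_mul]
  have := Nat.factorial_ne_zero p
  field_simp

theorem wedge_oneForm_comm (ξ η : E →L[ℝ] ℝ) :
    wedge (rfl : 1 + 1 = 2) (oneForm ξ) (oneForm η) =
      -wedge (rfl : 1 + 1 = 2) (oneForm η) (oneForm ξ) := by
  rw [wedge_oneForm rfl, wedge_oneForm rfl]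
  ext v
  rw [ContinuousAlternatingMap.neg_apply,
    ContinuousAlternatingMap.alternatizeUncurryFin_apply,
    ContinuousAlternatingMap.alternatizeUncurryFin_apply]
  simp [Fin.sum_univ_two, oneForm_apply, Fin.removeNth, Fin.succAbove]
  ring

/-- Endomorphisms act on the exterior algebra by derivations of degree zero. -/
theorem act_wedge {p q r : ℕ} (h : p + q = r) (α : E [⋀^Fin p]→L[ℝ] ℝ) (β : E [⋀^Fin q]→L[ℝ] ℝ)
    (B : E →L[ℝ] E) :
    act (wedge h α β) B = wedge h (act α B) β + wedge h α (act β B) := by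
  subst h
  ext v
  rw [ContinuousAlternatingMap.add_apply, wedge_apply, wedge_apply, ← mul_add,
    ← Finset.sum_add_distrib, act_apply]
  simp only [wedge_apply, ← Finset.mul_sum]
  rw [Finset.sum_comm]
  congr 1
  refine Finset.sum_congr rfl fun σ _ => ?_
  rw [← smul_add, ← Finset.smul_sum]
  congr 1
  simp only [Fin.cast_refl, id]
  rw [← Equiv.sum_comp σ, Fin.sum_univ_add, act_apply, act_apply, Finset.sum_mul, Finset.mul_sum]
  have h1 : ∀ k l, Function.update v (σ k) (B (v (σ k))) (σ l) =
      Function.update (fun l => v (σ l)) k (B (v (σ k))) l := by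
    intro k l
    rcases eq_or_ne l k with rfl | hlk
    · simp
    · simp [hlk]
  simp only [h1]
  have h2 : ∀ (i : Fin p) (j : Fin q), Fin.natAdd p j ≠ Fin.castAdd q i := by
    intro i j e
    have := congrArg Fin.val e
    simp at this
    omega
  congr 1
  · refine Finset.sum_congr rfl fun i _ => ?_
    congr 2
    · funext l
      rcases eq_or_ne l i with rfl | hl
      · simp
      · simp [hl]
    · funext l
      rw [Function.update_of_ne (h2 i l)]
  · refine Finset.sum_congr rfl fun i _ => ?_
    congr 2
    · funext l
      rw [Function.update_of_ne (h2 l i).symm]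
    · funext l
      rcases eq_or_ne l i with rfl | hl
      · simp
      · simp [hl]

/-- `torsion κ` as a linear map. -/
noncomputable def torsionLin (p : ℕ) (κ : E →L[ℝ] E →L[ℝ] E) :
    (E [⋀^Fin p]→L[ℝ] ℝ) →ₗ[ℝ] (E [⋀^Fin (p + 1)]→L[ℝ] ℝ) where
  toFun := torsion κ
  map_add' α β := by
    ext v
    simp [torsion_apply, act_add, mul_add, Finset.sum_add_distrib]
  map_smul' c α := by
    ext v
    simp [torsion_apply, act_smul, Finset.mul_sum, mul_left_comm]

theorem torsionLin_apply {p : ℕ} (κ : E →L[ℝ] E →L[ℝ] E) (α : E [⋀^Fin p]→L[ℝ] ℝ) :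
    torsionLin p κ α = torsion κ α := rfl

variable [FiniteDimensional ℝ E] {n : ℕ} (b : Module.Basis (Fin n) ℝ E)

/-- The dual basis, as continuous covectors. -/
noncomputable def coordCLM (c : Fin n) : E →L[ℝ] ℝ := (b.coord c).toContinuousLinearMap

theorem coordCLM_apply (c : Fin n) (v : E) : coordCLM b c v = b.repr v c := rfl

theorem alternatizeUncurryFin_eq_sum_wedge {p : ℕ} (f : E →L[ℝ] E [⋀^Fin p]→L[ℝ] ℝ) :
    ContinuousAlternatingMap.alternatizeUncurryFin f =
      ∑ c, wedge (add_comm 1 p) (oneForm (coordCLM b c)) (f (b c)) := by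
  simp only [wedge_oneForm]
  ext v
  simp only [ContinuousAlternatingMap.sum_apply,
    ContinuousAlternatingMap.alternatizeUncurryFin_apply]
  rw [Finset.sum_comm]
  refine Finset.sum_congr rfl fun i _ => ?_
  rw [← Finset.smul_sum]
  congr 1
  have h1 : f (v i) = ∑ c, b.repr (v i) c • f (b c) := by
    conv_lhs => rw [← b.sum_repr (v i), map_sum]
    simp only [map_smul]
  rw [h1, ContinuousAlternatingMap.sum_apply]
  rfl

/-- The Leibniz rule of the derivation `torsion κ`, for products with covectors. -/
theorem torsion_wedge_oneForm (b : Module.Basis (Fin n) ℝ E) {p : ℕ} (h : 1 + p = p + 1)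
    (h₂ : 1 + 1 + p = p + 1 + 1)
    (h₃ : 1 + (p + 1) = p + 1 + 1) (κ : E →L[ℝ] E →L[ℝ] E) (ξ : E →L[ℝ] ℝ)
    (β : E [⋀^Fin p]→L[ℝ] ℝ) : torsion κ (wedge h (oneForm ξ) β) =
      wedge h₂ (torsion κ (oneForm ξ)) β - wedge h₃ (oneForm ξ) (torsion κ β) := by
  simp only [torsion, alternatizeUncurryFin_eq_sum_wedge b, ContinuousLinearMap.comp_apply,
    act_wedge]
  simp only [← wedgeBilin_apply, map_sum, map_add, Finset.sum_add_distrib, LinearMap.sum_apply]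
  simp only [wedgeBilin_apply]
  rw [sub_eq_add_neg, ← Finset.sum_neg_distrib]
  congr 1
  · refine Finset.sum_congr rfl fun c _ => ?_
    rw [← wedge_assoc rfl h₂ h h₃]
  · refine Finset.sum_congr rfl fun c _ => ?_
    rw [← wedge_assoc rfl h₂ h h₃, wedge_oneForm_comm, ← wedge_assoc rfl h₂ _ h₃]
    simp only [← wedgeBilin_apply, map_neg, LinearMap.neg_apply]

/-- A form of positive degree is a combination of products with the dual basis. -/
theorem eq_sum_wedge_curryLeft {p : ℕ} (α : E [⋀^Fin (p + 1)]→L[ℝ] ℝ) :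
    α = ((p : ℝ) + 1)⁻¹ • ∑ c, wedge (add_comm 1 p) (oneForm (coordCLM b c))
      (α.curryLeft (b c)) := by
  rw [← alternatizeUncurryFin_eq_sum_wedge b,
    ContinuousAlternatingMap.alternatizeUncurryFin_curryLeft]
  have h2 : (p : ℝ) + 1 ≠ 0 := by positivity
  ext v
  simp
  field_simp

/-- Every linear map from covectors to `2`-forms is the alternation of a connection. -/
theorem exists_torsion_oneForm (D : (E [⋀^Fin 1]→L[ℝ] ℝ) →ₗ[ℝ] (E [⋀^Fin 2]→L[ℝ] ℝ)) :
    ∃ κ : E →L[ℝ] E →L[ℝ] E, ∀ c, torsion κ (oneForm (coordCLM b c)) =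
      D (oneForm (coordCLM b c)) := by
  let β : Fin n → E [⋀^Fin 2]→L[ℝ] ℝ := fun c => D (oneForm (coordCLM b c))
  let L : E →ₗ[ℝ] E →ₗ[ℝ] E := LinearMap.mk₂ ℝ
    (fun v w => ∑ c, ((1 / 2 : ℝ) * β c ![v, w]) • b c)
    (fun v v' w => by
      rw [← Finset.sum_add_distrib]
      refine Finset.sum_congr rfl fun c _ => ?_
      rw [← add_smul, ← mul_add]
      congr 2
      exact (β c).toMultilinearMap.cons_add ![w] v v')
    (fun t v w => by
      rw [Finset.smul_sum]
      refine Finset.sum_congr rfl fun c _ => ?_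
      rw [smul_smul, mul_left_comm]
      congr 2
      exact (β c).toMultilinearMap.cons_smul ![w] t v)
    (fun v w w' => by
      rw [← Finset.sum_add_distrib]
      refine Finset.sum_congr rfl fun c _ => ?_
      rw [← add_smul, ← mul_add]
      congr 2
      exact ((β c).curryLeft v).toMultilinearMap.cons_add ![] w w')
    (fun t v w => by
      rw [Finset.smul_sum]
      refine Finset.sum_congr rfl fun c _ => ?_
      rw [smul_smul, mul_left_comm]
      congr 2
      exact ((β c).curryLeft v).toMultilinearMap.cons_smul ![] t w)
  let κ : E →L[ℝ] E →L[ℝ] E :=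
    ((LinearMap.toContinuousLinearMap : (E →ₗ[ℝ] E) ≃ₗ[ℝ] (E →L[ℝ] E)).toLinearMap ∘ₗ
      L).toContinuousLinearMap
  have hκ : ∀ v w, κ v w = ∑ c, ((1 / 2 : ℝ) * β c ![v, w]) • b c := fun v w => rfl
  refine ⟨κ, fun c => ?_⟩
  have h1 : ∀ v w, coordCLM b c (κ v w) = (1 / 2 : ℝ) * β c ![v, w] := by
    intro v w
    rw [hκ, map_sum, Finset.sum_eq_single c]
    · simp [coordCLM_apply]
    · intro d _ hd
      simp [coordCLM_apply, hd]
    · simp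
  ext v
  have h2 : β c ![v 1, v 0] = -β c ![v 0, v 1] := by
    have := (β c).toAlternatingMap.map_swap ![v 0, v 1] (show (0 : Fin 2) ≠ 1 by decide)
    rw [ContinuousAlternatingMap.coe_toAlternatingMap] at this
    rw [← this]
    congr 1
    funext i
    fin_cases i <;> rfl
  have h3 : (![v 0, v 1] : Fin 2 → E) = v := by
    funext i
    fin_cases i <;> rfl
  rw [torsion_apply, Fin.sum_univ_two, act_apply, act_apply]
  simp [oneForm_apply, h1, h2, Fin.removeNth, Fin.succAbove]
  rw [h3]
  ring

/-- Every derivation of degree one of the exterior algebra is the alternation of a connection. -/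
theorem exists_torsion_of_derivation (b : Module.Basis (Fin n) ℝ E)
    (D : ∀ p, (E [⋀^Fin p]→L[ℝ] ℝ) →ₗ[ℝ] (E [⋀^Fin (p + 1)]→L[ℝ] ℝ))
    (hD : ∀ (p q r : ℕ) (h : p + q = r) (a : E [⋀^Fin p]→L[ℝ] ℝ) (b : E [⋀^Fin q]→L[ℝ] ℝ),
      D r (wedge h a b) = wedge (by omega) (D p a) b + (-1 : ℝ) ^ p • wedge (by omega) a (D q b)) :
    ∃ κ : E →L[ℝ] E →L[ℝ] E, ∀ p α, D p α = torsion κ α := by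
  obtain ⟨κ, hκ⟩ := exists_torsion_oneForm b (D 1)
  refine ⟨κ, fun p => ?_⟩
  induction p with
  | zero =>
    intro α
    -- a derivation annihilates the constants, as `1 ∧ 1 = 1`
    let c₁ : E [⋀^Fin 0]→L[ℝ] ℝ := ContinuousAlternatingMap.constOfIsEmpty ℝ E (Fin 0) (1 : ℝ)
    have h1 : wedge (rfl : 0 + 0 = 0) c₁ c₁ = c₁ := by
      ext v
      simp [wedge_apply, c₁]
    have h2 : wedge (rfl : 1 + 0 = 1) (D 0 c₁) c₁ = D 0 c₁ := by
      ext v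
      simp [wedge_apply, c₁]
    have h3 : wedge (rfl : 0 + 1 = 1) c₁ (D 0 c₁) = D 0 c₁ := by
      ext v
      simp [wedge_apply, c₁]
    have h4 := hD 0 0 0 rfl c₁ c₁
    rw [h1, h2, h3, pow_zero, one_smul, left_eq_add] at h4
    have h5 : α = α 0 • c₁ := by
      ext v
      rw [Subsingleton.elim v 0]
      simp [c₁]
    rw [h5, map_smul, h4, smul_zero]
    ext v
    simp [torsion_apply, act_apply]
  | succ p ih =>
    intro α
    have key : ∀ c (β : E [⋀^Fin p]→L[ℝ] ℝ),
        D (p + 1) (wedge (add_comm 1 p) (oneForm (coordCLM b c)) β) =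
          torsion κ (wedge (add_comm 1 p) (oneForm (coordCLM b c)) β) := by
      intro c β
      rw [hD, torsion_wedge_oneForm b _ (by omega) (by omega), hκ, ih, pow_one,
        sub_eq_add_neg]
      ext v
      simp only [ContinuousAlternatingMap.add_apply, ContinuousAlternatingMap.smul_apply,
        ContinuousAlternatingMap.neg_apply, smul_eq_mul, neg_one_mul]
    rw [eq_sum_wedge_curryLeft b α, map_smul, map_sum, Finset.sum_congr rfl fun c _ => key c _]
    simp only [← torsionLin_apply, map_smul, map_sum]

end Derivations


/-! ### Operators which extend to derivations -/

/-- A differential operator which extends to a derivation is the restriction of the alternation of a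
connection, which serves as the horizontal integral element. -/
theorem involutiveForAllOperators_of_isRegularFlag {n : ℕ} {A : GradedSubspace n}
    {b : Fin n → Euc n} (h : IsRegularFlag A b) : InvolutiveForAllOperators.{u} A := by
  intro f hf hD M _ _ _ _
  obtain ⟨D, hD, hDf⟩ := hD
  obtain ⟨κ, hκ⟩ := exists_torsion_of_derivation (EuclideanSpace.basisFun (Fin n) ℝ).toBasis D hD
  exact isInvolutive_frameEDS hf.1 κ (fun p a => (hDf p a).symm.trans (hκ p a.1)) h

theorem involutiveOnAllManifolds_zero {n : ℕ} {A : GradedSubspace n}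
    {b : Fin n → Euc n} (h : IsRegularFlag A b) :
    InvolutiveOnAllManifolds.{u} A (fun _ => 0) := by
  intro M _ _ _ _
  exact isInvolutive_frameEDS (fun p a => rfl) 0 (fun p a => (torsion_zero a.1).symm) h

/-! ### Cartan's test by counting equations -/

section Counting

theorem finrank_add_card_le {V ι : Type*} [AddCommGroup V] [Module ℝ V] [FiniteDimensional ℝ V]
    [Fintype ι] [DecidableEq ι] {Z : Submodule ℝ V} {F : ι → V →ₗ[ℝ] ℝ} {B : ι → V} {N : ℝ}
    (hN : N ≠ 0) (hFB : ∀ i k, F i (B k) = if i = k then N else 0) (hZ : ∀ i, ∀ v ∈ Z, F i v = 0) :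
    Module.finrank ℝ Z + Fintype.card ι ≤ Module.finrank ℝ V := by
  let g : (ι → ℝ) →ₗ[ℝ] V := Fintype.linearCombination ℝ B
  have hg : ∀ t i, F i (g t) = t i * N := by
    intro t i
    simp [g, Fintype.linearCombination_apply, hFB]
  have hinj : Function.Injective g := by
    rw [← LinearMap.ker_eq_bot, LinearMap.ker_eq_bot']
    intro t ht
    funext i
    have := hg t i
    rw [ht, map_zero] at this
    simpa [hN] using this.symm
  have hdisj : Disjoint Z (LinearMap.range g) := by
    rw [Submodule.disjoint_def]
    rintro _ hz ⟨t, rfl⟩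
    have : t = 0 := by
      funext i
      have := hg t i
      rw [hZ i _ hz] at this
      simpa [hN] using this.symm
    rw [this, map_zero]
  have := Submodule.finrank_add_finrank_le_of_disjoint hdisj
  rwa [LinearMap.finrank_range_of_inj hinj, Module.finrank_fintype_fun_eq_card] at this

theorem finrank_le_add_card {V κ : Type*} [AddCommGroup V] [Module ℝ V] [FiniteDimensional ℝ V]
    [Fintype κ] {S : Submodule ℝ V} (F : κ → V →ₗ[ℝ] ℝ)
    (hS : ∀ v, (∀ i, F i v = 0) → v ∈ S) :
    Module.finrank ℝ V ≤ Module.finrank ℝ S + Fintype.card κ := by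
  have h1 := LinearMap.finrank_range_add_finrank_ker (LinearMap.pi F)
  have h2 : LinearMap.ker (LinearMap.pi F) ≤ S := fun v hv => hS v fun i => congrFun hv i
  have h3 := Submodule.finrank_mono h2
  have h4 := Submodule.finrank_le (LinearMap.range (LinearMap.pi F))
  rw [Module.finrank_fintype_fun_eq_card] at h4
  omega

variable {n : ℕ} {E : Type*} [NormedAddCommGroup E] [NormedSpace ℝ E] [FiniteDimensional ℝ E]

theorem finrank_clm (hE : Module.finrank ℝ E = n) {F : Type*} [NormedAddCommGroup F]
    [NormedSpace ℝ F] [FiniteDimensional ℝ F] :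
    Module.finrank ℝ (E →L[ℝ] F) = n * Module.finrank ℝ F := by
  rw [← (LinearMap.toContinuousLinearMap : (E →ₗ[ℝ] F) ≃ₗ[ℝ] (E →L[ℝ] F)).finrank_eq,
    Module.finrank_linearMap, hE]

/-- Cartan's test by counting: `F i` are independent polar equations of the `level i`-th member of
the flag, with dual family `B`, and the integral elements are cut out by at most
`∑ᵢ (n - level i)` equations. -/
theorem isRegularFlag_of_functionals (hE : Module.finrank ℝ E = n)
    {A : ∀ p, Submodule ℝ (E [⋀^Fin p]→L[ℝ] ℝ)} {b : Fin n → E} (hb : LinearIndependent ℝ b)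
    {ι : Type*} [Fintype ι] [DecidableEq ι] {F : ι → (E →L[ℝ] E) →ₗ[ℝ] ℝ} {B : ι → E →L[ℝ] E}
    {N : ℝ} (hN : N ≠ 0) (hFB : ∀ i k, F i (B k) = if i = k then N else 0) (level : ι → ℕ)
    (hF : ∀ i, ∀ T ∈ polarKernel A (flag b (level i)), F i T = 0)
    (hV : n * (n * n) ≤ Module.finrank ℝ (closedConnections A) + ∑ i, (n - level i)) :
    IsRegularFlag A b := by
  refine ⟨hb, ?_⟩
  have h1 : ∀ j, polarNullity A b j + (Finset.univ.filter fun i => level i ≤ j).card ≤ n * n := by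
    intro j
    have := finrank_add_card_le (ι := {i // level i ≤ j}) (Z := polarKernel A (flag b j))
      (F := fun i => F i.1) (B := fun i => B i.1) hN
      (fun i k => by rw [hFB]; simp only [Subtype.ext_iff])
      (fun i v hv => hF i v fun p α hα w hw => hv p α hα w fun l => flag_mono b i.2 (hw l))
    rwa [finrank_clm hE, hE, Fintype.card_subtype] at this
  have h2 : ∑ j ∈ Finset.range n, (Finset.univ.filter fun i => level i ≤ j).card =
      ∑ i, (n - level i) := by
    simp only [Finset.card_filter]
    rw [Finset.sum_comm]
    refine Finset.sum_congr rfl fun i _ => ?_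
    rw [← Finset.card_filter]
    have : ((Finset.range n).filter fun j => level i ≤ j) = Finset.Ico (level i) n := by
      ext j
      simp [and_comm]
    rw [this, Nat.card_Ico]
  have h3 := Finset.sum_le_sum fun j (_ : j ∈ Finset.range n) => h1 j
  rw [Finset.sum_add_distrib, h2, Finset.sum_const, Finset.card_range, smul_eq_mul] at h3
  omega

end Counting

section Monomials

variable {n : ℕ} {E : Type*} [NormedAddCommGroup E] [NormedSpace ℝ E]

theorem apply_eq_zero_of_image_eq {p : ℕ} (β : E [⋀^Fin p]→L[ℝ] ℝ) (b : Fin n → E)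
    {J J' : Fin p → Fin n} (hJ' : Function.Injective J')
    (h : Finset.univ.image J = Finset.univ.image J') (h0 : β (fun i => b (J i)) = 0) :
    β (fun i => b (J' i)) = 0 := by
  have h1 : ∀ i, ∃ k, J k = J' i := by
    intro i
    have : J' i ∈ Finset.univ.image J := by
      rw [h]
      exact Finset.mem_image_of_mem _ (Finset.mem_univ i)
    simpa using this
  choose s hs using h1
  have hsi : Function.Injective s := fun i k hik => hJ' (by rw [← hs, ← hs, hik])
  let σ : Equiv.Perm (Fin p) := Equiv.ofBijective s (Finite.injective_iff_bijective.1 hsi)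
  have h2 := β.toAlternatingMap.map_perm (fun i => b (J i)) σ
  have h3 : (fun i => b (J i)) ∘ σ = fun i => b (J' i) := by
    funext i
    change b (J (s i)) = _
    rw [hs]
  rw [h3] at h2
  have h4 : β.toAlternatingMap (fun i => b (J i)) = 0 := h0
  rw [h4, smul_zero] at h2
  exact h2

/-- An alternating form vanishes if it does so on one arrangement of each set of basis vectors. -/
theorem eq_zero_of_forall_finset {p : ℕ} (β : E [⋀^Fin p]→L[ℝ] ℝ) (b : Module.Basis (Fin n) ℝ E)
    (h : ∀ S : Finset (Fin n), S.card = p → ∃ J : Fin p → Fin n, Finset.univ.image J = S ∧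
      β (fun i => b (J i)) = 0) : β = 0 := by
  apply ContinuousAlternatingMap.toAlternatingMap_injective
  refine Module.Basis.ext_alternating b fun J' hJ' => ?_
  obtain ⟨J, hJS, hJ⟩ := h (Finset.univ.image J') (by
    rw [Finset.card_image_of_injective _ hJ', Finset.card_univ, Fintype.card_fin])
  exact apply_eq_zero_of_image_eq β b hJ' hJS hJ

/-- The set `S` in increasing order. -/
noncomputable def increasing {p : ℕ} (S : {S : Finset (Fin n) // S.card = p}) : Fin p → Fin n :=
  S.1.orderEmbOfFin S.2

theorem eq_zero_of_forall_increasing {p : ℕ} (β : E [⋀^Fin p]→L[ℝ] ℝ)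
    (b : Module.Basis (Fin n) ℝ E)
    (h : ∀ S : {S : Finset (Fin n) // S.card = p}, β (fun i => b (increasing S i)) = 0) :
    β = 0 := by
  refine eq_zero_of_forall_finset β b fun S hS => ⟨increasing ⟨S, hS⟩, ?_, h ⟨S, hS⟩⟩
  exact Finset.image_orderEmbOfFin_univ S hS

/-- A component of the torsion of a fixed form, as a functional of the connection. -/
noncomputable def torsionFunctional {p : ℕ} (α : E [⋀^Fin p]→L[ℝ] ℝ) (v : Fin (p + 1) → E) :
    (E →L[ℝ] E →L[ℝ] E) →ₗ[ℝ] ℝ where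
  toFun δ := torsion δ α v
  map_add' δ ε := by rw [torsion_add]; rfl
  map_smul' c δ := by rw [torsion_smul]; rfl

/-- A component of the derivative of a fixed form under an endomorphism. -/
noncomputable def actFunctional {p : ℕ} (α : E [⋀^Fin p]→L[ℝ] ℝ) (v : Fin p → E) :
    (E →L[ℝ] E) →ₗ[ℝ] ℝ where
  toFun B := act α B v
  map_add' B C := by rw [map_add]; rfl
  map_smul' c B := by rw [map_smul]; rfl

variable [FiniteDimensional ℝ E]

/-- The vanishing of the torsion of one `p`-form amounts to `n.choose (p + 1)` equations. -/
theorem finrank_closedConnections_ge (b : Module.Basis (Fin n) ℝ E) {p : ℕ}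
    (α : E [⋀^Fin p]→L[ℝ] ℝ) {A : ∀ p, Submodule ℝ (E [⋀^Fin p]→L[ℝ] ℝ)}
    (hA : ∀ δ : E →L[ℝ] E →L[ℝ] E, torsion δ α = 0 → δ ∈ closedConnections A) :
    n * (n * n) ≤ Module.finrank ℝ (closedConnections A) + n.choose (p + 1) := by
  have hE : Module.finrank ℝ E = n := by rw [Module.finrank_eq_card_basis b, Fintype.card_fin]
  have h1 := finrank_le_add_card (κ := {S : Finset (Fin n) // S.card = p + 1})
    (S := closedConnections A) (fun S => torsionFunctional α fun i => b (increasing S i))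
    fun δ hδ => hA δ (eq_zero_of_forall_increasing _ b hδ)
  rw [finrank_clm hE, finrank_clm hE, hE, Fintype.card_finset_len, Fintype.card_fin] at h1
  exact h1

end Monomials

/-! ### Forms with integral coefficients -/

section IntegerForms

/-- A sum over `Fin p`, in a form which is fast to evaluate. -/
def sumFin : (p : ℕ) → (Fin p → ℤ) → ℤ
  | 0, _ => 0
  | p + 1, f => f 0 + sumFin p fun i => f i.succ

theorem sumFin_eq : ∀ (p : ℕ) (f : Fin p → ℤ), sumFin p f = ∑ i, f i
  | 0, _ => rfl
  | p + 1, f => by rw [sumFin, sumFin_eq p, Fin.sum_univ_succ]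

/-- The value of `e^{I₁} ∧ ⋯ ∧ e^{I_p}` on `(e_{J₁}, …, e_{J_p})`, by Laplace expansion. -/
def monomialEval {n : ℕ} : (p : ℕ) → (Fin p → Fin n) → (Fin p → Fin n) → ℤ
  | 0, _, _ => 1
  | p + 1, J, I => sumFin (p + 1) fun i => if (J i : ℕ) = I 0 then
      (-1) ^ (i : ℕ) * monomialEval p (fun k => J (i.succAbove k)) (fun k => I k.succ) else 0

theorem det_eq_monomialEval {n : ℕ} : ∀ (p : ℕ) (J I : Fin p → Fin n),
    (Matrix.of fun a b => if J a = I b then (1 : ℝ) else 0).det = monomialEval p J I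
  | 0, J, I => by simp [monomialEval]
  | p + 1, J, I => by
    rw [Matrix.det_succ_column_zero, monomialEval, sumFin_eq]
    push_cast
    refine Finset.sum_congr rfl fun i _ => ?_
    have h1 := det_eq_monomialEval p (fun k => J (i.succAbove k)) (fun k => I k.succ)
    have h2 : (Matrix.of fun a b => if J a = I b then (1 : ℝ) else 0).submatrix i.succAbove
        Fin.succ = Matrix.of fun a b => if J (i.succAbove a) = I b.succ then (1 : ℝ) else 0 := rfl
    rw [h2, h1]
    by_cases h : J i = I 0
    · simp [h]
    · have h' : (J i : ℕ) ≠ I 0 := fun e => h (Fin.ext e)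
      simp [h, h']

/-- The set of the entries of an injective tuple, as a binary number. -/
def mask {n : ℕ} : (p : ℕ) → (Fin p → Fin n) → ℕ
  | 0, _ => 0
  | p + 1, f => Nat.add (Nat.pow 2 (f 0)) (mask p fun i => f i.succ)

theorem mask_eq {n : ℕ} : ∀ (p : ℕ) (f : Fin p → Fin n), mask p f = ∑ i, 2 ^ (f i : ℕ)
  | 0, _ => rfl
  | p + 1, f => by rw [mask, mask_eq p, Fin.sum_univ_succ]; rfl

theorem monomialEval_eq_zero {n p : ℕ} {J I : Fin p → Fin n} (h : mask p J ≠ mask p I) :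
    monomialEval p J I = 0 := by
  have h1 : (Matrix.of fun a b => if J a = I b then (1 : ℝ) else 0).det = 0 := by
    rw [Matrix.det_apply, Finset.sum_eq_zero]
    intro σ _
    have : ∃ i, J (σ i) ≠ I i := by
      by_contra hall
      push Not at hall
      apply h
      rw [mask_eq, mask_eq, ← Equiv.sum_comp σ]
      exact Finset.sum_congr rfl fun i _ => by rw [hall]
    obtain ⟨i, hi⟩ := this
    rw [Finset.prod_eq_zero (Finset.mem_univ i), smul_zero]
    simp [hi]
  rw [det_eq_monomialEval] at h1
  exact_mod_cast h1

/-- The coefficient at `(e_{J₁}, …, e_{J_p})` of a form with integral coefficients, given as a list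
of monomials. -/
def coeff {n p : ℕ} : List (ℤ × (Fin p → Fin n)) → (Fin p → Fin n) → ℤ
  | [], _ => 0
  | t :: L, J => bif Nat.beq (mask p J) (mask p t.2) then t.1 * monomialEval p J t.2 + coeff L J
      else coeff L J

theorem coeff_eq {n p : ℕ} (L : List (ℤ × (Fin p → Fin n))) (J : Fin p → Fin n) :
    coeff L J = (L.map fun t => t.1 * monomialEval p J t.2).sum := by
  induction L with
  | nil => rfl
  | cons t L ih =>
    rw [coeff, List.map_cons, List.sum_cons, ih]
    rcases h : Nat.beq (mask p J) (mask p t.2) with _ | _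
    · rw [cond_false, monomialEval_eq_zero (Nat.ne_of_beq_eq_false h), mul_zero, zero_add]
    · rw [cond_true]

/-- The form with integral coefficients given by a list of monomials. -/
noncomputable def formOf {n p : ℕ} (L : List (ℤ × (Fin p → Fin n))) : Euc n [⋀^Fin p]→L[ℝ] ℝ :=
  (L.map fun t => (t.1 : ℝ) • coordForm t.2).sum

/-- The standard basis of `ℝⁿ`. -/
noncomputable def stdBasis (n : ℕ) : Module.Basis (Fin n) ℝ (Euc n) :=
  (EuclideanSpace.basisFun (Fin n) ℝ).toBasis

theorem stdBasis_apply {n : ℕ} (i j : Fin n) : stdBasis n i j = if i = j then 1 else 0 := by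
  simp [stdBasis, eq_comm]

theorem coordForm_stdBasis {n p : ℕ} (I J : Fin p → Fin n) :
    coordForm I (fun i => stdBasis n (J i)) = monomialEval p J I := by
  rw [coordForm_apply, ← det_eq_monomialEval]
  simp only [stdBasis_apply]

theorem formOf_stdBasis {n p : ℕ} (L : List (ℤ × (Fin p → Fin n))) (J : Fin p → Fin n) :
    formOf L (fun i => stdBasis n (J i)) = coeff L J := by
  rw [coeff_eq, formOf]
  induction L with
  | nil => simp
  | cons t L ih =>
    rw [List.map_cons, List.sum_cons, List.map_cons, List.sum_cons,
      ContinuousAlternatingMap.add_apply, ih, ContinuousAlternatingMap.smul_apply,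
      coordForm_stdBasis]
    push_cast
    rfl

/-- The coefficient at `(e_{J₁}, …, e_{J_p})` of the derivative of a form under the endomorphism
`∑ m e_c ⊗ e^d`, the sum over the entries `(m, c, d)` of a list. -/
def actCoeff {n p : ℕ} (L : List (ℤ × (Fin p → Fin n))) (C : List (ℤ × Fin n × Fin n))
    (J : Fin p → Fin n) : ℤ :=
  (C.map fun t => t.1 * sumFin p fun i =>
    if (J i : ℕ) = t.2.2 then coeff L (Function.update J i t.2.1) else 0).sum

/-- The smallest `j` such that all entries of the tuple are less than `j`. -/
def level {n : ℕ} : (p : ℕ) → (Fin p → Fin n) → ℕ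
  | 0, _ => 0
  | p + 1, f => max (f 0 + 1) (level p fun i => f i.succ)

theorem lt_level {n : ℕ} : ∀ (p : ℕ) (f : Fin p → Fin n) (i : Fin p), (f i : ℕ) < level p f
  | p + 1, f, i => by
    rw [level]
    refine Fin.cases ?_ (fun i => ?_) i
    · exact lt_of_lt_of_le (Nat.lt_succ_self _) (le_max_left _ _)
    · exact lt_of_lt_of_le (lt_level p (fun i => f i.succ) i) (le_max_right _ _)

end IntegerForms

section Certificates

variable {n : ℕ} {E : Type*} [NormedAddCommGroup E] [NormedSpace ℝ E] [FiniteDimensional ℝ E]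
  (b : Module.Basis (Fin n) ℝ E)

/-- The endomorphism `∑ m b_c ⊗ b^d`, the sum over the entries `(m, c, d)` of a list. -/
noncomputable def endoOf (C : List (ℤ × Fin n × Fin n)) : E →L[ℝ] E :=
  (C.map fun t => (t.1 : ℝ) • (coordCLM b t.2.2).smulRight (b t.2.1)).sum

theorem act_endoOf {p : ℕ} {α : E [⋀^Fin p]→L[ℝ] ℝ} {s : ℝ} {L : List (ℤ × (Fin p → Fin n))}
    (hα : ∀ J : Fin p → Fin n, α (fun i => b (J i)) = s * coeff L J)
    (C : List (ℤ × Fin n × Fin n)) (J : Fin p → Fin n) :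
    act α (endoOf b C) (fun i => b (J i)) = s * actCoeff L C J := by
  have h1 : ∀ c d, act α ((coordCLM b d).smulRight (b c)) (fun i => b (J i)) =
      s * (sumFin p fun i => if (J i : ℕ) = d then coeff L (Function.update J i c) else 0 : ℤ) := by
    intro c d
    rw [act_apply, sumFin_eq]
    push_cast
    rw [Finset.mul_sum]
    refine Finset.sum_congr rfl fun i _ => ?_
    have h2 : (coordCLM b d).smulRight (b c) (b (J i)) = if (J i : ℕ) = d then b c else 0 := by
      rw [ContinuousLinearMap.smulRight_apply, coordCLM_apply, b.repr_self, Finsupp.single_apply]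
      by_cases h : J i = d
      · simp [h]
      · have h' : (J i : ℕ) ≠ d := fun e => h (Fin.ext e)
        simp [h, h']
    rw [h2]
    split_ifs with h
    · rw [← hα]
      congr 1
      funext l
      rcases eq_or_ne l i with rfl | hl
      · simp
      · simp [hl]
    · simp only [mul_zero]
      exact α.toMultilinearMap.map_update_zero _ i
  unfold endoOf actCoeff
  induction C with
  | nil => simp
  | cons t C ih =>
    rw [List.map_cons, List.sum_cons, List.map_cons, List.sum_cons, map_add,
      ContinuousAlternatingMap.add_apply, ih, map_smul, ContinuousAlternatingMap.smul_apply, h1]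
    push_cast
    simp only [smul_eq_mul]
    ring

/-- Cartan's test for a system given by one form `α` with integral coefficients: the entries `(J, T)`
of the list `C` show that the components `J` of `B ↦ B · α` are independent, as the endomorphisms
`T` form a dual family up to the factor `N`. -/
theorem isRegularFlag_of_certificate {p : ℕ} {α : E [⋀^Fin p]→L[ℝ] ℝ}
    {A : ∀ p, Submodule ℝ (E [⋀^Fin p]→L[ℝ] ℝ)} (hαA : α ∈ A p)
    (hA : ∀ δ : E →L[ℝ] E →L[ℝ] E, torsion δ α = 0 → δ ∈ closedConnections A)
    {s : ℝ} (hs : s ≠ 0) {L : List (ℤ × (Fin p → Fin n))}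
    (hα : ∀ J : Fin p → Fin n, α (fun i => b (J i)) = s * coeff L J)
    (C : List ((Fin p → Fin n) × List (ℤ × Fin n × Fin n))) {N : ℤ} (hN : N ≠ 0)
    (hC : ∀ i k : Fin C.length,
      actCoeff L (C.get k).2 (C.get i).1 = if i = k then N else 0)
    (hcount : n.choose (p + 1) ≤ ∑ i : Fin C.length, (n - level p (C.get i).1)) :
    IsRegularFlag A b := by
  have hE : Module.finrank ℝ E = n := by rw [Module.finrank_eq_card_basis b, Fintype.card_fin]
  refine isRegularFlag_of_functionals hE b.linearIndependent (ι := Fin C.length)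
    (F := fun i => actFunctional α fun l => b ((C.get i).1 l))
    (B := fun k => endoOf b (C.get k).2) (N := s * N)
    (mul_ne_zero hs (by exact_mod_cast hN)) (fun i k => ?_) (fun i => level p (C.get i).1)
    (fun i T hT => hT p α hαA _ fun l => mem_flag b _ (lt_level p _ l)) ?_
  · change act α (endoOf b (C.get k).2) (fun l => b ((C.get i).1 l)) = _
    rw [act_endoOf b hα, hC]
    split_ifs <;> simp
  · have := finrank_closedConnections_ge b α hA
    omega

end Certificates

/-! ### The forms `ρ` and `*ρ` -/

section LineSpan

theorem torsion_eq_zero_of_mem_lineSpan {n p : ℕ} {α : Euc n [⋀^Fin p]→L[ℝ] ℝ}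
    {δ : Euc n →L[ℝ] Euc n →L[ℝ] Euc n} (h : torsion δ α = 0) {q : ℕ}
    {β : Euc n [⋀^Fin q]→L[ℝ] ℝ} (hβ : β ∈ lineSpan α q) : torsion δ β = 0 := by
  have h1 : lineSpan α q ≤ LinearMap.ker (torsionLin q δ) := by
    refine Submodule.span_le.2 fun β hβ => ?_
    have hβ' : (⟨q, β⟩ : Σ m, Euc n [⋀^Fin m]→L[ℝ] ℝ) = ⟨p, α⟩ := hβ
    obtain rfl := congrArg Sigma.fst hβ'
    obtain rfl := eq_of_heq (Sigma.mk.inj hβ').2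
    exact h
  exact h1 hβ

theorem mem_lineSpan_self {n p : ℕ} (α : Euc n [⋀^Fin p]→L[ℝ] ℝ) : α ∈ lineSpan α p :=
  Submodule.subset_span rfl

/-- Cartan's test for the line spanned by a form, by a certificate. -/
theorem isRegularFlag_lineSpan {n p : ℕ} (b : Module.Basis (Fin n) ℝ (Euc n))
    {α : Euc n [⋀^Fin p]→L[ℝ] ℝ}
    {s : ℝ} (hs : s ≠ 0) {L : List (ℤ × (Fin p → Fin n))}
    (hα : ∀ J : Fin p → Fin n, α (fun i => b (J i)) = s * coeff L J)
    (C : List ((Fin p → Fin n) × List (ℤ × Fin n × Fin n))) {N : ℤ} (hN : N ≠ 0)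
    (hC : ∀ i k : Fin C.length,
      actCoeff L (C.get k).2 (C.get i).1 = if i = k then N else 0)
    (hcount : n.choose (p + 1) ≤ ∑ i : Fin C.length, (n - level p (C.get i).1)) :
    IsRegularFlag (lineSpan α) b :=
  isRegularFlag_of_certificate b (mem_lineSpan_self α)
    (fun _ hδ _ _ hβ => torsion_eq_zero_of_mem_lineSpan hδ hβ) hs hα C hN hC hcount

/-- The basis `w_i e_i`. -/
noncomputable def scaledBasis {n : ℕ} {w : Fin n → ℝ} (hw : ∀ i, IsUnit (w i)) :
    Module.Basis (Fin n) ℝ (Euc n) := (stdBasis n).isUnitSMul hw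

theorem coordForm_scaledBasis {n p : ℕ} {w : Fin n → ℝ} (hw : ∀ i, IsUnit (w i))
    (I J : Fin p → Fin n) : coordForm I (fun i => scaledBasis hw (J i)) =
      (∏ k, w (I k)) * monomialEval p J I := by
  rw [coordForm_apply, ← det_eq_monomialEval, ← Matrix.det_mul_row]
  congr 1
  ext a c
  simp only [scaledBasis, Module.Basis.isUnitSMul_apply, Matrix.of_apply, PiLp.smul_apply,
    stdBasis_apply, smul_eq_mul]
  split_ifs with h
  · rw [h]
  · simp

end LineSpan

section HodgeStar

theorem hodgeStar_add {p q : ℕ} (α β : Euc (p + q) [⋀^Fin p]→L[ℝ] ℝ) :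
    hodgeStar (α + β) = hodgeStar α + hodgeStar β := by
  simp only [hodgeStar, ContinuousAlternatingMap.add_apply, add_smul, smul_add,
    Finset.sum_add_distrib]

theorem hodgeStar_smul {p q : ℕ} (c : ℝ) (α : Euc (p + q) [⋀^Fin p]→L[ℝ] ℝ) :
    hodgeStar (c • α) = c • hodgeStar α := by
  simp only [hodgeStar, ContinuousAlternatingMap.smul_apply, Finset.smul_sum, smul_eq_mul]
  refine Finset.sum_congr rfl fun σ _ => ?_
  simp only [smul_smul]
  congr 1
  ring

theorem coordForm_comp_perm {n p : ℕ} (I : Fin p → Fin n) (σ : Equiv.Perm (Fin p)) :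
    coordForm (fun i => I (σ i)) = ((Equiv.Perm.sign σ : ℤ) : ℝ) • coordForm I := by
  ext v
  rw [ContinuousAlternatingMap.smul_apply, coordForm_apply, coordForm_apply, smul_eq_mul,
    ← Matrix.det_permute']
  rfl

theorem coordForm_perm_apply {n p : ℕ} (I : Fin p → Fin n) (hI : Function.Injective I)
    (σ : Equiv.Perm (Fin p)) :
    coordForm I (fun i => EuclideanSpace.single (I (σ i)) (1 : ℝ)) =
      ((Equiv.Perm.sign σ : ℤ) : ℝ) := by
  rw [coordForm_apply, ← Matrix.det_permutation]
  congr 1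
  ext a c
  simp [Equiv.Perm.permMatrix, PEquiv.toMatrix_apply, hI.eq_iff, eq_comm]

/-- The Hodge star of a monomial, up to a positive constant which depends only on the degree. -/
theorem exists_hodgeStar_coordForm (p q : ℕ) : ∃ c : ℝ, c ≠ 0 ∧
    ∀ T : Fin (p + q) → Fin (p + q), Function.Injective T →
      hodgeStar (coordForm fun i => T (Fin.castAdd q i)) =
        (c * monomialEval (p + q) T id) • coordForm fun j => T (Fin.natAdd p j) := by
  classical
  let K : Finset (Equiv.Perm (Fin (p + q))) := Finset.univ.filter fun σ =>
    ∀ (i : Fin p) (j : Fin q), σ (Fin.castAdd q i) ≠ Fin.natAdd p j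
  have hK : K.card ≠ 0 := by
    refine Finset.card_ne_zero_of_mem (a := 1) ?_
    simp only [K, Finset.mem_filter, Finset.mem_univ, true_and, Equiv.Perm.one_apply]
    intro i j e
    have := congrArg Fin.val e
    simp at this
    omega
  refine ⟨((p ! * q ! : ℕ) : ℝ)⁻¹ * K.card, mul_ne_zero (by positivity) (by exact_mod_cast hK),
    fun T hT => ?_⟩
  let τ : Equiv.Perm (Fin (p + q)) := Equiv.ofBijective T (Finite.injective_iff_bijective.1 hT)
  have hτ : ((Equiv.Perm.sign τ : ℤ) : ℝ) = monomialEval (p + q) T id := by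
    rw [← det_eq_monomialEval, ← Matrix.det_permutation]
    congr 1
    ext a c
    simp [Equiv.Perm.permMatrix, PEquiv.toMatrix_apply, τ]
  rw [← hτ, hodgeStar, mul_assoc, mul_smul]
  congr 1
  rw [← Equiv.sum_comp (Equiv.mulLeft τ), mul_smul, Nat.cast_smul_eq_nsmul, ← Finset.sum_const,
    Finset.sum_filter]
  refine Finset.sum_congr rfl fun σ _ => ?_
  have hmul : ∀ i, (Equiv.mulLeft τ σ) i = T (σ i) := fun i => rfl
  simp only [hmul]
  split_ifs with hσ
  · obtain ⟨σ₁, σ₂, h1, h2, h3⟩ := exists_perm_blocks σ hσ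
    simp only [h1, h2]
    rw [coordForm_perm_apply (fun i => T (Fin.castAdd q i))
      (hT.comp (Fin.castAdd_injective p q)) σ₁, coordForm_comp_perm
      (fun i => T (Fin.natAdd p i)) σ₂, smul_smul, smul_smul]
    congr 1
    rw [Equiv.coe_mulLeft, Equiv.Perm.sign_mul, h3]
    rcases Int.units_eq_one_or (Equiv.Perm.sign σ₁) with h6 | h6 <;>
    rcases Int.units_eq_one_or (Equiv.Perm.sign σ₂) with h7 | h7 <;> simp [h6, h7]
  · push Not at hσ
    obtain ⟨i, j, hij⟩ := hσ
    have : coordForm (fun i => T (Fin.castAdd q i))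
        (fun i => EuclideanSpace.single (T (σ (Fin.castAdd q i))) (1 : ℝ)) = 0 := by
      rw [coordForm_apply]
      refine Matrix.det_eq_zero_of_row_eq_zero i fun k => ?_
      rw [Matrix.of_apply, hij]
      simp only [PiLp.single_apply, ite_eq_right_iff, one_ne_zero, imp_false]
      intro e
      have := congrArg Fin.val (hT e)
      simp at this
      omega
    rw [this, zero_smul, smul_zero]

end HodgeStar

section PSU3

/-- The coefficients of `2ρ` in the basis `e_1, …, e_7, e_8 / √3`. -/
def rhoCoeffs : List (ℤ × (Fin 3 → Fin 8)) :=
    [(2, ![0, 1, 2]), (1, ![0, 3, 6]), (-1, ![0, 4, 5]), (1, ![1, 3, 5]), (1, ![1, 4, 6]), (1,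
    ![2, 3, 4]), (-1, ![2, 5, 6]), (1, ![7, 3, 4]), (1, ![7, 5, 6])]

/-- Endomorphisms dual to the components of `B ↦ B · ρ` on `⟨e_1, …, e_7⟩`, up to a factor. -/
def rhoCertificate : List ((Fin 3 → Fin 8) × List (ℤ × Fin 8 × Fin 8)) :=
    [(![0, 1, 2], [(1, 0, 0), (1, 1, 1), (1, 2, 2), (-1, 5, 5), (-1, 6, 6), (-1, 7, 2)]), (![0,
    1, 3], [(3, 2, 3), (3, 7, 3)]), (![0, 1, 4], [(3, 2, 4), (3, 7, 4)]), (![0, 1, 5], [(3, 2,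
    5), (-3, 7, 5)]), (![0, 1, 6], [(3, 2, 6), (-3, 7, 6)]), (![0, 2, 3], [(-3, 1, 3), (3, 7,
    6)]), (![0, 2, 4], [(-3, 1, 4), (-3, 7, 5)]), (![0, 2, 5], [(-3, 1, 5), (-3, 7, 4)]), (![0,
    2, 6], [(-3, 1, 6), (3, 7, 3)]), (![0, 3, 4], [(3, 2, 0), (3, 7, 0)]), (![0, 3, 5], [(3, 1,
    0), (-3, 3, 4), (3, 6, 5)]), (![0, 3, 6], [(2, 0, 0), (-1, 1, 1), (-1, 2, 2), (-3, 4, 4), (1,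
    5, 5), (4, 6, 6), (4, 7, 2)]), (![0, 4, 5], [(-2, 0, 0), (1, 1, 1), (1, 2, 2), (-3, 4, 4),
    (-1, 5, 5), (2, 6, 6), (2, 7, 2)]), (![0, 4, 6], [(3, 1, 0), (3, 3, 4), (-3, 6, 5)]), (![0,
    5, 6], [(-3, 2, 0), (3, 7, 0)]), (![1, 2, 3], [(3, 0, 3), (3, 7, 5)]), (![1, 2, 4], [(3, 0,
    4), (3, 7, 6)]), (![1, 2, 5], [(3, 0, 5), (3, 7, 3)]), (![1, 2, 6], [(3, 0, 6), (3, 7, 4)]),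
    (![1, 3, 4], [(3, 2, 1), (3, 7, 1)]), (![1, 3, 5], [(-1, 0, 0), (2, 1, 1), (-1, 2, 2), (-3,
    4, 4), (4, 5, 5), (1, 6, 6), (4, 7, 2)]), (![1, 3, 6], [(3, 0, 1), (3, 4, 3), (3, 6, 5)]),
    (![1, 4, 5], [(-3, 1, 0), (3, 3, 4), (3, 6, 5)]), (![1, 4, 6], [(-1, 0, 0), (2, 1, 1), (-1,
    2, 2), (3, 4, 4), (-2, 5, 5), (1, 6, 6), (-2, 7, 2)]), (![1, 5, 6], [(-3, 2, 1), (3, 7, 1)]),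
    (![2, 3, 4], [(-1, 0, 0), (-1, 1, 1), (2, 2, 2), (1, 5, 5), (1, 6, 6), (4, 7, 2)]), (![2, 3,
    5], [(3, 1, 2), (3, 3, 6), (3, 4, 5)]), (![2, 3, 6], [(3, 0, 2), (-3, 3, 5), (3, 4, 6)]),
    (![2, 4, 5], [(-3, 0, 2), (-3, 3, 5), (3, 4, 6)]), (![2, 4, 6], [(3, 1, 2), (-3, 3, 6), (-3,
    4, 5)]), (![2, 5, 6], [(1, 0, 0), (1, 1, 1), (-2, 2, 2), (-1, 5, 5), (-1, 6, 6), (2, 7, 2)]),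
    (![3, 4, 5], [(6, 7, 5)]), (![3, 4, 6], [(6, 7, 6)]), (![3, 5, 6], [(6, 7, 3)]), (![4, 5, 6],
    [(6, 7, 4)])]

/-- The coefficients of `*ρ` in the basis `e_1, …, e_7, e_8 / √3`, up to a factor. -/
def starRhoCoeffs : List (ℤ × (Fin 5 → Fin 8)) :=
    [(2, ![3, 4, 5, 6, 7]), (1, ![1, 2, 4, 5, 7]), (-1, ![1, 2, 3, 6, 7]), (1, ![0, 2, 4, 6, 7]),
    (1, ![0, 2, 3, 5, 7]), (1, ![0, 1, 5, 6, 7]), (-1, ![0, 1, 3, 4, 7]), (3, ![1, 0, 2, 5, 6]),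
    (3, ![1, 0, 2, 3, 4])]

/-- Endomorphisms dual to the components of `B ↦ B · *ρ` on `⟨e_1, …, e_7⟩`, up to a factor. -/
def starRhoCertificate : List ((Fin 5 → Fin 8) × List (ℤ × Fin 8 × Fin 8)) :=
    [(![0, 1, 2, 3, 4], [(-2, 4, 4)]), (![0, 1, 2, 3, 5], [(-2, 4, 5)]), (![0, 1, 2, 3, 6], [(-2,
    4, 6)]), (![0, 1, 2, 4, 5], [(2, 3, 5)]), (![0, 1, 2, 4, 6], [(-2, 5, 4)]), (![0, 1, 2, 5,
    6], [(-2, 6, 6)]), (![0, 1, 3, 4, 5], [(-2, 2, 5)]), (![0, 1, 3, 4, 6], [(-2, 2, 6)]), (![0,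
    1, 3, 5, 6], [(-2, 2, 3)]), (![0, 1, 4, 5, 6], [(-2, 2, 4)]), (![0, 2, 3, 4, 5], [(2, 1,
    5)]), (![0, 2, 3, 4, 6], [(2, 1, 6)]), (![0, 2, 3, 5, 6], [(2, 1, 3)]), (![0, 2, 4, 5, 6],
    [(2, 1, 4)]), (![0, 3, 4, 5, 6], [(-1, 3, 5), (-1, 4, 6), (3, 7, 0)]), (![1, 2, 3, 4, 5],
    [(-2, 0, 5)]), (![1, 2, 3, 4, 6], [(-2, 0, 6)]), (![1, 2, 3, 5, 6], [(-2, 0, 3)]), (![1, 2,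
    4, 5, 6], [(-2, 0, 4)]), (![1, 3, 4, 5, 6], [(-1, 4, 5), (-1, 5, 4), (3, 7, 1)]), (![2, 3, 4,
    5, 6], [(-1, 4, 4), (1, 6, 6), (3, 7, 2)])]

/-- The scaling which removes the factor `√3` from `ρ`. -/
noncomputable def rhoScale (i : Fin 8) : ℝ := if i = 7 then (√3)⁻¹ else 1

theorem isUnit_rhoScale (i : Fin 8) : IsUnit (rhoScale i) := by
  unfold rhoScale
  split_ifs
  · simp
  · simp

theorem rho_scaledBasis (J : Fin 3 → Fin 8) :
    rho (fun i => scaledBasis isUnit_rhoScale (J i)) = (1 / 2) * coeff rhoCoeffs J := by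
  have h3 : (√3 : ℝ) ≠ 0 := by positivity
  simp only [rho, ContinuousAlternatingMap.add_apply, ContinuousAlternatingMap.sub_apply,
    ContinuousAlternatingMap.smul_apply, coordForm_scaledBasis, coeff_eq, rhoCoeffs,
    Fin.prod_univ_three, smul_eq_mul]
  simp [rhoScale]
  field_simp
  ring

theorem isRegularFlag_rho : IsRegularFlag (lineSpan rho) (scaledBasis isUnit_rhoScale) :=
  isRegularFlag_lineSpan _ (by norm_num) rho_scaledBasis rhoCertificate (N := 6) (by decide)
    (by decide +kernel) (by decide +kernel)

/-- The Hodge star `Λ³ℝ⁸ → Λ⁵ℝ⁸` as a linear map. -/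
noncomputable def hodgeStarThree :
    (Euc 8 [⋀^Fin 3]→L[ℝ] ℝ) →ₗ[ℝ] (Euc 8 [⋀^Fin 5]→L[ℝ] ℝ) where
  toFun α := hodgeStar (p := 3) (q := 5) α
  map_add' α β := hodgeStar_add (p := 3) (q := 5) α β
  map_smul' c α := hodgeStar_smul (p := 3) (q := 5) c α

theorem hodgeStarThree_apply (α : Euc 8 [⋀^Fin 3]→L[ℝ] ℝ) :
    hodgeStarThree α = hodgeStar (p := 3) (q := 5) α := rfl

theorem starRho_scaledBasis : ∃ s : ℝ, s ≠ 0 ∧ ∀ J : Fin 5 → Fin 8,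
    starRho (fun i => scaledBasis isUnit_rhoScale (J i)) = s * coeff starRhoCoeffs J := by
  obtain ⟨c, hc, hT⟩ := exists_hodgeStar_coordForm 3 5
  have h3 : (√3 : ℝ) ≠ 0 := by positivity
  have key : ∀ T : Fin 8 → Fin 8, Function.Injective T → monomialEval 8 T id = 1 →
      hodgeStar (p := 3) (q := 5) (coordForm ![T 0, T 1, T 2]) =
        c • coordForm ![T 3, T 4, T 5, T 6, T 7] := by
    intro T hTi hT1
    have h1 := hT T hTi
    rw [hT1, Int.cast_one, mul_one] at h1
    have e1 : ![T 0, T 1, T 2] = fun i : Fin 3 => T (Fin.castAdd 5 i) := by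
      funext i
      fin_cases i <;> rfl
    have e2 : ![T 3, T 4, T 5, T 6, T 7] = fun i : Fin 5 => T (Fin.natAdd 3 i) := by
      funext i
      fin_cases i <;> rfl
    rw [e1, e2]
    exact h1
  refine ⟨c * (2 * √3)⁻¹, mul_ne_zero hc (by positivity), fun J => ?_⟩
  have k0 :=
    (hodgeStarThree_apply _).trans (key ![0, 1, 2, 3, 4, 5, 6, 7] (by decide) (by decide +kernel))
  have k1 :=
    (hodgeStarThree_apply _).trans (key ![0, 3, 6, 1, 2, 4, 5, 7] (by decide) (by decide +kernel))
  have k2 :=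
    (hodgeStarThree_apply _).trans (key ![0, 4, 5, 1, 2, 3, 6, 7] (by decide) (by decide +kernel))
  have k3 :=
    (hodgeStarThree_apply _).trans (key ![1, 3, 5, 0, 2, 4, 6, 7] (by decide) (by decide +kernel))
  have k4 :=
    (hodgeStarThree_apply _).trans (key ![1, 4, 6, 0, 2, 3, 5, 7] (by decide) (by decide +kernel))
  have k5 :=
    (hodgeStarThree_apply _).trans (key ![2, 3, 4, 0, 1, 5, 6, 7] (by decide) (by decide +kernel))
  have k6 :=
    (hodgeStarThree_apply _).trans (key ![2, 5, 6, 0, 1, 3, 4, 7] (by decide) (by decide +kernel))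
  have k7 :=
    (hodgeStarThree_apply _).trans (key ![7, 3, 4, 1, 0, 2, 5, 6] (by decide) (by decide +kernel))
  have k8 :=
    (hodgeStarThree_apply _).trans (key ![7, 5, 6, 1, 0, 2, 3, 4] (by decide) (by decide +kernel))
  simp only [Matrix.cons_val] at k0 k1 k2 k3 k4 k5 k6 k7 k8
  change hodgeStarThree rho _ = _
  rw [rho]
  simp only [map_add, map_sub, map_smul, k0, k1, k2, k3, k4, k5, k6, k7, k8]
  simp only [ContinuousAlternatingMap.sub_apply, ContinuousAlternatingMap.add_apply,
    ContinuousAlternatingMap.smul_apply, coordForm_scaledBasis, coeff_eq, starRhoCoeffs,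
    Fin.prod_univ_five, smul_eq_mul]
  simp [rhoScale]
  field_simp
  rw [Real.sq_sqrt (by norm_num)]
  ring

theorem isRegularFlag_starRho :
    IsRegularFlag (lineSpan starRho) (scaledBasis isUnit_rhoScale) := by
  obtain ⟨s, hs, h⟩ := starRho_scaledBasis
  exact isRegularFlag_lineSpan _ hs h starRhoCertificate (N := 6) (by decide)
    (by decide +kernel) (by decide +kernel)

end PSU3


/-! ### Invariant forms and signed permutations -/

section SignedPermutations

variable {n p : ℕ}

/-- Whether a Boolean predicate holds on all increasing tuples with entries `≥ lo`. -/
def allIncreasing (n : ℕ) : (p : ℕ) → ℕ → ((Fin p → Fin n) → Bool) → Bool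
  | 0, _, P => P fun i => i.elim0
  | p + 1, lo, P => (List.finRange n).all fun a => bif Nat.ble lo a then
      allIncreasing n p (a + 1) fun J => P (Fin.cons a J) else true

theorem of_allIncreasing : ∀ {p : ℕ} {lo : ℕ} {P : (Fin p → Fin n) → Bool}
    (_ : allIncreasing n p lo P = true) (J : Fin p → Fin n) (_ : StrictMono J)
    (_ : ∀ i, lo ≤ J i), P J = true
  | 0, lo, P, h, J, _, _ => by
    have : J = fun i => i.elim0 := Subsingleton.elim _ _
    rw [this]
    exact h
  | p + 1, lo, P, h, J, hJ, hlo => by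
    rw [allIncreasing, List.all_eq_true] at h
    have h1 := h (J 0) (List.mem_finRange _)
    rw [Nat.ble_eq_true_of_le (hlo 0), cond_true] at h1
    have h2 := of_allIncreasing h1 (fun i => J i.succ)
      (fun i k hik => hJ (Fin.succ_lt_succ_iff.2 hik)) fun i => hJ (Fin.succ_pos i)
    have h3 : (Fin.cons (J 0) fun i => J i.succ : Fin (p + 1) → Fin n) = J :=
      Fin.cons_self_tail J
    rwa [h3] at h2

/-- An alternating form vanishes if it does so on all increasing tuples of basis vectors. -/
theorem eq_zero_of_forall_strictMono {E : Type*} [NormedAddCommGroup E] [NormedSpace ℝ E]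
    (β : E [⋀^Fin p]→L[ℝ] ℝ) (b : Module.Basis (Fin n) ℝ E)
    (h : ∀ J : Fin p → Fin n, StrictMono J → β (fun i => b (J i)) = 0) : β = 0 :=
  eq_zero_of_forall_increasing β b fun S => h _ (S.1.orderEmbOfFin S.2).strictMono

theorem eq_zero_of_lt {E : Type*} [NormedAddCommGroup E] [NormedSpace ℝ E] (hn : n < p)
    (β : E [⋀^Fin p]→L[ℝ] ℝ) (b : Module.Basis (Fin n) ℝ E) : β = 0 := by
  refine eq_zero_of_forall_strictMono β b fun J hJ => ?_
  have := Fintype.card_le_of_injective J hJ.injective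
  simp at this
  omega

theorem apply_eq_zero_of_forall_exists {E : Type*} [NormedAddCommGroup E] [NormedSpace ℝ E]
    (β : E [⋀^Fin p]→L[ℝ] ℝ) (b : Fin n → E) {J₀ J : Fin p → Fin n}
    (h0 : β (fun i => b (J₀ i)) = 0) (h : ∀ i, ∃ k, J i = J₀ k) : β (fun i => b (J i)) = 0 := by
  by_cases hJ : Function.Injective J
  · refine apply_eq_zero_of_image_eq β b hJ ?_ h0
    refine (Finset.eq_of_subset_of_card_le (fun x hx => ?_) ?_).symm
    · obtain ⟨i, -, rfl⟩ := Finset.mem_image.1 hx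
      obtain ⟨k, hk⟩ := h i
      rw [hk]
      exact Finset.mem_image_of_mem _ (Finset.mem_univ k)
    · rw [Finset.card_image_of_injective _ hJ]
      exact Finset.card_image_le
  · rw [Function.Injective] at hJ
    push Not at hJ
    obtain ⟨i, k, hik, hne⟩ := hJ
    exact β.map_eq_zero_of_eq _ (congrArg b hik) hne

/-- The signed permutation `e_i ↦ s_i e_{π i}` of the standard basis, `g = (s, π)`. -/
noncomputable def signedPerm (g : (Fin n → ℤ) × (Fin n → Fin n)) : Euc n →L[ℝ] Euc n :=
  ∑ i, (coordCLM (stdBasis n) i).smulRight ((g.1 i : ℝ) • stdBasis n (g.2 i))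

theorem signedPerm_stdBasis (g : (Fin n → ℤ) × (Fin n → Fin n)) (i : Fin n) :
    signedPerm g (stdBasis n i) = (g.1 i : ℝ) • stdBasis n (g.2 i) := by
  rw [signedPerm, sum_apply, Finset.sum_eq_single i]
  · rw [ContinuousLinearMap.smulRight_apply, coordCLM_apply]
    simp
  · intro k _ hk
    rw [ContinuousLinearMap.smulRight_apply, coordCLM_apply]
    simp [hk.symm]
  · simp

/-- The form `β` is invariant under the signed permutation `g`. -/
def IsSignedInvariant (β : Euc n [⋀^Fin p]→L[ℝ] ℝ) (g : (Fin n → ℤ) × (Fin n → Fin n)) : Prop :=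
  ∀ J : Fin p → Fin n, β (fun i => stdBasis n (J i)) =
    (∏ i, (g.1 (J i) : ℝ)) * β fun i => stdBasis n (g.2 (J i))

theorem compContinuousLinearMap_signedPerm (β : Euc n [⋀^Fin p]→L[ℝ] ℝ)
    (g : (Fin n → ℤ) × (Fin n → Fin n)) (J : Fin p → Fin n) :
    β.compContinuousLinearMap (signedPerm g) (fun i => stdBasis n (J i)) =
      (∏ i, (g.1 (J i) : ℝ)) * β fun i => stdBasis n (g.2 (J i)) := by
  rw [ContinuousAlternatingMap.compContinuousLinearMap_apply]
  have : (signedPerm g ∘ fun i => stdBasis n (J i)) =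
      fun i => (g.1 (J i) : ℝ) • stdBasis n (g.2 (J i)) :=
    funext fun i => signedPerm_stdBasis g _
  rw [this]
  exact β.toMultilinearMap.map_smul_univ _ _

theorem isSignedInvariant_iff {β : Euc n [⋀^Fin p]→L[ℝ] ℝ} {g : (Fin n → ℤ) × (Fin n → Fin n)} :
    IsSignedInvariant β g ↔ β.compContinuousLinearMap (signedPerm g) = β := by
  constructor
  · intro h
    rw [← sub_eq_zero]
    refine eq_zero_of_forall_strictMono _ (stdBasis n) fun J _ => ?_
    rw [ContinuousAlternatingMap.sub_apply, compContinuousLinearMap_signedPerm, ← h J, sub_self]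
  · intro h J
    rw [← compContinuousLinearMap_signedPerm, h]

theorem isSignedInvariant_formOf {L : List (ℤ × (Fin p → Fin n))}
    {g : (Fin n → ℤ) × (Fin n → Fin n)}
    (h : allIncreasing n p 0 (fun J => decide (coeff L J =
      (∏ i, g.1 (J i)) * coeff L fun i => g.2 (J i))) = true) :
    IsSignedInvariant (formOf L) g := by
  rw [isSignedInvariant_iff, ← sub_eq_zero]
  refine eq_zero_of_forall_strictMono _ (stdBasis n) fun J hJ => ?_
  have h1 := of_decide_eq_true (of_allIncreasing h J hJ fun _ => Nat.zero_le _)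
  rw [ContinuousAlternatingMap.sub_apply, compContinuousLinearMap_signedPerm, formOf_stdBasis,
    formOf_stdBasis, h1]
  push_cast
  exact sub_self _

theorem IsSignedInvariant.sub {β γ : Euc n [⋀^Fin p]→L[ℝ] ℝ}
    {g : (Fin n → ℤ) × (Fin n → Fin n)} (hβ : IsSignedInvariant β g)
    (hγ : IsSignedInvariant γ g) : IsSignedInvariant (β - γ) g := by
  intro J
  rw [ContinuousAlternatingMap.sub_apply, ContinuousAlternatingMap.sub_apply, hβ J, hγ J, mul_sub]

theorem IsSignedInvariant.smul {β : Euc n [⋀^Fin p]→L[ℝ] ℝ} (c : ℝ)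
    {g : (Fin n → ℤ) × (Fin n → Fin n)} (hβ : IsSignedInvariant β g) :
    IsSignedInvariant (c • β) g := by
  intro J
  rw [ContinuousAlternatingMap.smul_apply, ContinuousAlternatingMap.smul_apply, hβ J,
    smul_eq_mul, smul_eq_mul, mul_left_comm]

/-- The underlying permutation of a product of signed permutations. -/
def wordPerm (gens : List ((Fin n → ℤ) × (Fin n → Fin n))) : List ℕ → Fin n → Fin n
  | [], i => i
  | k :: w, i => wordPerm gens w ((gens.getD k (fun _ => 1, id)).2 i)

theorem apply_eq_zero_of_wordPerm {gens : List ((Fin n → ℤ) × (Fin n → Fin n))}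
    {β : Euc n [⋀^Fin p]→L[ℝ] ℝ} (hβ : ∀ g ∈ gens, IsSignedInvariant β g) :
    ∀ (w : List ℕ) (J : Fin p → Fin n),
      β (fun i => stdBasis n (wordPerm gens w (J i))) = 0 → β (fun i => stdBasis n (J i)) = 0
  | [], _, h => h
  | k :: w, J, h => by
    have h1 : IsSignedInvariant β (gens.getD k (fun _ => 1, id)) := by
      rw [List.getD_eq_getElem?_getD]
      rcases h2 : gens[k]? with _ | g
      · intro J
        simp
      · exact hβ g (List.mem_of_getElem? h2)
    rw [h1, apply_eq_zero_of_wordPerm hβ w _ h, mul_zero]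

/-- Whether the component of an invariant form at the tuple `J` is changed in sign by one of the
signed permutations, or moved by a product of them to a component in a list. -/
def isForcedZero (gens : List ((Fin n → ℤ) × (Fin n → Fin n)))
    (words : List (List ℕ)) (zeros : List (Fin p → Fin n)) (J : Fin p → Fin n) :
    Bool :=
  decide (∃ g ∈ gens, (∀ i, g.2 (J i) = J i) ∧ ∏ i, g.1 (J i) = -1) ||
    decide (∃ w ∈ words, ∃ J₀ ∈ zeros, ∀ i, ∃ k, wordPerm gens w (J i) = J₀ k)

theorem apply_eq_zero_of_isForcedZero {gens : List ((Fin n → ℤ) × (Fin n → Fin n))}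
    {words : List (List ℕ)} {zeros : List (Fin p → Fin n)}
    {β : Euc n [⋀^Fin p]→L[ℝ] ℝ} (hβ : ∀ g ∈ gens, IsSignedInvariant β g)
    (h0 : ∀ J₀ ∈ zeros, β (fun i => stdBasis n (J₀ i)) = 0) {J : Fin p → Fin n}
    (h : isForcedZero gens words zeros J = true) : β (fun i => stdBasis n (J i)) = 0 := by
  rw [isForcedZero, Bool.or_eq_true, decide_eq_true_iff, decide_eq_true_iff] at h
  rcases h with ⟨g, hg, hfix, hs⟩ | ⟨w, -, J₀, hJ₀, hw⟩
  · have h2 := hβ g hg J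
    have h3 : (∏ i, (g.1 (J i) : ℝ)) = -1 := by exact_mod_cast hs
    simp only [hfix] at h2
    rw [h3] at h2
    linarith
  · exact apply_eq_zero_of_wordPerm hβ w J
      (apply_eq_zero_of_forall_exists β (stdBasis n) (h0 J₀ hJ₀) hw)

theorem eq_zero_of_isForcedZero {gens : List ((Fin n → ℤ) × (Fin n → Fin n))}
    (words : List (List ℕ)) (zeros : List (Fin p → Fin n))
    {β : Euc n [⋀^Fin p]→L[ℝ] ℝ} (hβ : ∀ g ∈ gens, IsSignedInvariant β g)
    (h0 : ∀ J₀ ∈ zeros, β (fun i => stdBasis n (J₀ i)) = 0)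
    (h : allIncreasing n p 0 (isForcedZero gens words zeros) = true) : β = 0 :=
  eq_zero_of_forall_strictMono _ (stdBasis n) fun _ hJ =>
    apply_eq_zero_of_isForcedZero hβ h0 (of_allIncreasing h _ hJ fun _ => Nat.zero_le _)

theorem isInvertible_signedPerm {g : (Fin n → ℤ) × (Fin n → Fin n)} (hs : ∀ i, g.1 i * g.1 i = 1)
    (hπ : Function.Injective g.2) : (signedPerm g).IsInvertible := by
  let π : Equiv.Perm (Fin n) := Equiv.ofBijective g.2 (Finite.injective_iff_bijective.1 hπ)
  let h : (Fin n → ℤ) × (Fin n → Fin n) := (fun i => g.1 (π.symm i), π.symm)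
  have hs' : ∀ i, (g.1 i : ℝ) * (g.1 i : ℝ) = 1 := fun i => by exact_mod_cast hs i
  have h1 : ∀ x, signedPerm h (signedPerm g x) = x := by
    intro x
    have : (signedPerm h ∘L signedPerm g : Euc n →ₗ[ℝ] Euc n) = LinearMap.id := by
      refine (stdBasis n).ext fun i => ?_
      change signedPerm h (signedPerm g (stdBasis n i)) = stdBasis n i
      have e : π.symm (g.2 i) = i := π.symm_apply_apply i
      rw [signedPerm_stdBasis, map_smul, signedPerm_stdBasis, smul_smul]
      change ((g.1 i : ℝ) * (g.1 (π.symm (g.2 i)) : ℝ)) • stdBasis n (π.symm (g.2 i)) = _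
      rw [e, hs', one_smul]
    exact LinearMap.congr_fun this x
  have h2 : ∀ x, signedPerm g (signedPerm h x) = x := by
    intro x
    have : (signedPerm g ∘L signedPerm h : Euc n →ₗ[ℝ] Euc n) = LinearMap.id := by
      refine (stdBasis n).ext fun i => ?_
      change signedPerm g (signedPerm h (stdBasis n i)) = stdBasis n i
      have e : g.2 (π.symm i) = i := π.apply_symm_apply i
      rw [signedPerm_stdBasis, map_smul, signedPerm_stdBasis, smul_smul]
      change ((g.1 (π.symm i) : ℝ) * (g.1 (π.symm i) : ℝ)) • stdBasis n (g.2 (π.symm i)) = _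
      rw [e, hs', one_smul]
    exact LinearMap.congr_fun this x
  exact ⟨ContinuousLinearEquiv.equivOfInverse _ _ h1 h2, rfl⟩

/-- A signed permutation with the coefficients of `α` invariant lies in the stabiliser of `α`. -/
theorem signedPerm_mem_stabilizer {α : Euc n [⋀^Fin p]→L[ℝ] ℝ} {L : List (ℤ × (Fin p → Fin n))}
    (hα : α = formOf L) {g : (Fin n → ℤ) × (Fin n → Fin n)} (hs : ∀ i, g.1 i * g.1 i = 1)
    (hπ : Function.Injective g.2)
    (h : allIncreasing n p 0 (fun J => decide (coeff L J =
      (∏ i, g.1 (J i)) * coeff L fun i => g.2 (J i))) = true) :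
    signedPerm g ∈ stabilizer α :=
  ⟨isInvertible_signedPerm hs hπ, hα ▸ isSignedInvariant_iff.1 (isSignedInvariant_formOf h)⟩

theorem isSignedInvariant_of_mem_invariants {G : Set (Euc n →L[ℝ] Euc n)}
    {g : (Fin n → ℤ) × (Fin n → Fin n)} (hg : signedPerm g ∈ G) {β : Euc n [⋀^Fin p]→L[ℝ] ℝ}
    (hβ : β ∈ invariants G p) : IsSignedInvariant β g :=
  isSignedInvariant_iff.2 (hβ _ hg)

theorem torsion_degree_zero (δ : Euc n →L[ℝ] Euc n →L[ℝ] Euc n) (α : Euc n [⋀^Fin 0]→L[ℝ] ℝ) :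
    torsion δ α = 0 := by
  ext v
  rw [torsion_apply]
  simp [act_apply]

/-- A system is closed on a connection as soon as it is in the degrees `1, …, n - 1`. -/
theorem mem_closedConnections_of_degrees {A : GradedSubspace n}
    {δ : Euc n →L[ℝ] Euc n →L[ℝ] Euc n}
    (h : ∀ p, 0 < p → p < n → ∀ α ∈ A p, torsion δ α = 0) : δ ∈ closedConnections A := by
  intro p α hα
  rcases Nat.eq_zero_or_pos p with rfl | hp
  · exact torsion_degree_zero δ α
  · rcases lt_or_ge p n with hn | hn
    · exact h p hp hn α hα
    · exact eq_zero_of_lt (Nat.lt_succ_of_le hn) _ (stdBasis n)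

end SignedPermutations

/-! ### The groups `Spin(7)` and `Sp(2)Sp(1)` -/

theorem formOf_apply {n p : ℕ} (L : List (ℤ × (Fin p → Fin n))) (v : Fin p → Euc n) :
    formOf L v = (L.map fun t => (t.1 : ℝ) * coordForm t.2 v).sum := by
  rw [formOf]
  induction L with
  | nil => rfl
  | cons t L ih =>
    rw [List.map_cons, List.sum_cons, List.map_cons, List.sum_cons,
      ContinuousAlternatingMap.add_apply, ih, ContinuousAlternatingMap.smul_apply, smul_eq_mul]

section SpinSeven

/-- The coefficients of the Cayley form. -/
def cayleyCoeffs : List (ℤ × (Fin 4 → Fin 8)) :=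
    [(1, ![0, 1, 2, 3]), (1, ![0, 1, 4, 5]), (1, ![0, 1, 6, 7]), (1, ![0, 2, 4, 6]), (-1, ![0,
    2, 5, 7]), (-1, ![0, 3, 4, 7]), (-1, ![0, 3, 5, 6]), (-1, ![1, 2, 4, 7]), (-1, ![1, 2, 5,
    6]), (-1, ![1, 3, 4, 6]), (1, ![1, 3, 5, 7]), (1, ![2, 3, 4, 5]), (1, ![2, 3, 6, 7]), (1,
    ![4, 5, 6, 7])]

/-- Endomorphisms dual to the components of `B ↦ B · Φ` on `⟨e_1, …, e_7⟩`, up to a factor, for the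
Cayley form `Φ`. -/
def cayleyCertificate : List ((Fin 4 → Fin 8) × List (ℤ × Fin 8 × Fin 8)) :=
    [(![0, 1, 2, 3], [(1, 0, 0), (1, 1, 1), (1, 2, 2), (1, 3, 3), (-1, 4, 4), (-1, 5, 5), (-1,
    6, 6)]),   (![0, 1, 2, 4], [(-2, 2, 5), (2, 3, 4), (2, 6, 1)]),   (![0, 1, 2, 5], [(2, 0,
    6), (2, 3, 5), (2, 4, 2)]),   (![0, 1, 2, 6], [(-2, 1, 4), (2, 3, 6), (-2, 5, 0)]),   (![0,
    1, 3, 4], [(-2, 2, 4), (-2, 3, 5), (2, 6, 0)]),   (![0, 1, 3, 5], [(-2, 2, 5), (2, 3, 4),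
    (-2, 6, 1)]),   (![0, 1, 3, 6], [(2, 1, 5), (-2, 2, 6), (-2, 4, 0)]),   (![0, 1, 4, 5], [(1,
    0, 0), (1, 1, 1), (-1, 2, 2), (-1, 3, 3), (1, 4, 4), (1, 5, 5), (-1, 6, 6)]),   (![0, 1, 4,
    6], [(2, 2, 1), (2, 3, 0), (2, 6, 5)]),   (![0, 1, 5, 6], [(-2, 1, 3), (2, 2, 0), (-2, 4,
    6)]),   (![0, 2, 3, 4], [(2, 1, 4), (-2, 3, 6), (-2, 5, 0)]),   (![0, 2, 3, 5], [(2, 1, 5),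
    (-2, 2, 6), (2, 4, 0)]),   (![0, 2, 3, 6], [(2, 1, 6), (2, 3, 4), (2, 5, 2)]),   (![0, 2, 4,
    5], [(2, 2, 1), (-2, 3, 0), (2, 6, 5)]),   (![0, 2, 4, 6], [(1, 0, 0), (-1, 1, 1), (1, 2,
    2), (-1, 3, 3), (1, 4, 4), (-1, 5, 5), (1, 6, 6)]),   (![0, 2, 5, 6], [(-2, 1, 0), (-2, 2,
    3), (2, 4, 5)]),   (![0, 3, 4, 5], [(2, 1, 3), (2, 2, 0), (2, 4, 6)]),   (![0, 3, 4, 6],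
    [(-2, 1, 0), (2, 2, 3), (-2, 4, 5)]),   (![0, 3, 5, 6], [(-1, 0, 0), (1, 1, 1), (1, 2, 2),
    (-1, 3, 3), (1, 4, 4), (-1, 5, 5), (-1, 6, 6)]),   (![0, 4, 5, 6], [(-2, 2, 5), (-2, 3, 4),
    (2, 6, 1)]),   (![1, 2, 3, 4], [(-2, 0, 4), (-2, 1, 5), (-2, 6, 2)]),   (![1, 2, 3, 5], [(2,
    4, 1), (-2, 5, 0), (2, 6, 3)]),   (![1, 2, 3, 6], [(-2, 0, 6), (-2, 3, 5), (2, 4, 2)]),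
    (![1, 2, 4, 5], [(-2, 2, 0), (-2, 3, 1), (2, 6, 4)]),   (![1, 2, 4, 6], [(2, 1, 0), (-2, 3,
    2), (-2, 5, 4)]),   (![1, 2, 5, 6], [(1, 0, 0), (-1, 1, 1), (-1, 2, 2), (1, 3, 3), (1, 4,
    4), (-1, 5, 5), (-1, 6, 6)]),   (![1, 3, 4, 5], [(2, 2, 1), (-2, 3, 0), (-2, 6, 5)]),
    (![1, 3, 4, 6], [(1, 0, 0), (-1, 1, 1), (1, 2, 2), (-1, 3, 3), (-1, 4, 4), (1, 5, 5), (-1,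
    6, 6)]),   (![1, 3, 5, 6], [(-2, 1, 0), (-2, 2, 3), (-2, 4, 5)]),   (![1, 4, 5, 6], [(-2, 0,
    6), (2, 3, 5), (-2, 4, 2)]),   (![2, 3, 4, 5], [(-1, 0, 0), (-1, 1, 1), (1, 2, 2), (1, 3,
    3), (1, 4, 4), (1, 5, 5), (-1, 6, 6)]),   (![2, 3, 4, 6], [(-2, 0, 3), (-2, 1, 2), (2, 6,
    5)]),   (![2, 3, 5, 6], [(2, 1, 3), (-2, 2, 0), (-2, 4, 6)]),   (![2, 4, 5, 6], [(2, 1, 4),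
    (2, 3, 6), (2, 5, 0)]),   (![3, 4, 5, 6], [(-2, 1, 5), (-2, 2, 6), (2, 4, 0)])]

/-- Some signed permutations which preserve the Cayley form. -/
def cayleySymmetries : List ((Fin 8 → ℤ) × (Fin 8 → Fin 8)) :=
  [(fun _ => 1, ![0, 2, 4, 6, 3, 1, 7, 5]), (fun _ => 1, ![4, 5, 6, 7, 0, 1, 2, 3]),
    (![-1, -1, -1, -1, 1, 1, 1, 1], id), (![1, 1, 1, 1, -1, -1, -1, -1], id),
    (![1, 1, -1, -1, 1, 1, -1, -1], id), (![1, -1, 1, -1, 1, -1, 1, -1], id)]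

/-- Products of the symmetries which take each monomial of the Cayley form to the first one. -/
def cayleyWords : List (List ℕ) :=
    [[], [0], [1], [0, 0], [0, 1], [0, 0, 0], [1, 0, 0], [0, 0, 0, 0], [1, 0, 0, 0], [0, 0, 0,
    0, 0], [1, 0, 0, 0, 0], [0, 0, 0, 0, 0, 0], [0, 1, 0, 0, 0, 0], [0, 0, 1, 0, 0, 0, 0]]

theorem cayleyForm_eq : cayleyForm = formOf cayleyCoeffs := by
  ext v
  rw [formOf_apply]
  simp only [cayleyForm, cayleyCoeffs, List.map_cons, List.map_nil, List.sum_cons,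
    List.sum_nil, ContinuousAlternatingMap.add_apply, ContinuousAlternatingMap.sub_apply]
  push_cast
  ring

theorem signedPerm_mem_spin7 : ∀ g ∈ cayleySymmetries, signedPerm g ∈ Spin7 := by
  have h : ∀ g ∈ cayleySymmetries, (∀ i, g.1 i * g.1 i = 1) ∧ Function.Injective g.2 ∧
      allIncreasing 8 4 0 (fun J => decide (coeff cayleyCoeffs J =
        (∏ i, g.1 (J i)) * coeff cayleyCoeffs fun i => g.2 (J i))) = true := by
    decide +kernel
  exact fun g hg => signedPerm_mem_stabilizer cayleyForm_eq (h g hg).1 (h g hg).2.1 (h g hg).2.2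

theorem invariants_spin7_eq_bot {p : ℕ} (h0 : 0 < p) (h8 : p < 8) (h4 : p ≠ 4)
    {α : Euc 8 [⋀^Fin p]→L[ℝ] ℝ} (hα : α ∈ invariants Spin7 p) : α = 0 := by
  have hinv : ∀ g ∈ cayleySymmetries, IsSignedInvariant α g := fun g hg =>
    isSignedInvariant_of_mem_invariants (signedPerm_mem_spin7 g hg) hα
  refine eq_zero_of_isForcedZero [] [] hinv (by simp) ?_
  clear hinv hα α
  interval_cases p <;> first | decide +kernel | exact absurd rfl h4

theorem cayleyForm_mem : cayleyForm ∈ invariants Spin7 4 := fun _ hg => hg.2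

/-- The Cayley form spans the invariant `4`-forms of `Spin(7)`. -/
theorem exists_smul_cayleyForm {α : Euc 8 [⋀^Fin 4]→L[ℝ] ℝ} (hα : α ∈ invariants Spin7 4) :
    ∃ t : ℝ, α = t • cayleyForm := by
  refine ⟨α fun i => stdBasis 8 (![0, 1, 2, 3] i), ?_⟩
  rw [← sub_eq_zero]
  refine eq_zero_of_isForcedZero cayleyWords [![0, 1, 2, 3]] (fun g hg =>
    isSignedInvariant_of_mem_invariants (signedPerm_mem_spin7 g hg)
      (Submodule.sub_mem _ hα (Submodule.smul_mem _ _ cayleyForm_mem))) ?_ (by decide +kernel)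
  intro J hJ
  rw [List.mem_singleton.1 hJ, ContinuousAlternatingMap.sub_apply,
    ContinuousAlternatingMap.smul_apply, cayleyForm_eq, formOf_stdBasis]
  have : coeff cayleyCoeffs ![0, 1, 2, 3] = 1 := by decide +kernel
  rw [this]
  simp

theorem isRegularFlag_spin7 : IsRegularFlag (invariants Spin7) (stdBasis 8) := by
  refine isRegularFlag_of_certificate (stdBasis 8) cayleyForm_mem (fun δ hδ => ?_) one_ne_zero
    (L := cayleyCoeffs) (fun J => by rw [cayleyForm_eq, formOf_stdBasis, one_mul])
    cayleyCertificate (N := 4) (by decide) (by decide +kernel) (by decide +kernel)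
  refine mem_closedConnections_of_degrees fun p h0 h8 α hα => ?_
  rcases eq_or_ne p 4 with rfl | h4
  · obtain ⟨t, rfl⟩ := exists_smul_cayleyForm hα
    rw [← torsionLin_apply, map_smul, torsionLin_apply, hδ, smul_zero]
  · rw [invariants_spin7_eq_bot h0 h8 h4 hα, ← torsionLin_apply, map_zero]

end SpinSeven

section QuaternionKaehler

/-- The coefficients of a multiple of the Kraines form, the invariant `4`-form of
`Sp(2)Sp(1)`. -/
def krainesCoeffs : List (ℤ × (Fin 4 → Fin 8)) :=
    [(-3, ![0, 1, 2, 3]), (1, ![0, 1, 4, 5]), (-1, ![0, 1, 6, 7]), (1, ![0, 2, 4, 6]), (1, ![0,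
    2, 5, 7]), (1, ![0, 3, 4, 7]), (-1, ![0, 3, 5, 6]), (-1, ![1, 2, 4, 7]), (1, ![1, 2, 5, 6]),
    (1, ![1, 3, 4, 6]), (1, ![1, 3, 5, 7]), (-1, ![2, 3, 4, 5]), (1, ![2, 3, 6, 7]), (-3, ![4,
    5, 6, 7])]

/-- Endomorphisms dual to the components of `B ↦ B · Ω` on `⟨e_1, …, e_7⟩`, up to a factor, for the
Kraines form `Ω`. -/
def krainesCertificate : List ((Fin 4 → Fin 8) × List (ℤ × Fin 8 × Fin 8)) :=
    [(![0, 1, 2, 3], [(-1, 0, 0), (-1, 1, 1), (-1, 2, 2), (-1, 3, 3), (1, 4, 4), (1, 5, 5), (1,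
    6, 6)]),   (![0, 1, 2, 4], [(2, 2, 5), (-2, 3, 4), (6, 6, 1)]),   (![0, 1, 2, 5], [(2, 0,
    6), (-2, 3, 5), (6, 4, 2)]),   (![0, 1, 2, 6], [(2, 1, 4), (-2, 3, 6), (6, 5, 0)]),   (![0,
    1, 3, 4], [(2, 2, 4), (2, 3, 5), (-6, 6, 0)]),   (![0, 1, 3, 5], [(2, 2, 5), (-2, 3, 4),
    (-6, 6, 1)]),   (![0, 1, 3, 6], [(-2, 1, 5), (2, 2, 6), (6, 4, 0)]),   (![0, 1, 4, 5], [(3,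
    0, 0), (3, 1, 1), (-3, 2, 2), (-3, 3, 3), (3, 4, 4), (3, 5, 5), (-3, 6, 6)]),   (![0, 1, 4,
    6], [(6, 2, 1), (-6, 3, 0), (6, 6, 5)]),   (![0, 1, 5, 6], [(-6, 1, 3), (-6, 2, 0), (-6, 4,
    6)]),   (![0, 2, 3, 4], [(-2, 1, 4), (2, 3, 6), (6, 5, 0)]),   (![0, 2, 3, 5], [(-2, 1, 5),
    (2, 2, 6), (-6, 4, 0)]),   (![0, 2, 3, 6], [(-2, 1, 6), (-2, 3, 4), (6, 5, 2)]),   (![0, 2,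
    4, 5], [(6, 2, 1), (6, 3, 0), (6, 6, 5)]),   (![0, 2, 4, 6], [(3, 0, 0), (-3, 1, 1), (3, 2,
    2), (-3, 3, 3), (3, 4, 4), (-3, 5, 5), (3, 6, 6)]),   (![0, 2, 5, 6], [(6, 1, 0), (-6, 2,
    3), (6, 4, 5)]),   (![0, 3, 4, 5], [(6, 1, 3), (-6, 2, 0), (6, 4, 6)]),   (![0, 3, 4, 6],
    [(6, 1, 0), (6, 2, 3), (-6, 4, 5)]),   (![0, 3, 5, 6], [(-3, 0, 0), (3, 1, 1), (3, 2, 2),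
    (-3, 3, 3), (3, 4, 4), (-3, 5, 5), (-3, 6, 6)]),   (![0, 4, 5, 6], [(-6, 2, 5), (-6, 3, 4),
    (-18, 6, 1)]),   (![1, 2, 3, 4], [(2, 0, 4), (-2, 1, 5), (6, 6, 2)]),   (![1, 2, 3, 5],
    [(-6, 4, 1), (-6, 5, 0), (-6, 6, 3)]),   (![1, 2, 3, 6], [(2, 0, 6), (-2, 3, 5), (-6, 4,
    2)]),   (![1, 2, 4, 5], [(-6, 2, 0), (6, 3, 1), (-6, 6, 4)]),   (![1, 2, 4, 6], [(6, 1, 0),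
    (6, 3, 2), (6, 5, 4)]),   (![1, 2, 5, 6], [(-3, 0, 0), (3, 1, 1), (3, 2, 2), (-3, 3, 3),
    (-3, 4, 4), (3, 5, 5), (3, 6, 6)]),   (![1, 3, 4, 5], [(-6, 2, 1), (-6, 3, 0), (6, 6, 5)]),
    (![1, 3, 4, 6], [(-3, 0, 0), (3, 1, 1), (-3, 2, 2), (3, 3, 3), (3, 4, 4), (-3, 5, 5), (3, 6,
    6)]),   (![1, 3, 5, 6], [(-6, 1, 0), (6, 2, 3), (6, 4, 5)]),   (![1, 4, 5, 6], [(-6, 0, 6),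
    (-6, 3, 5), (-18, 4, 2)]),   (![2, 3, 4, 5], [(3, 0, 0), (3, 1, 1), (-3, 2, 2), (-3, 3, 3),
    (-3, 4, 4), (-3, 5, 5), (3, 6, 6)]),   (![2, 3, 4, 6], [(-6, 0, 3), (6, 1, 2), (-6, 6, 5)]),
    (![2, 3, 5, 6], [(-6, 1, 3), (-6, 2, 0), (6, 4, 6)]),   (![2, 4, 5, 6], [(-6, 1, 4), (-6, 3,
    6), (-18, 5, 0)]),   (![3, 4, 5, 6], [(6, 1, 5), (6, 2, 6), (-18, 4, 0)])]

/-- Some signed permutations in `Sp(2)Sp(1)`: the interchange of the coordinates, `diag(j, 1)`, the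
conjugations by `(1 + i + j + k) / 2`, `i` and `j`, and `± diag(1, -1)`. -/
def krainesSymmetries : List ((Fin 8 → ℤ) × (Fin 8 → Fin 8)) :=
  [(fun _ => 1, ![4, 5, 6, 7, 0, 1, 2, 3]),
    (![1, -1, -1, 1, 1, 1, 1, 1], ![2, 3, 0, 1, 4, 5, 6, 7]),
    (fun _ => 1, ![0, 2, 3, 1, 4, 6, 7, 5]),
    (![-1, -1, -1, -1, 1, 1, 1, 1], id), (![1, 1, 1, 1, -1, -1, -1, -1], id),
    (![1, 1, -1, -1, 1, 1, -1, -1], id), (![1, -1, 1, -1, 1, -1, 1, -1], id)]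

/-- Products of the symmetries which take each monomial of the Kraines form other than `e¹²³⁴` and
`e⁵⁶⁷⁸` to `e¹²⁵⁶`. -/
def krainesWords : List (List ℕ) :=
    [[], [1], [2], [0, 1], [2, 1], [2, 2], [1, 0, 1], [2, 0, 1], [2, 2, 1], [2, 1, 0, 1], [2, 2,
    0, 1], [2, 2, 1, 0, 1]]

theorem signedPerm_apply {n : ℕ} (g : (Fin n → ℤ) × (Fin n → Fin n)) (x : Euc n) (k : Fin n) :
    signedPerm g x k = ∑ i, x i * (g.1 i * if g.2 i = k then 1 else 0) := by
  rw [signedPerm, sum_apply, WithLp.ofLp_sum, Finset.sum_apply]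
  refine Finset.sum_congr rfl fun i _ => ?_
  rw [ContinuousLinearMap.smulRight_apply, coordCLM_apply]
  simp only [PiLp.smul_apply, smul_eq_mul, stdBasis_apply]
  simp [stdBasis]

/-- The quaternion `a + b i + c j + d k`. -/
def quat (a b c d : ℝ) : ℍ[ℝ] := ⟨a, b, c, d⟩

theorem re_quat (a b c d : ℝ) : (quat a b c d).re = a := rfl

theorem imI_quat (a b c d : ℝ) : (quat a b c d).imI = b := rfl

theorem imJ_quat (a b c d : ℝ) : (quat a b c d).imJ = c := rfl

theorem imK_quat (a b c d : ℝ) : (quat a b c d).imK = d := rfl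

theorem quatCoord_zero (x : Euc 8) : quatCoord x 0 = quat (x 0) (x 1) (x 2) (x 3) := rfl

theorem quatCoord_one (x : Euc 8) : quatCoord x 1 = quat (x 4) (x 5) (x 6) (x 7) := rfl

theorem quat_mem_unitary {a b c d : ℝ} (h : a * a + b * b + c * c + d * d = 1) :
    quat a b c d ∈ unitary ℍ[ℝ] := by
  rw [Unitary.mem_iff]
  constructor
  · ext <;> simp only [Quaternion.re_mul, Quaternion.imI_mul, Quaternion.imJ_mul,
      Quaternion.imK_mul, Quaternion.re_star, Quaternion.imI_star, Quaternion.imJ_star,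
      Quaternion.imK_star, re_quat, imI_quat, imJ_quat, imK_quat, Quaternion.re_one,
      Quaternion.imI_one, Quaternion.imJ_one, Quaternion.imK_one] <;> linarith
  · ext <;> simp only [Quaternion.re_mul, Quaternion.imI_mul, Quaternion.imJ_mul,
      Quaternion.imK_mul, Quaternion.re_star, Quaternion.imI_star, Quaternion.imJ_star,
      Quaternion.imK_star, re_quat, imI_quat, imJ_quat, imK_quat, Quaternion.re_one,
      Quaternion.imI_one, Quaternion.imJ_one, Quaternion.imK_one] <;> linarith

theorem mem_unitary_matrix {a b c d : ℍ[ℝ]} (h1 : star a * a + star c * c = 1)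
    (h2 : star a * b + star c * d = 0) (h3 : star b * a + star d * c = 0)
    (h4 : star b * b + star d * d = 1) (h5 : a * star a + b * star b = 1)
    (h6 : a * star c + b * star d = 0) (h7 : c * star a + d * star b = 0)
    (h8 : c * star c + d * star d = 1) :
    (!![a, b; c, d] : Matrix (Fin 2) (Fin 2) ℍ[ℝ]) ∈ unitary (Matrix (Fin 2) (Fin 2) ℍ[ℝ]) := by
  rw [Unitary.mem_iff]
  constructor
  · refine Matrix.ext fun i k => ?_
    fin_cases i <;> fin_cases k <;>
      simp [Matrix.star_eq_conjTranspose, Matrix.mul_apply, h1, h2, h3, h4]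
  · refine Matrix.ext fun i k => ?_
    fin_cases i <;> fin_cases k <;>
      simp [Matrix.star_eq_conjTranspose, Matrix.mul_apply, h5, h6, h7, h8]

/-- A map given by a `2 × 2` quaternionic matrix and a right factor lies in `Sp(2)Sp(1)`. -/
theorem mem_sp2Sp1 {g : Euc 8 →L[ℝ] Euc 8} {a b c d q : ℍ[ℝ]}
    (hA : (!![a, b; c, d] : Matrix (Fin 2) (Fin 2) ℍ[ℝ]) ∈ unitary (Matrix (Fin 2) (Fin 2) ℍ[ℝ]))
    (hq : q ∈ unitary ℍ[ℝ])
    (h0 : ∀ x, quatCoord (g x) 0 = (a * quatCoord x 0 + b * quatCoord x 1) * star q)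
    (h1 : ∀ x, quatCoord (g x) 1 = (c * quatCoord x 0 + d * quatCoord x 1) * star q) :
    g ∈ Sp2Sp1 := by
  refine ⟨_, hA, q, hq, fun x j => ?_⟩
  rw [Fin.sum_univ_two]
  fin_cases j
  · exact h0 x
  · exact h1 x

theorem diag_mem_unitary {a b : ℍ[ℝ]} (ha : a ∈ unitary ℍ[ℝ]) (hb : b ∈ unitary ℍ[ℝ]) :
    (!![a, 0; 0, b] : Matrix (Fin 2) (Fin 2) ℍ[ℝ]) ∈ unitary (Matrix (Fin 2) (Fin 2) ℍ[ℝ]) := by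
  rw [Unitary.mem_iff] at ha hb
  apply mem_unitary_matrix <;> simp [ha, hb]

theorem signedPerm_mem_sp2Sp1 : ∀ g ∈ krainesSymmetries, signedPerm g ∈ Sp2Sp1 := by
  intro g hg
  have hr := quat_mem_unitary (a := 1) (b := 0) (c := 0) (d := 0) (by norm_num)
  have hr' := quat_mem_unitary (a := -1) (b := 0) (c := 0) (d := 0) (by norm_num)
  have hi := quat_mem_unitary (a := 0) (b := 1) (c := 0) (d := 0) (by norm_num)
  have hj := quat_mem_unitary (a := 0) (b := 0) (c := 1) (d := 0) (by norm_num)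
  have hw := quat_mem_unitary (a := 1 / 2) (b := 1 / 2) (c := 1 / 2) (d := 1 / 2) (by norm_num)
  have hanti : (!![0, 1; 1, 0] : Matrix (Fin 2) (Fin 2) ℍ[ℝ]) ∈
      unitary (Matrix (Fin 2) (Fin 2) ℍ[ℝ]) := by
    apply mem_unitary_matrix <;> simp
  simp only [krainesSymmetries, List.mem_cons, List.not_mem_nil, or_false] at hg
  rcases hg with rfl | rfl | rfl | rfl | rfl | rfl | rfl
  on_goal 1 => refine mem_sp2Sp1 hanti hr (fun x => ?_) (fun x => ?_)
  on_goal 3 => refine mem_sp2Sp1 (diag_mem_unitary hj hr) hr (fun x => ?_) (fun x => ?_)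
  on_goal 5 => refine mem_sp2Sp1 (diag_mem_unitary hw hw) hw (fun x => ?_) (fun x => ?_)
  on_goal 7 => refine mem_sp2Sp1 (diag_mem_unitary hr' hr) hr (fun x => ?_) (fun x => ?_)
  on_goal 9 => refine mem_sp2Sp1 (diag_mem_unitary hr hr') hr (fun x => ?_) (fun x => ?_)
  on_goal 11 => refine mem_sp2Sp1 (diag_mem_unitary hi hi) hi (fun x => ?_) (fun x => ?_)
  on_goal 13 => refine mem_sp2Sp1 (diag_mem_unitary hj hj) hj (fun x => ?_) (fun x => ?_)
  all_goals
    simp only [quatCoord_zero, quatCoord_one, signedPerm_apply, Fin.sum_univ_eight]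
    ext <;> simp [re_quat, imI_quat, imJ_quat, imK_quat] <;> ring

/-- The rotation `(x, y) ↦ ((x - y) / √2, (x + y) / √2)` of `ℍ²`. -/
noncomputable def eighthTurn : Euc 8 →L[ℝ] Euc 8 :=
  (√2)⁻¹ • (signedPerm (fun _ => 1, id) +
    signedPerm (![1, 1, 1, 1, -1, -1, -1, -1], ![4, 5, 6, 7, 0, 1, 2, 3]))

theorem eighthTurn_mem : eighthTurn ∈ Sp2Sp1 := by
  have h2 : (√2 : ℝ)⁻¹ * (√2)⁻¹ = 1 / 2 := by
    rw [← mul_inv, Real.mul_self_sqrt (by norm_num)]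
    norm_num
  refine mem_sp2Sp1 (a := quat (√2)⁻¹ 0 0 0) (b := quat (-(√2)⁻¹) 0 0 0) (c := quat (√2)⁻¹ 0 0 0)
    (d := quat (√2)⁻¹ 0 0 0) ?_ (one_mem _) (fun x => ?_) (fun x => ?_)
  · apply mem_unitary_matrix <;> ext <;>
      simp [re_quat, imI_quat, imJ_quat, imK_quat, -mul_eq_zero] <;> linarith
  all_goals
    simp only [quatCoord_zero, quatCoord_one, eighthTurn, smul_apply,
      add_apply, PiLp.smul_apply, PiLp.add_apply, signedPerm_apply, Fin.sum_univ_eight]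
    ext <;> simp [re_quat, imI_quat, imJ_quat, imK_quat] <;> ring

/-- The tuples which occur in the expansion of a form on the images of `e_1, …, e_4` under the
eighth turn. -/
def eighthTurnTuple (T : Finset (Fin 4)) (i : Fin 4) : Fin 8 :=
  T.piecewise ![0, 1, 2, 3] ![4, 5, 6, 7] i

theorem eighthTurn_expansion {γ : Euc 8 [⋀^Fin 4]→L[ℝ] ℝ}
    (hγ : γ.compContinuousLinearMap eighthTurn = γ) :
    4 * γ (fun i => stdBasis 8 (![0, 1, 2, 3] i)) =
      ∑ T : Finset (Fin 4), γ fun i => stdBasis 8 (eighthTurnTuple T i) := by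
  have h1 : (eighthTurn ∘ fun i => stdBasis 8 (![0, 1, 2, 3] i)) = fun i : Fin 4 =>
      (√2)⁻¹ • ((fun k => stdBasis 8 (![0, 1, 2, 3] k)) +
        (fun k => stdBasis 8 (![4, 5, 6, 7] k)) : Fin 4 → Euc 8) i := by
    funext i
    rw [Function.comp_apply, eighthTurn, smul_apply, add_apply,
      signedPerm_stdBasis, signedPerm_stdBasis]
    fin_cases i <;> simp
  have h2 := DFunLike.congr_fun hγ fun i => stdBasis 8 (![0, 1, 2, 3] i)
  rw [ContinuousAlternatingMap.compContinuousLinearMap_apply, h1] at h2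
  have h3 := γ.toMultilinearMap.map_smul_univ (fun _ => (√2)⁻¹)
    ((fun k => stdBasis 8 (![0, 1, 2, 3] k)) + (fun k => stdBasis 8 (![4, 5, 6, 7] k)))
  have h4 := γ.toMultilinearMap.map_add_univ
    (fun k => stdBasis 8 (![0, 1, 2, 3] k)) (fun k => stdBasis 8 (![4, 5, 6, 7] k))
  have h5 : ∏ _i : Fin 4, (√2 : ℝ)⁻¹ = 1 / 4 := by
    rw [Finset.prod_const, Finset.card_univ, Fintype.card_fin, inv_pow,
      show (√2 : ℝ) ^ 4 = (√2 ^ 2) ^ 2 by ring, Real.sq_sqrt (by norm_num)]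
    norm_num
  have h6 : ∀ T : Finset (Fin 4), (T.piecewise (fun k => stdBasis 8 (![0, 1, 2, 3] k))
      (fun k => stdBasis 8 (![4, 5, 6, 7] k)) : Fin 4 → Euc 8) =
      fun i => stdBasis 8 (eighthTurnTuple T i) := by
    intro T
    funext i
    simp only [eighthTurnTuple, Finset.piecewise]
    split_ifs <;> rfl
  rw [h4, h5] at h3
  simp only [h6] at h3
  have h7 := h2.symm.trans h3
  rw [h7, smul_eq_mul, ← mul_assoc]
  norm_num

theorem krainesCoeffs_expansion : 4 * coeff krainesCoeffs ![0, 1, 2, 3] =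
    ∑ T : Finset (Fin 4), coeff krainesCoeffs (eighthTurnTuple T) := by
  decide +kernel

/-- The invariant `4`-forms of `Sp(2)Sp(1)` are multiples of the Kraines form. -/
theorem exists_smul_kraines {α : Euc 8 [⋀^Fin 4]→L[ℝ] ℝ} (hα : α ∈ invariants Sp2Sp1 4) :
    ∃ t : ℝ, α = t • formOf krainesCoeffs := by
  let β := α - (α fun i => stdBasis 8 (![0, 1, 4, 5] i)) • formOf krainesCoeffs
  refine ⟨α fun i => stdBasis 8 (![0, 1, 4, 5] i), ?_⟩
  rw [← sub_eq_zero]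
  change β = 0
  have hinv : ∀ g ∈ krainesSymmetries, IsSignedInvariant β g := by
    have h : ∀ g ∈ krainesSymmetries,
        allIncreasing 8 4 0 (fun J => decide (coeff krainesCoeffs J =
          (∏ i, g.1 (J i)) * coeff krainesCoeffs fun i => g.2 (J i))) = true := by
      decide +kernel
    exact fun g hg => (isSignedInvariant_of_mem_invariants (signedPerm_mem_sp2Sp1 g hg) hα).sub
      ((isSignedInvariant_formOf (h g hg)).smul _)
  have h0 : ∀ J₀ ∈ [![0, 1, 4, 5]], β (fun i => stdBasis 8 (J₀ i)) = 0 := by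
    intro J hJ
    rw [List.mem_singleton.1 hJ]
    change α _ - _ * formOf krainesCoeffs _ = 0
    rw [formOf_stdBasis]
    have : coeff krainesCoeffs ![0, 1, 4, 5] = 1 := by decide +kernel
    rw [this]
    simp
  -- the interchange of the two quaternionic coordinates
  have h1 : β (fun i => stdBasis 8 (![0, 1, 2, 3] i)) =
      β (fun i => stdBasis 8 (![4, 5, 6, 7] i)) := by
    rw [hinv (fun _ => 1, ![4, 5, 6, 7, 0, 1, 2, 3]) (by simp [krainesSymmetries])]
    have : (fun i => stdBasis 8 (![4, 5, 6, 7, 0, 1, 2, 3] (![0, 1, 2, 3] i) : Fin 8)) =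
        fun i : Fin 4 => stdBasis 8 (![4, 5, 6, 7] i) := by
      funext i
      fin_cases i <;> rfl
    simp [this]
  have h2 : 4 * β (fun i => stdBasis 8 (![0, 1, 2, 3] i)) =
      ∑ T : Finset (Fin 4), β fun i => stdBasis 8 (eighthTurnTuple T i) := by
    have h3 := eighthTurn_expansion (hα _ eighthTurn_mem)
    have h4 : (4 : ℝ) * formOf krainesCoeffs (fun i => stdBasis 8 (![0, 1, 2, 3] i)) =
        ∑ T : Finset (Fin 4), formOf krainesCoeffs fun i => stdBasis 8 (eighthTurnTuple T i) := by
      simp only [formOf_stdBasis]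
      exact_mod_cast krainesCoeffs_expansion
    change 4 * (α _ - _ * formOf krainesCoeffs _) =
      ∑ T : Finset (Fin 4), (α _ - _ * formOf krainesCoeffs _)
    rw [Finset.sum_sub_distrib, ← Finset.mul_sum, ← h3, ← h4]
    ring
  have h3 : ∀ T : Finset (Fin 4), T ≠ Finset.univ → T ≠ ∅ →
      isForcedZero krainesSymmetries krainesWords [![0, 1, 4, 5]] (eighthTurnTuple T) = true := by
    decide +kernel
  rw [Finset.sum_eq_add_of_mem Finset.univ ∅ (Finset.mem_univ _) (Finset.mem_univ _) (by decide)
    fun T _ hT => apply_eq_zero_of_isForcedZero hinv h0 (h3 T hT.1 hT.2)] at h2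
  have e1 : eighthTurnTuple Finset.univ = ![0, 1, 2, 3] := by decide
  have e2 : eighthTurnTuple ∅ = ![4, 5, 6, 7] := by decide
  rw [e1, e2, ← h1] at h2
  have h4 : β (fun i => stdBasis 8 (![0, 1, 2, 3] i)) = 0 := by linarith
  refine eq_zero_of_isForcedZero krainesWords [![0, 1, 4, 5], ![0, 1, 2, 3], ![4, 5, 6, 7]]
    hinv ?_ (by decide +kernel)
  intro J hJ
  simp only [List.mem_cons, List.not_mem_nil, or_false] at hJ
  rcases hJ with rfl | rfl | rfl
  · exact h0 _ (List.mem_singleton_self _)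
  · exact h4
  · exact h1.symm.trans h4

theorem invariants_sp2Sp1_eq_bot {p : ℕ} (h0 : 0 < p) (h8 : p < 8) (h4 : p ≠ 4)
    {α : Euc 8 [⋀^Fin p]→L[ℝ] ℝ} (hα : α ∈ invariants Sp2Sp1 p) : α = 0 := by
  have hinv : ∀ g ∈ krainesSymmetries, IsSignedInvariant α g := fun g hg =>
    isSignedInvariant_of_mem_invariants (signedPerm_mem_sp2Sp1 g hg) hα
  refine eq_zero_of_isForcedZero [] [] hinv (by simp) ?_
  clear hinv hα α
  interval_cases p <;> first | decide +kernel | exact absurd rfl h4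

/-- Cartan's test holds trivially if all connections are closed. -/
theorem isRegularFlag_of_eq_top {n : ℕ} {A : GradedSubspace n} {x : Fin n → Euc n}
    (hx : LinearIndependent ℝ x) (h : closedConnections A = ⊤) : IsRegularFlag A x := by
  refine ⟨hx, ?_⟩
  have hE : Module.finrank ℝ (Euc n) = n := finrank_euclideanSpace_fin
  rw [h, finrank_top]
  have h1 : ∀ j ∈ Finset.range n, polarNullity A x j ≤ n * n := fun j _ => by
    have := Submodule.finrank_le (polarKernel A (flag x j))
    rwa [finrank_clm hE, hE] at this
  have h2 := Finset.sum_le_card_nsmul _ _ _ h1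
  have h3 : Module.finrank ℝ (Euc n →L[ℝ] Euc n →L[ℝ] Euc n) = n * (n * n) := by
    rw [finrank_clm hE, finrank_clm hE, hE]
  rwa [Finset.card_range, smul_eq_mul, ← h3] at h2

theorem isRegularFlag_sp2Sp1 : IsRegularFlag (invariants Sp2Sp1) (stdBasis 8) := by
  -- The Kraines form is invariant, but this is not needed: were it not, there would be no invariant
  -- forms in the degrees `1, …, 7`, and every connection would be closed.
  by_cases hΩ : formOf krainesCoeffs ∈ invariants Sp2Sp1 4
  · refine isRegularFlag_of_certificate (stdBasis 8) hΩ (fun δ hδ => ?_) one_ne_zero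
      (L := krainesCoeffs) (fun J => by rw [formOf_stdBasis, one_mul])
      krainesCertificate (N := 12) (by decide) (by decide +kernel) (by decide +kernel)
    refine mem_closedConnections_of_degrees fun p h0 h8 α hα => ?_
    rcases eq_or_ne p 4 with rfl | h4
    · obtain ⟨t, rfl⟩ := exists_smul_kraines hα
      rw [← torsionLin_apply, map_smul, torsionLin_apply, hδ, smul_zero]
    · rw [invariants_sp2Sp1_eq_bot h0 h8 h4 hα, ← torsionLin_apply, map_zero]
  · refine isRegularFlag_of_eq_top (stdBasis 8).linearIndependent (eq_top_iff.2 fun δ _ => ?_)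
    refine mem_closedConnections_of_degrees fun p h0 h8 α hα => ?_
    have hα0 : α = 0 := by
      rcases eq_or_ne p 4 with rfl | h4
      · obtain ⟨t, rfl⟩ := exists_smul_kraines hα
        rcases eq_or_ne t 0 with rfl | ht
        · rw [zero_smul]
        · refine absurd ?_ hΩ
          have := Submodule.smul_mem _ t⁻¹ hα
          rwa [smul_smul, inv_mul_cancel₀ ht, one_smul] at this
      · exact invariants_sp2Sp1_eq_bot h0 h8 h4 hα
    rw [hα0, ← torsionLin_apply, map_zero]

end QuaternionKaehler

/-! ### The group `G₂` -/

section GTwo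

/-- The coefficients of the `3`-form `φ` with stabiliser `G₂`. -/
def g2Coeffs : List (ℤ × (Fin 3 → Fin 7)) :=
    [(1, ![0, 1, 2]), (1, ![0, 3, 4]), (1, ![0, 5, 6]), (1, ![1, 3, 5]), (-1, ![1, 4, 6]), (-1,
    ![2, 3, 6]), (-1, ![2, 4, 5])]

/-- The coefficients of the `4`-form `*φ`. -/
def g2DualCoeffs : List (ℤ × (Fin 4 → Fin 7)) :=
    [(-1, ![0, 1, 3, 6]), (-1, ![0, 1, 4, 5]), (-1, ![0, 2, 3, 5]), (1, ![0, 2, 4, 6]), (1, ![1,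
    2, 3, 4]), (1, ![1, 2, 5, 6]), (1, ![3, 4, 5, 6])]

/-- Endomorphisms dual to the components of `B ↦ B · φ` on `⟨e_1, …, e_6⟩`, up to a factor. -/
def g2Certificate : List ((Fin 3 → Fin 7) × List (ℤ × Fin 7 × Fin 7)) :=
    [(![0, 1, 2], [(1, 1, 1), (1, 2, 2), (-1, 5, 5)]),   (![0, 1, 3], [(-1, 1, 4), (1, 2, 3),
    (1, 5, 0)]),   (![0, 1, 4], [(2, 3, 1)]),   (![0, 1, 5], [(2, 2, 5)]),   (![0, 2, 3], [(-2,
    1, 3)]),   (![0, 2, 4], [(-1, 1, 4), (1, 2, 3), (-1, 5, 0)]),   (![0, 2, 5], [(2, 4, 0)]),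
    (![0, 3, 4], [(1, 3, 3), (1, 4, 4), (-1, 5, 5)]),   (![0, 3, 5], [(2, 1, 0)]),   (![0, 4,
    5], [(-2, 3, 5)]),   (![1, 2, 3], [(-2, 5, 2)]),   (![1, 2, 4], [(-2, 5, 1)]),   (![1, 2,
    5], [(1, 3, 2), (1, 4, 1), (1, 5, 0)]),   (![1, 3, 4], [(2, 0, 1)]),   (![1, 3, 5], [(1, 1,
    1), (-1, 2, 2), (1, 5, 5)]),   (![1, 4, 5], [(2, 3, 4)]),   (![2, 3, 4], [(2, 0, 2)]),
    (![2, 3, 5], [(2, 1, 2)]),   (![2, 4, 5], [(1, 1, 1), (-1, 2, 2), (-1, 5, 5)]),   (![3, 4,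
    5], [(-1, 1, 4), (-1, 2, 3), (1, 5, 0)])]

/-- Endomorphisms dual to the components of `B ↦ B · φ` on `⟨e_1, …, e_6⟩` and annihilated by the
components of `B ↦ B · *φ` in `g2DualCertificateSnd`, up to a factor. -/
def g2DualCertificateFst : List ((Fin 3 → Fin 7) × List (ℤ × Fin 7 × Fin 7)) :=
    [(![0, 1, 2], [(1, 0, 0), (1, 2, 2), (-1, 4, 4)]),   (![0, 1, 3], [(-1, 1, 4), (1, 2, 3),
    (1, 5, 0)]),   (![0, 1, 4], [(2, 2, 4)]),   (![0, 1, 5], [(2, 2, 5)]),   (![0, 2, 3], [(-2,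
    1, 3)]),   (![0, 2, 4], [(-1, 1, 4), (1, 2, 3), (-1, 5, 0)]),   (![0, 2, 5], [(-2, 1, 5)]),
    (![0, 3, 4], [(1, 0, 0), (-1, 1, 1), (1, 3, 3)]),   (![0, 3, 5], [(2, 4, 5)]),   (![0, 4,
    5], [(-2, 3, 5)]),   (![1, 2, 3], [(2, 0, 3)]),   (![1, 2, 4], [(2, 0, 4)]),   (![1, 2, 5],
    [(1, 3, 2), (1, 4, 1), (1, 5, 0)]),   (![1, 3, 4], [(2, 0, 1)]),   (![1, 3, 5], [(1, 3, 3),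
    (-1, 4, 4), (1, 5, 5)]),   (![1, 4, 5], [(2, 3, 4)]),   (![2, 3, 4], [(2, 0, 2)]),   (![2,
    3, 5], [(2, 1, 2)]),   (![2, 4, 5], [(1, 1, 1), (-1, 2, 2), (-1, 5, 5)]),   (![3, 4, 5],
    [(-1, 1, 4), (-1, 2, 3), (1, 5, 0)])]

/-- Endomorphisms dual to some components of `B ↦ B · *φ` on `⟨e_1, …, e_6⟩` and annihilated by all
components of `B ↦ B · φ` on this subspace, up to a factor. -/
def g2DualCertificateSnd : List ((Fin 4 → Fin 7) × List (ℤ × Fin 7 × Fin 7)) :=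
    [(![0, 1, 2, 3], [(-2, 1, 5), (-2, 4, 0)]),   (![0, 1, 2, 4], [(2, 2, 5), (2, 3, 0)]),
    (![0, 1, 3, 4], [(-2, 0, 2), (2, 5, 3)]),   (![0, 2, 3, 4], [(2, 1, 0), (-2, 4, 5)]),
    (![1, 2, 3, 4], [(-1, 0, 0), (1, 1, 1), (1, 4, 4), (-1, 5, 5)]),   (![0, 1, 2, 5], [(-2, 2,
    4), (2, 3, 1)]),   (![0, 1, 3, 5], [(-2, 1, 2), (-2, 4, 3)]),   (![0, 1, 4, 5], [(-1, 1, 1),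
    (1, 2, 2), (1, 3, 3), (-1, 4, 4)])]

/-- Some signed permutations in `G₂`. -/
def g2Symmetries : List ((Fin 7 → ℤ) × (Fin 7 → Fin 7)) :=
  [(fun _ => 1, ![1, 3, 5, 2, 0, 6, 4]),
    (![1, 1, 1, -1, -1, -1, -1], id), (![1, -1, -1, 1, 1, -1, -1], id),
    (![-1, 1, -1, 1, -1, 1, -1], id)]

/-- The powers of the first symmetry, which permute the monomials of `φ` and of `*φ`
transitively. -/
def g2Words : List (List ℕ) :=
  (List.range 7).map fun k => List.replicate k 0

theorem g2Form_eq : g2Form = formOf g2Coeffs := by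
  ext v
  rw [formOf_apply]
  simp only [g2Form, g2Coeffs, List.map_cons, List.map_nil, List.sum_cons,
    List.sum_nil, ContinuousAlternatingMap.add_apply, ContinuousAlternatingMap.sub_apply]
  push_cast
  ring

theorem signedPerm_mem_g2 : ∀ g ∈ g2Symmetries, signedPerm g ∈ G2 := by
  have h : ∀ g ∈ g2Symmetries, (∀ i, g.1 i * g.1 i = 1) ∧ Function.Injective g.2 ∧
      allIncreasing 7 3 0 (fun J => decide (coeff g2Coeffs J =
        (∏ i, g.1 (J i)) * coeff g2Coeffs fun i => g.2 (J i))) = true := by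
    decide +kernel
  exact fun g hg => signedPerm_mem_stabilizer g2Form_eq (h g hg).1 (h g hg).2.1 (h g hg).2.2

theorem invariants_g2_eq_bot {p : ℕ} (h0 : 0 < p) (h7 : p < 7) (h3 : p ≠ 3) (h4 : p ≠ 4)
    {α : Euc 7 [⋀^Fin p]→L[ℝ] ℝ} (hα : α ∈ invariants G2 p) : α = 0 := by
  have hinv : ∀ g ∈ g2Symmetries, IsSignedInvariant α g := fun g hg =>
    isSignedInvariant_of_mem_invariants (signedPerm_mem_g2 g hg) hα
  refine eq_zero_of_isForcedZero [] [] hinv (by simp) ?_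
  clear hinv hα α
  interval_cases p <;>
    first | decide +kernel | exact absurd rfl h3 | exact absurd rfl h4

theorem g2Form_mem : g2Form ∈ invariants G2 3 := fun _ hg => hg.2

theorem exists_smul_g2Form {α : Euc 7 [⋀^Fin 3]→L[ℝ] ℝ} (hα : α ∈ invariants G2 3) :
    ∃ t : ℝ, α = t • g2Form := by
  refine ⟨α fun i => stdBasis 7 (![0, 1, 2] i), ?_⟩
  rw [← sub_eq_zero]
  refine eq_zero_of_isForcedZero g2Words [![0, 1, 2]] (fun g hg =>
    isSignedInvariant_of_mem_invariants (signedPerm_mem_g2 g hg)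
      (Submodule.sub_mem _ hα (Submodule.smul_mem _ _ g2Form_mem))) ?_ (by decide +kernel)
  intro J hJ
  rw [List.mem_singleton.1 hJ, ContinuousAlternatingMap.sub_apply,
    ContinuousAlternatingMap.smul_apply, g2Form_eq, formOf_stdBasis]
  have : coeff g2Coeffs ![0, 1, 2] = 1 := by decide +kernel
  rw [this]
  simp

theorem exists_smul_g2Dual {α : Euc 7 [⋀^Fin 4]→L[ℝ] ℝ} (hα : α ∈ invariants G2 4) :
    ∃ t : ℝ, α = t • formOf g2DualCoeffs := by
  refine ⟨α fun i => stdBasis 7 (![3, 4, 5, 6] i), ?_⟩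
  rw [← sub_eq_zero]
  have h : ∀ g ∈ g2Symmetries,
      allIncreasing 7 4 0 (fun J => decide (coeff g2DualCoeffs J =
        (∏ i, g.1 (J i)) * coeff g2DualCoeffs fun i => g.2 (J i))) = true := by
    decide +kernel
  refine eq_zero_of_isForcedZero g2Words [![3, 4, 5, 6]] (fun g hg =>
    (isSignedInvariant_of_mem_invariants (signedPerm_mem_g2 g hg) hα).sub
      ((isSignedInvariant_formOf (h g hg)).smul _)) ?_ (by decide +kernel)
  intro J hJ
  rw [List.mem_singleton.1 hJ, ContinuousAlternatingMap.sub_apply,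
    ContinuousAlternatingMap.smul_apply, formOf_stdBasis]
  have : coeff g2DualCoeffs ![3, 4, 5, 6] = 1 := by decide +kernel
  rw [this]
  simp

/-- A connection is closed for `G₂` if it is so on `φ` and on the invariant `4`-forms. -/
theorem mem_closedConnections_g2 {δ : Euc 7 →L[ℝ] Euc 7 →L[ℝ] Euc 7}
    (h3 : torsion δ g2Form = 0) (h4 : ∀ α ∈ invariants G2 4, torsion δ α = 0) :
    δ ∈ closedConnections (invariants G2) := by
  refine mem_closedConnections_of_degrees fun p h0 h7 α hα => ?_
  rcases eq_or_ne p 3 with rfl | hp3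
  · obtain ⟨t, rfl⟩ := exists_smul_g2Form hα
    rw [← torsionLin_apply, map_smul, torsionLin_apply, h3, smul_zero]
  rcases eq_or_ne p 4 with rfl | hp4
  · exact h4 α hα
  · rw [invariants_g2_eq_bot h0 h7 hp3 hp4 hα, ← torsionLin_apply, map_zero]

section TorsionIdentity

variable {n : ℕ}

/-- The component at `(e_{J₀}, …, e_{J_p})` of the torsion of a form with integral coefficients, for
the connection `e^a ⊗ e_c ⊗ e^d`. -/
def torsionCoeff {p : ℕ} (L : List (ℤ × (Fin p → Fin n))) (a c d : Fin n) (J : Fin (p + 1) → Fin n) :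
    ℤ :=
  sumFin (p + 1) fun i => if (J i : ℕ) = a then
    (-1) ^ (i : ℕ) * actCoeff L [(1, c, d)] (fun k => J (i.succAbove k)) else 0

/-- The connection `e^a ⊗ e_c ⊗ e^d`. -/
noncomputable def elementaryConnection (a c d : Fin n) : Euc n →L[ℝ] Euc n →L[ℝ] Euc n :=
  (coordCLM (stdBasis n) a).smulRight (endoOf (stdBasis n) [(1, c, d)])

theorem elementaryConnection_apply (a c d i k : Fin n) :
    elementaryConnection a c d (stdBasis n i) (stdBasis n k) =
      if i = a ∧ k = d then stdBasis n c else 0 := by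
  rw [elementaryConnection, ContinuousLinearMap.smulRight_apply, coordCLM_apply]
  simp only [endoOf, List.map_cons, List.map_nil, List.sum_cons, List.sum_nil, add_zero,
    Int.cast_one, one_smul, smul_apply]
  rw [ContinuousLinearMap.smulRight_apply, coordCLM_apply]
  simp only [Module.Basis.repr_self, Finsupp.single_apply]
  by_cases h1 : i = a <;> by_cases h2 : k = d <;> simp [h1, h2]

theorem torsion_elementaryConnection {p : ℕ} (L : List (ℤ × (Fin p → Fin n))) (a c d : Fin n)
    (J : Fin (p + 1) → Fin n) : torsion (elementaryConnection a c d) (formOf L)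
      (fun i => stdBasis n (J i)) = torsionCoeff L a c d J := by
  rw [torsion_apply, torsionCoeff, sumFin_eq]
  push_cast
  refine Finset.sum_congr rfl fun i _ => ?_
  have h1 : elementaryConnection a c d (stdBasis n (J i)) =
      if J i = a then endoOf (stdBasis n) [(1, c, d)] else 0 := by
    rw [elementaryConnection, ContinuousLinearMap.smulRight_apply, coordCLM_apply]
    simp only [Module.Basis.repr_self, Finsupp.single_apply]
    split_ifs <;> simp
  rw [h1]
  by_cases h : J i = a
  · have h' : (J i : ℕ) = a := congrArg Fin.val h
    rw [if_pos h, if_pos h']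
    congr 1
    have := act_endoOf (stdBasis n) (α := formOf L) (s := 1)
      (fun J => by rw [formOf_stdBasis, one_mul]) [(1, c, d)] fun k => J (i.succAbove k)
    rw [one_mul] at this
    exact this
  · have h' : (J i : ℕ) ≠ a := fun e => h (Fin.ext e)
    rw [if_neg h, if_neg h', map_zero]
    simp

/-- A linear functional on the connections vanishes if it does so on the elementary ones. -/
theorem eq_zero_of_elementaryConnection (F : (Euc n →L[ℝ] Euc n →L[ℝ] Euc n) →ₗ[ℝ] ℝ)
    (h : ∀ a c d, F (elementaryConnection a c d) = 0) (δ : Euc n →L[ℝ] Euc n →L[ℝ] Euc n) :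
    F δ = 0 := by
  have h1 : δ = ∑ a, ∑ c, ∑ d, ((stdBasis n).repr (δ (stdBasis n a) (stdBasis n d)) c) •
      elementaryConnection a c d := by
    have h2 : ∀ i k, δ (stdBasis n i) (stdBasis n k) =
        (∑ a, ∑ c, ∑ d, ((stdBasis n).repr (δ (stdBasis n a) (stdBasis n d)) c) •
          elementaryConnection a c d) (stdBasis n i) (stdBasis n k) := by
      intro i k
      simp only [sum_apply, smul_apply, elementaryConnection_apply]
      rw [Finset.sum_eq_single i (fun a _ ha => by simp [ha.symm]) (by simp)]
      refine ((stdBasis n).sum_repr (δ (stdBasis n i) (stdBasis n k))).symm.trans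
        (Finset.sum_congr rfl fun c _ => ?_)
      rw [Finset.sum_eq_single k (fun a _ ha => by simp [ha.symm]) (by simp)]
      simp
    ext1 x
    ext1 y
    have h3 : ∀ i, δ (stdBasis n i) = (∑ a, ∑ c, ∑ d,
        ((stdBasis n).repr (δ (stdBasis n a) (stdBasis n d)) c) •
          elementaryConnection a c d) (stdBasis n i) := fun i =>
      ContinuousLinearMap.coe_injective ((stdBasis n).ext fun k => h2 i k)
    have h4 : (δ : Euc n →ₗ[ℝ] Euc n →L[ℝ] Euc n) = ((∑ a, ∑ c, ∑ d,
        ((stdBasis n).repr (δ (stdBasis n a) (stdBasis n d)) c) •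
          elementaryConnection a c d : Euc n →L[ℝ] Euc n →L[ℝ] Euc n) :
        Euc n →ₗ[ℝ] Euc n →L[ℝ] Euc n) := (stdBasis n).ext h3
    exact congrArg (fun z => z y) (LinearMap.congr_fun h4 x)
  rw [h1]
  simp only [map_sum, map_smul, h, smul_zero, Finset.sum_const_zero]

end TorsionIdentity

/-- The components of the torsion of `*φ` in the identities which express that the
`7`-dimensional components of `d*φ` and of `dφ` are proportional. -/
def g2IdentitySnd (r : Fin 7) : List (ℤ × (Fin 5 → Fin 7)) :=
  ([[(1, ![0, 3, 4, 5, 6]), (1, ![0, 1, 2, 5, 6]), (1, ![0, 1, 2, 3, 4])], [(1, ![1, 3, 4, 5,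
    6]), (-1, ![0, 1, 2, 4, 6]), (1, ![0, 1, 2, 3, 5])], [(-1, ![2, 3, 4, 5, 6]), (1, ![0, 1, 2,
    4, 5]), (1, ![0, 1, 2, 3, 6])], [(-1, ![1, 2, 3, 5, 6]), (-1, ![0, 2, 3, 4, 6]), (1, ![0, 1,
    3, 4, 5])], [(1, ![1, 2, 4, 5, 6]), (1, ![0, 2, 3, 4, 5]), (1, ![0, 1, 3, 4, 6])], [(1, ![1,
    2, 3, 4, 5]), (-1, ![0, 2, 4, 5, 6]), (1, ![0, 1, 3, 5, 6])], [(-1, ![1, 2, 3, 4, 6]), (1,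
    ![0, 2, 3, 5, 6]), (1, ![0, 1, 4, 5, 6])]] :
    List (List (ℤ × (Fin 5 → Fin 7)))).getD r []

/-- The components of the torsion of `φ` in these identities. -/
def g2IdentityFst (r : Fin 7) : List (ℤ × (Fin 4 → Fin 7)) :=
  ([[(-1, ![0, 1, 3, 5]), (1, ![0, 1, 4, 6]), (1, ![0, 2, 3, 6]), (1, ![0, 2, 4, 5])], [(1,
    ![0, 1, 3, 4]), (1, ![0, 1, 5, 6]), (1, ![1, 2, 3, 6]), (1, ![1, 2, 4, 5])], [(-1, ![0, 2,
    3, 4]), (-1, ![0, 2, 5, 6]), (-1, ![1, 2, 3, 5]), (1, ![1, 2, 4, 6])], [(-1, ![0, 1, 2, 3]),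
    (-1, ![0, 3, 5, 6]), (1, ![1, 3, 4, 6]), (1, ![2, 3, 4, 5])], [(1, ![0, 1, 2, 4]), (1, ![0,
    4, 5, 6]), (-1, ![1, 3, 4, 5]), (1, ![2, 3, 4, 6])], [(1, ![0, 1, 2, 5]), (1, ![0, 3, 4,
    5]), (1, ![1, 4, 5, 6]), (1, ![2, 3, 5, 6])], [(-1, ![0, 1, 2, 6]), (-1, ![0, 3, 4, 6]),
    (-1, ![1, 3, 5, 6]), (1, ![2, 4, 5, 6])]] :
    List (List (ℤ × (Fin 4 → Fin 7)))).getD r []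

theorem g2_torsionCoeff_identity : ∀ r a c d : Fin 7,
    ((g2IdentitySnd r).map fun t => t.1 * torsionCoeff g2DualCoeffs a c d t.2).sum +
      ((g2IdentityFst r).map fun t => t.1 * torsionCoeff g2Coeffs a c d t.2).sum = 0 := by
  decide +kernel

theorem g2_torsion_identity (r : Fin 7) (δ : Euc 7 →L[ℝ] Euc 7 →L[ℝ] Euc 7) :
    ((g2IdentitySnd r).map fun t =>
        (t.1 : ℝ) * torsion δ (formOf g2DualCoeffs) fun i => stdBasis 7 (t.2 i)).sum +
      ((g2IdentityFst r).map fun t =>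
        (t.1 : ℝ) * torsion δ (formOf g2Coeffs) fun i => stdBasis 7 (t.2 i)).sum = 0 := by
  have hlin : ∀ {p : ℕ} (α : Euc 7 [⋀^Fin p]→L[ℝ] ℝ) (l : List (ℤ × (Fin (p + 1) → Fin 7)))
      (ε : Euc 7 →L[ℝ] Euc 7 →L[ℝ] Euc 7),
      (l.map fun t => (t.1 : ℝ) • torsionFunctional α fun i => stdBasis 7 (t.2 i)).sum ε =
        (l.map fun t => (t.1 : ℝ) * torsion ε α fun i => stdBasis 7 (t.2 i)).sum := by
    intro p α l ε
    induction l with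
    | nil => rfl
    | cons t l ih =>
      rw [List.map_cons, List.sum_cons, List.map_cons, List.sum_cons, LinearMap.add_apply, ih]
      rfl
  have h := eq_zero_of_elementaryConnection
    (((g2IdentitySnd r).map fun t => (t.1 : ℝ) •
      torsionFunctional (formOf g2DualCoeffs) fun i => stdBasis 7 (t.2 i)).sum +
    ((g2IdentityFst r).map fun t => (t.1 : ℝ) •
      torsionFunctional (formOf g2Coeffs) fun i => stdBasis 7 (t.2 i)).sum) ?_ δ
  · rwa [LinearMap.add_apply, hlin, hlin] at h
  · intro a c d
    rw [LinearMap.add_apply, hlin, hlin]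
    simp only [torsion_elementaryConnection]
    have := congrArg (Int.cast (R := ℝ)) (g2_torsionCoeff_identity r a c d)
    rw [Int.cast_add, Int.cast_list_sum, Int.cast_list_sum, List.map_map, List.map_map] at this
    simpa only [Function.comp_def, Int.cast_mul, Int.cast_zero] using this

/-- The torsion of `*φ` vanishes if that of `φ` and `14` of the `21` components of that of `*φ` do:
each of the seven identities yields one more component. -/
theorem torsion_g2Dual_eq_zero {δ : Euc 7 →L[ℝ] Euc 7 →L[ℝ] Euc 7}
    (h3 : torsion δ (formOf g2Coeffs) = 0)
    (h4 : ∀ r, ∀ t ∈ (g2IdentitySnd r).take 2,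
      torsion δ (formOf g2DualCoeffs) (fun i => stdBasis 7 (t.2 i)) = 0) :
    torsion δ (formOf g2DualCoeffs) = 0 := by
  have hall : ∀ r, ∀ t ∈ g2IdentitySnd r,
      torsion δ (formOf g2DualCoeffs) (fun i => stdBasis 7 (t.2 i)) = 0 := by
    intro r t ht
    have h1 : ((g2IdentitySnd r).drop 2).length = 1 ∧
        ∀ t ∈ (g2IdentitySnd r).drop 2, t.1 ≠ 0 := by
      clear ht
      revert r
      decide +kernel
    obtain ⟨t₀, ht₀⟩ := List.length_eq_one_iff.1 h1.1
    have h2 := g2_torsion_identity r δ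
    have h5 : ((g2IdentityFst r).map fun t =>
        (t.1 : ℝ) * torsion δ (formOf g2Coeffs) fun i => stdBasis 7 (t.2 i)).sum = 0 := by
      refine List.sum_eq_zero fun x hx => ?_
      obtain ⟨t, -, rfl⟩ := List.mem_map.1 hx
      rw [h3]
      exact mul_zero _
    rw [h5, add_zero, ← List.take_append_drop 2 (g2IdentitySnd r), List.map_append, List.sum_append,
      ht₀, List.sum_eq_zero (l := List.map _ (List.take 2 _)), zero_add, List.map_singleton,
      List.sum_singleton] at h2
    · rw [← List.take_append_drop 2 (g2IdentitySnd r), List.mem_append, ht₀,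
        List.mem_singleton] at ht
      rcases ht with ht | rfl
      · exact h4 r t ht
      · have hne : (t.1 : ℝ) ≠ 0 := by
          exact_mod_cast h1.2 t (ht₀ ▸ List.mem_singleton_self _)
        exact (mul_eq_zero.1 h2).resolve_left hne
    · intro x hx
      obtain ⟨t, ht, rfl⟩ := List.mem_map.1 hx
      rw [h4 r t ht, mul_zero]
  refine eq_zero_of_forall_strictMono _ (stdBasis 7) fun J hJ => ?_
  have h6 : allIncreasing 7 5 0 (fun J => decide (∃ r, ∃ t ∈ g2IdentitySnd r,
      ∀ i, t.2 i = J i)) = true := by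
    decide +kernel
  obtain ⟨r, t, ht, htJ⟩ := of_decide_eq_true (of_allIncreasing h6 J hJ fun _ => Nat.zero_le _)
  have := hall r t ht
  simp only [htJ] at this
  exact this

theorem isRegularFlag_g2 : IsRegularFlag (invariants G2) (stdBasis 7) := by
  -- The form `*φ` is invariant, but this is not needed: were it not, the invariant forms in the
  -- degrees `1, …, 6` would be the multiples of `φ`.
  by_cases hψ : formOf g2DualCoeffs ∈ invariants G2 4
  · refine isRegularFlag_of_functionals finrank_euclideanSpace_fin (stdBasis 7).linearIndependent
      (ι := Fin g2DualCertificateFst.length ⊕ Fin g2DualCertificateSnd.length)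
      (F := Sum.elim
        (fun i => actFunctional (formOf g2Coeffs)
          fun l => stdBasis 7 ((g2DualCertificateFst.get i).1 l))
        (fun i => actFunctional (formOf g2DualCoeffs)
          fun l => stdBasis 7 ((g2DualCertificateSnd.get i).1 l)))
      (B := Sum.elim (fun i => endoOf (stdBasis 7) (g2DualCertificateFst.get i).2)
        (fun i => endoOf (stdBasis 7) (g2DualCertificateSnd.get i).2))
      (N := 2) (by norm_num) ?_
      (Sum.elim (fun i => level 3 (g2DualCertificateFst.get i).1)
        (fun i => level 4 (g2DualCertificateSnd.get i).1)) ?_ ?_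
    · have hact : ∀ {p : ℕ} (L : List (ℤ × (Fin p → Fin 7))) (C : List (ℤ × Fin 7 × Fin 7))
          (J : Fin p → Fin 7), act (formOf L) (endoOf (stdBasis 7) C)
            (fun i => stdBasis 7 (J i)) = actCoeff L C J := by
        intro p L C J
        have := act_endoOf (stdBasis 7) (α := formOf L) (s := 1)
          (fun J => by rw [formOf_stdBasis, one_mul]) C J
        rwa [one_mul] at this
      have e33 : ∀ i k : Fin g2DualCertificateFst.length, actCoeff g2Coeffs
          (g2DualCertificateFst.get k).2 (g2DualCertificateFst.get i).1 =
          if i = k then 2 else 0 := by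
        decide +kernel
      have e34 : ∀ (i : Fin g2DualCertificateFst.length) (k : Fin g2DualCertificateSnd.length),
          actCoeff g2Coeffs (g2DualCertificateSnd.get k).2 (g2DualCertificateFst.get i).1 = 0 := by
        decide +kernel
      have e43 : ∀ (i : Fin g2DualCertificateSnd.length) (k : Fin g2DualCertificateFst.length),
          actCoeff g2DualCoeffs (g2DualCertificateFst.get k).2
            (g2DualCertificateSnd.get i).1 = 0 := by
        decide +kernel
      have e44 : ∀ i k : Fin g2DualCertificateSnd.length, actCoeff g2DualCoeffs
          (g2DualCertificateSnd.get k).2 (g2DualCertificateSnd.get i).1 =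
          if i = k then 2 else 0 := by
        decide +kernel
      rintro (i | i) (k | k)
      · refine (hact g2Coeffs (g2DualCertificateFst.get k).2
          (g2DualCertificateFst.get i).1).trans ?_
        rw [e33]
        simp only [Sum.inl.injEq]
        split_ifs <;> norm_num
      · refine (hact g2Coeffs (g2DualCertificateSnd.get k).2
          (g2DualCertificateFst.get i).1).trans ?_
        rw [e34]
        simp
      · refine (hact g2DualCoeffs (g2DualCertificateFst.get k).2
          (g2DualCertificateSnd.get i).1).trans ?_
        rw [e43]
        simp
      · refine (hact g2DualCoeffs (g2DualCertificateSnd.get k).2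
          (g2DualCertificateSnd.get i).1).trans ?_
        rw [e44]
        simp only [Sum.inr.injEq]
        split_ifs <;> norm_num
    · rintro (i | i) T hT
      · exact hT 3 _ (g2Form_eq ▸ g2Form_mem) _ fun l => mem_flag _ _ (lt_level 3 _ l)
      · exact hT 4 _ hψ _ fun l => mem_flag _ _ (lt_level 4 _ l)
    · have h1 := finrank_le_add_card
        (κ := {S : Finset (Fin 7) // S.card = 4} ⊕ (Fin 7 × Fin 2))
        (S := closedConnections (invariants G2))
        (Sum.elim
          (fun S => torsionFunctional (formOf g2Coeffs) fun i => stdBasis 7 (increasing S i))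
          (fun rs => torsionFunctional (formOf g2DualCoeffs) fun i =>
            stdBasis 7 (((g2IdentitySnd rs.1).getD rs.2 (0, fun _ => 0)).2 i)))
        fun δ hδ => ?_
      · rw [finrank_clm finrank_euclideanSpace_fin, finrank_clm finrank_euclideanSpace_fin,
          finrank_euclideanSpace_fin, Fintype.card_sum, Fintype.card_finset_len,
          Fintype.card_prod, Fintype.card_fin, Fintype.card_fin] at h1
        have h2 : ∑ i : Fin g2DualCertificateFst.length ⊕ Fin g2DualCertificateSnd.length,
            (7 - (Sum.elim (fun i => level 3 (g2DualCertificateFst.get i).1)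
              (fun i => level 4 (g2DualCertificateSnd.get i).1)) i) = 49 := by
          rw [Fintype.sum_sum_type]
          decide +kernel
        rw [h2]
        have h3 : Nat.choose 7 4 + 7 * 2 = 49 := by decide
        rw [h3] at h1
        exact h1
      · have h3 : torsion δ (formOf g2Coeffs) = 0 :=
          eq_zero_of_forall_increasing _ (stdBasis 7) fun S => hδ (Sum.inl S)
        have h4 : torsion δ (formOf g2DualCoeffs) = 0 := by
          refine torsion_g2Dual_eq_zero h3 fun r t ht => ?_
          have h5 : ∀ r, ∀ t ∈ (g2IdentitySnd r).take 2,
              ∃ s : Fin 2, (g2IdentitySnd r).getD s (0, fun _ => 0) = t := by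
            decide +kernel
          obtain ⟨s, rfl⟩ := h5 r t ht
          exact hδ (Sum.inr (r, s))
        refine mem_closedConnections_g2 (g2Form_eq ▸ h3) fun α hα => ?_
        obtain ⟨t, rfl⟩ := exists_smul_g2Dual hα
        rw [← torsionLin_apply, map_smul, torsionLin_apply, h4, smul_zero]
  · refine isRegularFlag_of_certificate (stdBasis 7) g2Form_mem (fun δ hδ => ?_) one_ne_zero
      (L := g2Coeffs) (fun J => by rw [g2Form_eq, formOf_stdBasis, one_mul])
      g2Certificate (N := 2) (by decide) (by decide +kernel) (by decide +kernel)
    refine mem_closedConnections_g2 hδ fun α hα => ?_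
    obtain ⟨t, rfl⟩ := exists_smul_g2Dual hα
    rcases eq_or_ne t 0 with rfl | ht
    · rw [zero_smul, ← torsionLin_apply, map_zero]
    · refine absurd ?_ hψ
      have := Submodule.smul_mem _ t⁻¹ hα
      rwa [smul_smul, inv_mul_cancel₀ ht, one_smul] at this

end GTwo

/-! ### Cartan's test by prolongation -/

section Tableau

variable {n : ℕ} {E : Type*} [NormedAddCommGroup E] [NormedSpace ℝ E]

/-- Symmetric connections have no torsion. -/
theorem torsion_eq_zero_of_symmetric [FiniteDimensional ℝ E] (b : Module.Basis (Fin n) ℝ E)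
    {s : E →L[ℝ] E →L[ℝ] E} (hs : ∀ v w, s v w = s w v) :
    ∀ {p : ℕ} (α : E [⋀^Fin p]→L[ℝ] ℝ), torsion s α = 0
  | 0, α => by
    ext v
    rw [torsion_apply]
    simp [act_apply]
  | p + 1, α => by
    have h1 : ∀ ξ : E →L[ℝ] ℝ, torsion s (oneForm ξ) = 0 := by
      intro ξ
      ext v
      rw [torsion_apply, Fin.sum_univ_two, act_apply, act_apply]
      simp [oneForm_apply, Fin.removeNth, hs (v 0) (v 1)]
    rw [eq_sum_wedge_curryLeft b α, ← torsionLin_apply, map_smul, map_sum, Finset.sum_eq_zero,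
      smul_zero]
    intro c _
    rw [torsionLin_apply, torsion_wedge_oneForm b _ (by omega) (by omega), h1,
      torsion_eq_zero_of_symmetric b hs (α.curryLeft (b c))]
    simp only [← wedgeBilin_apply, map_zero, LinearMap.zero_apply, sub_zero]

theorem torsion_eq_zero_of_act {δ : E →L[ℝ] E →L[ℝ] E} {p : ℕ} {α : E [⋀^Fin p]→L[ℝ] ℝ}
    (h : ∀ v, act α (δ v) = 0) : torsion δ α = 0 := by
  ext v
  rw [torsion_apply]
  simp [h]

/-- A symmetric bilinear map with given values on the first vectors of a basis, if these values are
symmetric. -/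
theorem exists_symmetric [FiniteDimensional ℝ E] (b : Module.Basis (Fin n) ℝ E) (j : Fin n)
    (R : Fin n → E →L[ℝ] E) (hR : ∀ a c, a ≤ j → c ≤ j → R a (b c) = R c (b a)) :
    ∃ s : E →L[ℝ] E →L[ℝ] E, (∀ v w, s v w = s w v) ∧ ∀ a ≤ j, s (b a) = R a := by
  let q : Fin n → Fin n → E := fun a c =>
    if a ≤ j then R a (b c) else if c ≤ j then R c (b a) else 0
  have hq : ∀ a c, q a c = q c a := by
    intro a c
    by_cases ha : a ≤ j <;> by_cases hc : c ≤ j <;> simp [q, ha, hc, hR]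
  let s : E →L[ℝ] E →L[ℝ] E := ∑ a, ∑ c,
    (coordCLM b a).smulRight ((coordCLM b c).smulRight (q a c))
  have hs : ∀ v w, s v w = ∑ a, ∑ c, (b.repr v a * b.repr w c) • q a c := by
    intro v w
    simp only [s, sum_apply, ContinuousLinearMap.smulRight_apply, smul_apply, coordCLM_apply,
      smul_smul]
  refine ⟨s, fun v w => ?_, fun a ha => ?_⟩
  · rw [hs, hs, Finset.sum_comm]
    refine Finset.sum_congr rfl fun a _ => Finset.sum_congr rfl fun c _ => ?_
    rw [hq, mul_comm]
  · refine ContinuousLinearMap.coe_injective (b.ext fun c => ?_)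
    change s (b a) (b c) = R a (b c)
    rw [hs, Finset.sum_eq_single a, Finset.sum_eq_single c]
    · simp [q, ha]
    · intro k _ hk
      simp [hk.symm]
    · simp
    · intro k _ hk
      refine Finset.sum_eq_zero fun l _ => ?_
      simp [hk.symm]
    · simp

theorem finrank_add_le_of_ker {V W : Type*} [AddCommGroup V] [Module ℝ V] [FiniteDimensional ℝ V]
    [AddCommGroup W] [Module ℝ W] [FiniteDimensional ℝ W] (f : V →ₗ[ℝ] W) {S S' : Submodule ℝ V}
    {Z : Submodule ℝ W} (hZ : ∀ z ∈ Z, ∃ s ∈ S, f s = z) (hS : ∀ s ∈ S', s ∈ S ∧ f s = 0) :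
    Module.finrank ℝ Z + Module.finrank ℝ S' ≤ Module.finrank ℝ S := by
  have h1 := LinearMap.finrank_range_add_finrank_ker (f.domRestrict S)
  have h2 : Z ≤ LinearMap.range (f.domRestrict S) := by
    intro z hz
    obtain ⟨s, hs, rfl⟩ := hZ z hz
    exact ⟨⟨s, hs⟩, rfl⟩
  have h3 := Submodule.finrank_mono h2
  have h4 : Module.finrank ℝ S' ≤ Module.finrank ℝ (LinearMap.ker (f.domRestrict S)) := by
    rw [← (Submodule.comapSubtypeEquivOfLe (q := S) fun s hs => (hS s hs).1).finrank_eq]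
    refine Submodule.finrank_mono fun s hs => ?_
    exact (hS _ hs).2
  omega

theorem finrank_add_le_closedFiltration [FiniteDimensional ℝ E]
    (A : ∀ p, Submodule ℝ (E [⋀^Fin p]→L[ℝ] ℝ)) (x : Fin n → E) (j : Fin n)
    (h : ∀ B ∈ polarKernel A (flag x j), ∃ δ ∈ closedFiltration A x j, δ (x j) = B) :
    Module.finrank ℝ (polarKernel A (flag x j)) +
        Module.finrank ℝ (closedFiltration A x (j + 1)) ≤
      Module.finrank ℝ (closedFiltration A x j) := by
  let ev : (E →L[ℝ] E →L[ℝ] E) →ₗ[ℝ] (E →L[ℝ] E) :=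
    { toFun := fun δ => δ (x j)
      map_add' := fun _ _ => rfl
      map_smul' := fun _ _ => rfl }
  refine finrank_add_le_of_ker ev (fun B hB => h B hB) fun δ hδ =>
    ⟨⟨hδ.1, fun v hv => hδ.2 v (flag_mono x (Nat.le_succ _) hv)⟩,
      hδ.2 _ (mem_flag x j (Nat.lt_succ_self _))⟩

/-- Cartan's test holds if every polar direction over a member of the flag is the value of a closed
connection which vanishes on that member. -/
theorem isRegularFlag_of_forall_exists [FiniteDimensional ℝ E]
    {A : ∀ p, Submodule ℝ (E [⋀^Fin p]→L[ℝ] ℝ)} {x : Fin n → E} (hx : LinearIndependent ℝ x)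
    (h : ∀ j : Fin n, ∀ B ∈ polarKernel A (flag x j),
      ∃ δ ∈ closedFiltration A x j, δ (x j) = B) : IsRegularFlag A x := by
  refine ⟨hx, ?_⟩
  have h0 : Module.finrank ℝ (closedFiltration A x 0) ≤ Module.finrank ℝ (closedConnections A) :=
    Submodule.finrank_mono fun δ hδ => hδ.1
  have key : ∀ m ≤ n, ∑ j ∈ Finset.range m, polarNullity A x j +
      Module.finrank ℝ (closedFiltration A x m) ≤ Module.finrank ℝ (closedFiltration A x 0) := by
    intro m
    induction m with
    | zero => simp
    | succ m ih =>
      intro hm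
      have h1 := ih (by omega)
      have h2 := finrank_add_le_closedFiltration A x ⟨m, hm⟩ (h ⟨m, hm⟩)
      rw [Finset.sum_range_succ]
      change polarNullity A x m + _ ≤ _ at h2
      change _ + Module.finrank ℝ (closedFiltration A x (m + 1)) ≤ _
      have h3 : Module.finrank ℝ (closedFiltration A x ((⟨m, hm⟩ : Fin n) + 1 : ℕ)) =
        Module.finrank ℝ (closedFiltration A x (m + 1)) := rfl
      have h4 : Module.finrank ℝ (closedFiltration A x ((⟨m, hm⟩ : Fin n) : ℕ)) =
        Module.finrank ℝ (closedFiltration A x m) := rfl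
      omega
  have := key n le_rfl
  omega

/-- Cartan's test by prolongation. The forms in `A` are annihilated by a space `L` of endomorphisms,
so that connections with values in `L`, and symmetric connections, are closed. A polar direction `B`
over a member of the flag is the value of a closed connection which vanishes on that member if it
is, up to the symmetric ones, the value of a connection `Γ` with values in `L` which is symmetric on
the member. -/
theorem isRegularFlag_of_tableau [FiniteDimensional ℝ E] (b : Module.Basis (Fin n) ℝ E)
    {A : ∀ p, Submodule ℝ (E [⋀^Fin p]→L[ℝ] ℝ)} (L : Submodule ℝ (E →L[ℝ] E))
    (hL : ∀ X ∈ L, ∀ p, ∀ α ∈ A p, act α X = 0)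
    (h : ∀ j : Fin n, ∀ B ∈ polarKernel A (flag b j), ∃ Γ : Fin n → E →L[ℝ] E, (∀ a, Γ a ∈ L) ∧
      (∀ a c, a < j → c < j → Γ a (b c) = Γ c (b a)) ∧
      ∀ a < j, Γ j (b a) - Γ a (b j) = B (b a)) : IsRegularFlag A b := by
  refine isRegularFlag_of_forall_exists b.linearIndependent fun j B hB => ?_
  obtain ⟨Γ, hΓL, hΓ, hΓB⟩ := h j B hB
  have hR : ∀ a c, a ≤ j → c ≤ j → (if a = j then B - Γ a else - Γ a) (b c) =
      (if c = j then B - Γ c else - Γ c) (b a) := by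
    intro a c ha hc
    by_cases h1 : a = j <;> by_cases h2 : c = j
    · rw [h1, h2]
    · rw [if_pos h1, if_neg h2, h1]
      have := hΓB c (lt_of_le_of_ne hc h2)
      simp only [sub_apply, neg_apply, ← this]
      abel
    · rw [if_neg h1, if_pos h2, h2]
      have := hΓB a (lt_of_le_of_ne ha h1)
      simp only [sub_apply, neg_apply, ← this]
      abel
    · rw [if_neg h1, if_neg h2]
      simp only [neg_apply]
      rw [hΓ a c (lt_of_le_of_ne ha h1) (lt_of_le_of_ne hc h2)]
  obtain ⟨s, hs, hsR⟩ := exists_symmetric b j (fun a => if a = j then B - Γ a else - Γ a) hR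
  let γ : E →L[ℝ] E →L[ℝ] E := ∑ a, (coordCLM b a).smulRight (Γ a)
  have hγ : ∀ v, γ v = ∑ a, b.repr v a • Γ a := by
    intro v
    simp only [γ, sum_apply, ContinuousLinearMap.smulRight_apply, coordCLM_apply]
  have hγb : ∀ a, γ (b a) = Γ a := by
    intro a
    rw [hγ, Finset.sum_eq_single a]
    · simp
    · intro k _ hk
      simp [hk.symm]
    · simp
  refine ⟨γ + s, ⟨fun p α hα => ?_, fun v hv => ?_⟩, ?_⟩
  · rw [torsion_add, torsion_eq_zero_of_symmetric b hs, add_zero]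
    refine torsion_eq_zero_of_act fun v => hL _ ?_ p α hα
    rw [hγ]
    exact Submodule.sum_mem _ fun a _ => Submodule.smul_mem _ _ (hΓL a)
  · have h1 : flag b j ≤ LinearMap.ker ((γ + s : E →L[ℝ] E →L[ℝ] E) : E →ₗ[ℝ] E →L[ℝ] E) := by
      refine Submodule.span_le.2 ?_
      rintro _ ⟨a, ha, rfl⟩
      have ha' : a < j := ha
      change (γ + s) (b a) = 0
      rw [add_apply, hγb, hsR a ha'.le, if_neg ha'.ne]
      simp
    exact h1 hv
  · rw [add_apply, hγb, hsR j le_rfl, if_pos rfl]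
    simp

end Tableau

/-! ### The special unitary groups: Lie algebra and invariant forms -/

section ComplexStructure

variable {n k : ℕ} (h : 2 * k ≤ n)

/-- The complex coordinates as a linear map. -/
noncomputable def complexCoordLin : Euc n →ₗ[ℝ] (Fin k → ℂ) where
  toFun := complexCoord h
  map_add' x y := by
    funext j
    exact Complex.ext rfl rfl
  map_smul' c x := by
    funext j
    apply Complex.ext <;> simp [complexCoord]

theorem complexCoordLin_apply (x : Euc n) : complexCoordLin h x = complexCoord h x := rfl

theorem complexCoord_add (x y : Euc n) :
    complexCoord h (x + y) = complexCoord h x + complexCoord h y := (complexCoordLin h).map_add x y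

theorem complexCoord_sub (x y : Euc n) :
    complexCoord h (x - y) = complexCoord h x - complexCoord h y := (complexCoordLin h).map_sub x y

theorem euc_ext {x y : Euc n} (h1 : complexCoord h x = complexCoord h y)
    (h2 : ∀ i : Fin n, 2 * k ≤ i → x i = y i) : x = y := by
  ext i
  rcases lt_or_ge (i : ℕ) (2 * k) with hi | hi
  · have h3 := congrFun h1 ⟨i / 2, by omega⟩
    rcases Nat.even_or_odd' (i : ℕ) with ⟨m, hm | hm⟩
    · have h4 := congrArg Complex.re h3
      have e : (⟨2 * ((i : ℕ) / 2), by omega⟩ : Fin n) = i := Fin.ext (by simp; omega)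
      change x ⟨2 * ((i : ℕ) / 2), _⟩ = y ⟨2 * ((i : ℕ) / 2), _⟩ at h4
      rwa [e] at h4
    · have h4 := congrArg Complex.im h3
      have e : (⟨2 * ((i : ℕ) / 2) + 1, by omega⟩ : Fin n) = i := Fin.ext (by simp; omega)
      change x ⟨2 * ((i : ℕ) / 2) + 1, _⟩ = y ⟨2 * ((i : ℕ) / 2) + 1, _⟩ at h4
      rwa [e] at h4
  · exact h2 i hi

/-- The inclusion `ℂᵏ → ℝⁿ`. -/
noncomputable def ofComplex : (Fin k → ℂ) →ₗ[ℝ] Euc n where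
  toFun z := WithLp.toLp 2 fun i => if hi : (i : ℕ) / 2 < k then
    (if (i : ℕ) % 2 = 0 then (z ⟨i / 2, hi⟩).re else (z ⟨i / 2, hi⟩).im) else 0
  map_add' z w := by
    ext i
    simp only [PiLp.add_apply]
    split_ifs <;> simp
  map_smul' c z := by
    ext i
    simp only [PiLp.smul_apply]
    split_ifs <;> simp

theorem complexCoord_ofComplex (z : Fin k → ℂ) :
    complexCoord h (ofComplex (n := n) z) = z := by
  funext j
  have e1 : (2 * (j : ℕ)) / 2 = j := by omega
  have e2 : (2 * (j : ℕ) + 1) / 2 = j := by omega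
  apply Complex.ext
  · change (if hi : (2 * (j : ℕ)) / 2 < k then _ else _) = _
    rw [dif_pos (by omega), if_pos (by simp)]
    congr 2
    exact Fin.ext e1
  · change (if hi : (2 * (j : ℕ) + 1) / 2 < k then _ else _) = _
    rw [dif_pos (by omega), if_neg (by simp)]
    congr 2
    exact Fin.ext e2

theorem ofComplex_apply_of_le (z : Fin k → ℂ) {i : Fin n} (hi : 2 * k ≤ i) :
    ofComplex (n := n) z i = 0 := by
  change (if hi : (i : ℕ) / 2 < k then _ else _) = _
  rw [dif_neg (by omega)]

/-- The endomorphism of `ℝⁿ` given by a complex matrix, zero on the second summand of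
`ℂᵏ ⊕ ℝ^{n-2k}`. -/
noncomputable def complexEndo (M : Matrix (Fin k) (Fin k) ℂ) : Euc n →L[ℝ] Euc n :=
  LinearMap.toContinuousLinearMap
    (ofComplex ∘ₗ (Matrix.mulVecLin M).restrictScalars ℝ ∘ₗ complexCoordLin h)

theorem complexEndo_apply (M : Matrix (Fin k) (Fin k) ℂ) (x : Euc n) :
    complexEndo h M x = ofComplex (M.mulVec (complexCoord h x)) := rfl

theorem complexCoord_complexEndo (M : Matrix (Fin k) (Fin k) ℂ) (x : Euc n) :
    complexCoord h (complexEndo h M x) = M.mulVec (complexCoord h x) :=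
  complexCoord_ofComplex h _

theorem complexEndo_apply_of_le (M : Matrix (Fin k) (Fin k) ℂ) (x : Euc n) {i : Fin n}
    (hi : 2 * k ≤ i) : complexEndo h M x i = 0 :=
  ofComplex_apply_of_le _ hi

/-- The Lie algebra `𝔰𝔲(k)` acting on `ℝⁿ`. -/
noncomputable def suLie : Submodule ℝ (Euc n →L[ℝ] Euc n) where
  carrier := {X | ∃ M : Matrix (Fin k) (Fin k) ℂ, M.conjTranspose = -M ∧ M.trace = 0 ∧
    X = complexEndo h M}
  add_mem' := by
    rintro _ _ ⟨M, h1, h2, rfl⟩ ⟨N, h3, h4, rfl⟩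
    refine ⟨M + N, by rw [Matrix.conjTranspose_add, h1, h3, neg_add],
      by rw [Matrix.trace_add, h2, h4, add_zero], ?_⟩
    ext1 x
    rw [add_apply, complexEndo_apply, complexEndo_apply, complexEndo_apply, Matrix.add_mulVec,
      map_add]
  zero_mem' := by
    refine ⟨0, by simp, by simp, ?_⟩
    ext1 x
    rw [complexEndo_apply, Matrix.zero_mulVec, map_zero]
    rfl
  smul_mem' := by
    rintro c _ ⟨M, h1, h2, rfl⟩
    refine ⟨c • M, by rw [Matrix.conjTranspose_smul, h1, star_trivial, smul_neg],
      by rw [Matrix.trace_smul, h2, smul_zero], ?_⟩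
    ext1 x
    rw [smul_apply, complexEndo_apply, complexEndo_apply, Matrix.smul_mulVec, map_smul]

/-- An element of `SU(k)`, as a transformation of `ℝⁿ`. -/
theorem id_add_complexEndo_mem {U : Matrix (Fin k) (Fin k) ℂ}
    (hU : U ∈ Matrix.specialUnitaryGroup (Fin k) ℂ) :
    ContinuousLinearMap.id ℝ (Euc n) + complexEndo h (U - 1) ∈ SU k h := by
  refine ⟨⟨U, hU, fun x => ?_⟩, fun x i hi => ?_⟩
  · rw [add_apply, complexCoord_add, complexCoord_complexEndo, Matrix.sub_mulVec, Matrix.one_mulVec]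
    exact add_sub_cancel _ _
  · rw [add_apply, PiLp.add_apply, complexEndo_apply_of_le h _ _ hi, add_zero]
    rfl

/-- A curve in `G` through the identity has a velocity which annihilates the invariants of `G`. -/
theorem act_eq_zero_of_curve {G : Set (Euc n →L[ℝ] Euc n)} {p : ℕ} {α : Euc n [⋀^Fin p]→L[ℝ] ℝ}
    (hα : α ∈ invariants G p) {g : ℝ → Euc n →L[ℝ] Euc n} (hg : ∀ t, g t ∈ G)
    (h0 : ∀ x, g 0 x = x) {X : Euc n →L[ℝ] Euc n}
    (hX : ∀ x, HasDerivAt (fun t => g t x) (X x) 0) : act α X = 0 := by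
  ext v
  have h1 : HasDerivAt (fun t => fun i => g t (v i)) (fun i => X (v i)) 0 :=
    hasDerivAt_pi.2 fun i => hX (v i)
  have h2 := (α.toContinuousMultilinearMap.hasFDerivAt (fun i => g 0 (v i))).comp_hasDerivAt 0 h1
  have h3 : (α.toContinuousMultilinearMap ∘ fun t => fun i => g t (v i)) = fun _ => α v := by
    funext t
    exact DFunLike.congr_fun (hα _ (hg t)) v
  rw [h3] at h2
  have h4 := h2.unique (hasDerivAt_const (0 : ℝ) (α v))
  rw [ContinuousMultilinearMap.linearDeriv_apply] at h4
  simp only [h0] at h4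
  rw [act_apply]
  exact h4

theorem act_eq_zero_of_mem_suLie {X : Euc n →L[ℝ] Euc n} (hX : X ∈ suLie h) {p : ℕ}
    {α : Euc n [⋀^Fin p]→L[ℝ] ℝ} (hα : α ∈ invariants (SU k h) p) : act α X = 0 := by
  obtain ⟨M, hM, htr, rfl⟩ := hX
  -- `exp (t M)` is computed in a basis of eigenvectors of the Hermitian matrix `-iM`
  have hN : (-Complex.I • M).IsHermitian := by
    rw [Matrix.IsHermitian, Matrix.conjTranspose_smul, hM]
    simp
  let U : Matrix (Fin k) (Fin k) ℂ := hN.eigenvectorUnitary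
  let ev : Fin k → ℝ := hN.eigenvalues
  have hU : U * star U = 1 := Unitary.coe_mul_star_self _
  have hU' : star U * U = 1 := Unitary.coe_star_mul_self _
  have hsp : M = U * Matrix.diagonal (fun j => Complex.I * (ev j : ℂ)) * star U := by
    have h1 := hN.spectral_theorem
    rw [Unitary.conjStarAlgAut_apply] at h1
    have h2 : M = Complex.I • (-Complex.I • M) := by
      rw [smul_smul]
      simp
    have h3 : Matrix.diagonal (fun j => Complex.I * (ev j : ℂ)) =
        Complex.I • Matrix.diagonal (RCLike.ofReal ∘ hN.eigenvalues : Fin k → ℂ) := by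
      rw [← Matrix.diagonal_smul]
      rfl
    rw [h3, Matrix.mul_smul, Matrix.smul_mul]
    exact h2.trans (congrArg (fun Z => Complex.I • Z) h1)
  have hsum : ∑ j, (ev j : ℂ) = 0 := by
    have h1 := hN.trace_eq_sum_eigenvalues
    rw [Matrix.trace_smul, htr, smul_zero] at h1
    exact h1.symm
  let w : ℝ → Fin k → ℂ := fun t j => Complex.exp (t * (Complex.I * ev j))
  let V : ℝ → Matrix (Fin k) (Fin k) ℂ := fun t => U * Matrix.diagonal (w t) * star U
  have hw : ∀ t j, star (w t j) * w t j = 1 := by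
    intro t j
    change (starRingEnd ℂ) (Complex.exp _) * Complex.exp _ = 1
    rw [← Complex.exp_conj, ← Complex.exp_add]
    simp
  have hV : ∀ t, V t ∈ Matrix.specialUnitaryGroup (Fin k) ℂ := by
    intro t
    rw [Matrix.mem_specialUnitaryGroup_iff]
    constructor
    · rw [Matrix.mem_unitaryGroup_iff']
      have h1 : star (Matrix.diagonal (w t)) * Matrix.diagonal (w t) = 1 := by
        rw [Matrix.star_eq_conjTranspose, Matrix.diagonal_conjTranspose, Matrix.diagonal_mul_diagonal,
          ← Matrix.diagonal_one]
        congr 1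
        funext j
        exact hw t j
      simp only [V, star_mul, star_star]
      calc U * (star (Matrix.diagonal (w t)) * star U) * (U * Matrix.diagonal (w t) * star U)
          = U * (star (Matrix.diagonal (w t)) * (star U * U) * Matrix.diagonal (w t)) * star U := by
            simp only [Matrix.mul_assoc]
        _ = 1 := by rw [hU', Matrix.mul_one, h1, Matrix.mul_one, hU]
    · have h1 : U.det * (star U).det = 1 := by rw [← Matrix.det_mul, hU, Matrix.det_one]
      simp only [V, Matrix.det_mul, Matrix.det_diagonal]
      rw [mul_right_comm, h1, one_mul, ← Complex.exp_sum, ← Finset.mul_sum, ← Finset.mul_sum, hsum]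
      simp
  have hderiv : ∀ z : Fin k → ℂ, HasDerivAt (fun t : ℝ => (V t).mulVec z) (M.mulVec z) 0 := by
    intro z
    have h1 : ∀ d : Fin k → ℂ, (U * Matrix.diagonal d * star U).mulVec z =
        fun i => ∑ j, U i j * (d j * (star U).mulVec z j) := by
      intro d
      rw [← Matrix.mulVec_mulVec, ← Matrix.mulVec_mulVec]
      funext i
      change ∑ j, U i j * (Matrix.diagonal d).mulVec ((star U).mulVec z) j = _
      simp only [Matrix.mulVec_diagonal]
    have h2 : (fun t => (V t).mulVec z) =
        fun t i => ∑ j, U i j * (w t j * (star U).mulVec z j) := funext fun t => h1 (w t)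
    rw [h2, hsp, h1]
    refine hasDerivAt_pi.2 fun i => HasDerivAt.fun_sum fun j _ =>
      HasDerivAt.const_mul _ (HasDerivAt.mul_const ?_ _)
    have h3 : HasDerivAt (fun t : ℝ => (t : ℂ) * (Complex.I * ev j)) (Complex.I * ev j) 0 := by
      have := (Complex.ofRealCLM.hasDerivAt (x := (0 : ℝ))).mul_const (Complex.I * (ev j : ℂ))
      simpa using this
    have h4 := h3.cexp
    simpa [w] using h4
  refine act_eq_zero_of_curve hα
    (g := fun t => ContinuousLinearMap.id ℝ (Euc n) + complexEndo h (V t - 1))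
    (fun t => id_add_complexEndo_mem h (hV t)) (fun x => ?_) fun x => ?_
  · have h1 : V 0 = 1 := by
      have : w 0 = 1 := by
        funext j
        simp [w]
      simp only [V, this]
      change U * Matrix.diagonal (fun _ => 1) * star U = 1
      rw [Matrix.diagonal_one, Matrix.mul_one, hU]
    rw [h1, sub_self, add_apply, complexEndo_apply, Matrix.zero_mulVec, map_zero, add_zero]
    rfl
  · have h1 : (fun t => (ContinuousLinearMap.id ℝ (Euc n) + complexEndo h (V t - 1)) x) =
        fun t => x + LinearMap.toContinuousLinearMap (ofComplex (n := n) (k := k))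
          ((V t).mulVec (complexCoord h x) - complexCoord h x) := by
      funext t
      rw [add_apply, complexEndo_apply, Matrix.sub_mulVec, Matrix.one_mulVec]
      rfl
    rw [h1]
    refine HasDerivAt.const_add _ ?_
    have h2 := (hderiv (complexCoord h x)).sub_const (complexCoord h x)
    exact (LinearMap.toContinuousLinearMap
      (ofComplex (n := n) (k := k))).hasFDerivAt.comp_hasDerivAt 0 h2

/-- The Kähler form of `ℂᵏ`. -/
noncomputable def kaehlerForm : Euc n [⋀^Fin 2]→L[ℝ] ℝ :=
  ∑ l : Fin k, coordForm ![⟨2 * l, by omega⟩, ⟨2 * l + 1, by omega⟩]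

theorem kaehlerForm_apply (v : Fin 2 → Euc n) : kaehlerForm h v =
    (star (complexCoord h (v 0)) ⬝ᵥ complexCoord h (v 1)).im := by
  rw [kaehlerForm, ContinuousAlternatingMap.sum_apply, dotProduct, Complex.im_sum]
  refine Finset.sum_congr rfl fun l _ => ?_
  rw [coordForm_apply, Matrix.det_fin_two]
  simp [complexCoord]
  ring

theorem kaehlerForm_mem : kaehlerForm h ∈ invariants (SU k h) 2 := by
  rintro g ⟨⟨U, hU, hg⟩, -⟩
  ext v
  rw [ContinuousAlternatingMap.compContinuousLinearMap_apply, kaehlerForm_apply, kaehlerForm_apply]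
  simp only [Function.comp_apply]
  rw [hg, hg, Matrix.star_mulVec, ← Matrix.dotProduct_mulVec, Matrix.mulVec_mulVec,
    ← Matrix.star_eq_conjTranspose,
    Matrix.mem_unitaryGroup_iff'.1 (Matrix.mem_specialUnitaryGroup_iff.1 hU).1, Matrix.one_mulVec]

/-- A real-linear function `l` of the holomorphic volume form `dz_1 ∧ ⋯ ∧ dz_k`, such as its real or
imaginary part. -/
noncomputable def holomorphicVolume (l : ℂ →ₗ[ℝ] ℝ) : Euc n [⋀^Fin k]→L[ℝ] ℝ where
  toFun v := l (Matrix.of fun a b => complexCoord h (v a) b).det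
  map_update_add' := by
    intro inst v i x y
    have hinst : inst = instDecidableEqFin k := Subsingleton.elim _ _
    subst hinst
    have h1 : ∀ z, (Matrix.of fun a b => complexCoord h (Function.update v i z a) b) =
        (Matrix.of fun a b => complexCoord h (v a) b).updateRow i (complexCoord h z) := by
      intro z
      ext a b
      rcases eq_or_ne a i with rfl | ha
      · simp
      · simp [ha]
    rw [h1, h1, h1, complexCoord_add, Matrix.det_updateRow_add, map_add]
  map_update_smul' := by
    intro inst v i c x
    have hinst : inst = instDecidableEqFin k := Subsingleton.elim _ _
    subst hinst
    have h1 : ∀ z, (Matrix.of fun a b => complexCoord h (Function.update v i z a) b) =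
        (Matrix.of fun a b => complexCoord h (v a) b).updateRow i (complexCoord h z) := by
      intro z
      ext a b
      rcases eq_or_ne a i with rfl | ha
      · simp
      · simp [ha]
    have h2 : complexCoord h (c • x) = (c : ℂ) • complexCoord h x := by
      rw [← complexCoordLin_apply, map_smul]
      funext j
      simp [complexCoordLin_apply]
    rw [h1, h1, h2, Matrix.det_updateRow_smul, smul_eq_mul, ← Complex.real_smul, map_smul,
      smul_eq_mul]
  map_eq_zero_of_eq' := by
    intro v i j hij hne
    rw [Matrix.det_zero_of_row_eq hne, map_zero]
    funext b
    simp [hij]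
  cont := by
    have h1 : Continuous fun x : Euc n => complexCoord h x :=
      (LinearMap.toContinuousLinearMap (complexCoordLin h)).continuous
    refine (LinearMap.toContinuousLinearMap l).continuous.comp (Continuous.matrix_det ?_)
    refine continuous_matrix fun a b => ?_
    exact (continuous_apply b).comp (h1.comp (continuous_apply a))

theorem holomorphicVolume_apply (l : ℂ →ₗ[ℝ] ℝ) (v : Fin k → Euc n) : holomorphicVolume h l v =
    l (Matrix.of fun a b => complexCoord h (v a) b).det := rfl

theorem holomorphicVolume_mem (l : ℂ →ₗ[ℝ] ℝ) :
    holomorphicVolume h l ∈ invariants (SU k h) k := by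
  rintro g ⟨⟨U, hU, hg⟩, -⟩
  ext v
  rw [ContinuousAlternatingMap.compContinuousLinearMap_apply, holomorphicVolume_apply,
    holomorphicVolume_apply]
  have h1 : (Matrix.of fun a b => complexCoord h ((g ∘ v) a) b) =
      (Matrix.of fun a b => complexCoord h (v a) b) * U.transpose := by
    ext a b
    simp only [Function.comp_apply, hg, Matrix.of_apply, Matrix.mul_apply, Matrix.mulVec,
      dotProduct, Matrix.transpose_apply]
    exact Finset.sum_congr rfl fun c _ => mul_comm _ _
  rw [h1, Matrix.det_mul, Matrix.det_transpose, (Matrix.mem_specialUnitaryGroup_iff.1 hU).2,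
    mul_one]

theorem coordForm_mem {i : Fin n} (hi : 2 * k ≤ i) :
    coordForm ![i] ∈ invariants (SU k h) 1 := by
  rintro g ⟨-, hg⟩
  ext v
  rw [ContinuousAlternatingMap.compContinuousLinearMap_apply, coordForm_apply, coordForm_apply]
  simp [hg _ i hi]

variable {h} {W : Submodule ℝ (Euc n)} {B : Euc n →L[ℝ] Euc n}

/-- The polar equation of the Kähler form. -/
theorem kaehler_polar (hB : B ∈ polarKernel (invariants (SU k h)) W) {x y : Euc n} (hx : x ∈ W)
    (hy : y ∈ W) : (star (complexCoord h (B x)) ⬝ᵥ complexCoord h y).im +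
      (star (complexCoord h x) ⬝ᵥ complexCoord h (B y)).im = 0 := by
  have h1 := hB 2 _ (kaehlerForm_mem h) ![x, y] (by
    intro i
    fin_cases i
    · exact hx
    · exact hy)
  rw [act_apply, Fin.sum_univ_two, kaehlerForm_apply, kaehlerForm_apply] at h1
  simpa using h1

/-- The polar equation of the holomorphic volume form. -/
theorem volume_polar (hB : B ∈ polarKernel (invariants (SU k h)) W) {v : Fin k → Euc n}
    (hv : ∀ i, v i ∈ W) : ∑ i, ((Matrix.of fun a b => complexCoord h (v a) b).updateRow i
      (complexCoord h (B (v i)))).det = 0 := by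
  have h0 : ∀ l : ℂ →ₗ[ℝ] ℝ, l (∑ i, ((Matrix.of fun a b => complexCoord h (v a) b).updateRow i
      (complexCoord h (B (v i)))).det) = 0 := by
    intro l
    have h1 := hB k _ (holomorphicVolume_mem h l) v hv
    rw [act_apply] at h1
    rw [map_sum, ← h1]
    refine Finset.sum_congr rfl fun i _ => ?_
    rw [holomorphicVolume_apply]
    congr 2
    ext a b
    rcases eq_or_ne a i with rfl | ha
    · simp
    · simp [ha]
  exact Complex.ext (h0 Complex.reLm) (h0 Complex.imLm)

/-- The polar equation of the coordinates on which `SU(k)` acts trivially. -/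
theorem coord_polar (hB : B ∈ polarKernel (invariants (SU k h)) W) {x : Euc n} (hx : x ∈ W)
    {i : Fin n} (hi : 2 * k ≤ i) : B x i = 0 := by
  have h1 := hB 1 _ (coordForm_mem h hi) (fun _ => x) fun _ => hx
  rw [act_apply, Fin.sum_univ_one, coordForm_apply] at h1
  simpa using h1

end ComplexStructure

/-! ### The special unitary groups: prolongation -/

section Prolongation

variable {k : ℕ}

/-- The prolongation conditions for `𝔰𝔲(k)` on the span of `e_1, …, e_{j-1}`, `j ≤ k`: if the values
`β` of a polar direction are symmetric with respect to the Kähler form, they are the alternation of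
an array `M` of matrices in `𝔰𝔲(k)`, symmetric on this span. The real symmetric part of `β` is
absorbed by the matrices `M a`, `a < j`, with entries in row and column `j` only; then `β` becomes
skew-Hermitian on the span, and extends to a trace-free matrix since the entry at `(j, j)` is
free. -/
theorem exists_su_real (j : Fin k) (β : Fin k → Fin k → ℂ)
    (hβ : ∀ a c, a < j → c < j → (β a c).im = (β c a).im) :
    ∃ M : Fin k → Matrix (Fin k) (Fin k) ℂ,
      (∀ a, (M a).conjTranspose = -M a ∧ (M a).trace = 0) ∧
      (∀ a c, a < j → c < j → ∀ r, M a r c = M c r a) ∧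
      ∀ a < j, ∀ r, M j r a - M a r j = β a r := by
  -- the real symmetric part of `β`
  let H : Fin k → Fin k → ℝ := fun c a =>
    if c < j ∧ a < j then ((β a c).re + (β c a).re) / 2 else 0
  have hH : ∀ c a, H c a = H a c := by
    intro c a
    simp only [H, and_comm, add_comm]
  have hHj : ∀ a, H j a = 0 := fun a => by simp [H]
  let N : Fin k → Matrix (Fin k) (Fin k) ℂ := fun a => Matrix.of fun r s =>
    (if r = j then (H s a : ℂ) else 0) - if s = j then (H r a : ℂ) else 0
  let b' : Fin k → Fin k → ℂ := fun r s => β s r - H r s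
  have hb' : ∀ r s, r < j → s < j → star (b' s r) = -b' r s := by
    intro r s hr hs
    apply Complex.ext
    · simp [b', H, hr, hs]
      ring
    · have := hβ r s hr hs
      simp [b', H, this]
  let P : Matrix (Fin k) (Fin k) ℂ := Matrix.of fun r s =>
    if s < j then b' r s else if r < j then -star (b' s r) else
      if r = j ∧ s = j then -∑ a with a < j, b' a a else 0
  have hP : P.conjTranspose = -P := by
    ext r s
    simp only [Matrix.conjTranspose_apply, Matrix.neg_apply, P, Matrix.of_apply]
    by_cases hr : r < j <;> by_cases hs : s < j
    · simp only [hr, hs, if_true]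
      exact hb' r s hr hs
    · simp [hr, hs]
    · simp [hr, hs]
    · simp only [hr, hs, if_false]
      by_cases hrs : r = j ∧ s = j
      · have h1 : ∑ a with a < j, star (b' a a) = ∑ a with a < j, -b' a a :=
          Finset.sum_congr rfl fun a ha =>
            hb' a a (Finset.mem_filter.1 ha).2 (Finset.mem_filter.1 ha).2
        rw [if_pos hrs, if_pos hrs.symm, star_neg, star_sum, h1, Finset.sum_neg_distrib]
      · rw [if_neg hrs, if_neg fun e => hrs e.symm]
        simp
  have hPtr : P.trace = 0 := by
    have h1 : ∀ r, P r r = (if r < j then b' r r else 0) +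
        if r = j then -∑ a with a < j, b' a a else 0 := by
      intro r
      simp only [P, Matrix.of_apply]
      by_cases hr : r < j
      · simp [hr, hr.ne]
      · by_cases hr' : r = j <;> simp [hr, hr']
    rw [Matrix.trace]
    simp only [Matrix.diag_apply, h1, Finset.sum_add_distrib, Finset.sum_ite_eq',
      Finset.mem_univ, if_true, ← Finset.sum_filter]
    exact add_neg_cancel _
  refine ⟨fun a => if a = j then P else N a, fun a => ?_, fun a c ha hc r => ?_, fun a ha r => ?_⟩
  · beta_reduce
    by_cases ha : a = j
    · rw [if_pos ha]
      exact ⟨hP, hPtr⟩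
    · rw [if_neg ha]
      constructor
      · ext r s
        simp only [Matrix.conjTranspose_apply, Matrix.neg_apply, N, Matrix.of_apply]
        by_cases hr : r = j <;> by_cases hs : s = j <;> simp [hr, hs]
      · rw [Matrix.trace]
        simp [N]
  · beta_reduce
    rw [if_neg ha.ne, if_neg hc.ne]
    simp only [N, Matrix.of_apply, ha.ne, hc.ne, if_false, hH c a]
  · beta_reduce
    rw [if_pos rfl, if_neg ha.ne]
    simp only [N, P, Matrix.of_apply, ha, if_true, b']
    by_cases hr : r = j
    · simp [hr, hHj]
    · simp [hr]

/-- A symmetric trace-free matrix `h` is the slice `Q(·, ·, m)` of a symmetric array with vanishing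
contractions. If the rows of `h` before the `m`-th vanish, so do those slices of `Q`. -/
theorem exists_tracefree_cubic (m : Fin k) {h : Fin k → Fin k → ℝ} (hh : ∀ a c, h a c = h c a)
    (hl : ∀ l < m, ∀ c, h l c = 0) (hhtr : ∑ a, h a a = 0) :
    ∃ Q : Fin k → Fin k → Fin k → ℝ, (∀ a r c, Q a r c = Q c r a) ∧ (∀ a r c, Q a r c = Q a c r) ∧
      (∀ a r, Q a r m = h a r) ∧ (∀ l < m, ∀ a r, Q a r l = 0) ∧ ∀ a, ∑ r, Q a r r = 0 := by
  let Q : Fin k → Fin k → Fin k → ℝ := fun a r c => if a = m then h r c else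
    if r = m then h a c else if c = m then h a r else if a = r ∧ r = c then -h a m else 0
  have hQ1 : ∀ a r c, Q a r c = Q c r a := by
    intro a r c
    simp only [Q]
    grind
  have hQ2 : ∀ a r c, Q a r c = Q a c r := by
    intro a r c
    simp only [Q]
    grind
  refine ⟨Q, hQ1, hQ2, fun a r => ?_, fun l hlm a r => ?_, fun a => ?_⟩
  · simp only [Q]
    grind
  · rw [hQ1]
    simp only [Q, if_neg hlm.ne, hl l hlm]
    simp
  · by_cases ha : a = m
    · simpa only [Q, if_pos ha] using hhtr
    · rw [Finset.sum_eq_add_of_mem m a (Finset.mem_univ _) (Finset.mem_univ _) (Ne.symm ha)]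
      · simp [Q, ha]
      · intro c _ hc
        simp [Q, ha, hc.1, hc.2.symm]

/-- The prolongation conditions for `𝔰𝔲(k)` on the span of `e_1, …, e_k, ie_1, …, ie_{m-1}`. The real
symmetric part of the values `b` of a polar direction is absorbed by the matrices `M a = i Q(a, ·, ·)`
with a real symmetric trace-free cubic form `Q`, and the rest is a matrix in `𝔰𝔲(k)`. -/
theorem exists_su_imaginary (m : Fin k) (b : Fin k → Fin k → ℂ)
    (hq : ∀ a c, (b a c).im = (b c a).im) (htr : ∑ a, b a a = 0)
    (hp : ∀ l < m, ∀ a, (b a l).re = -(b l a).re) :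
    ∃ (M : Fin k → Matrix (Fin k) (Fin k) ℂ) (P : Matrix (Fin k) (Fin k) ℂ),
      (∀ a, (M a).conjTranspose = -M a ∧ (M a).trace = 0) ∧ P.conjTranspose = -P ∧ P.trace = 0 ∧
      (∀ a c r, M a r c = M c r a) ∧ (∀ l < m, ∀ a r, M a r l = 0) ∧
      ∀ a r, P r a - Complex.I * M a r m = b a r := by
  let h : Fin k → Fin k → ℝ := fun a c => ((b a c).re + (b c a).re) / 2
  have hh : ∀ a c, h a c = h c a := fun a c => by simp only [h, add_comm]
  have hl : ∀ l < m, ∀ c, h l c = 0 := fun l hlm c => by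
    simp only [h]
    rw [hp l hlm c]
    ring
  have hhtr : ∑ a, h a a = 0 := by
    have h1 := congrArg Complex.re htr
    rw [Complex.re_sum, Complex.zero_re] at h1
    rw [← h1]
    exact Finset.sum_congr rfl fun a _ => by simp only [h]; ring
  obtain ⟨Q, hQ1, hQ2, hQm, hQl, hQtr⟩ := exists_tracefree_cubic m hh hl hhtr
  let M : Fin k → Matrix (Fin k) (Fin k) ℂ := fun a => Matrix.of fun r c => Complex.I * Q a r c
  let P : Matrix (Fin k) (Fin k) ℂ := Matrix.of fun r a => ⟨(b a r).re - h a r, (b a r).im⟩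
  refine ⟨M, P, fun a => ⟨?_, ?_⟩, ?_, ?_, fun a c r => ?_, fun l hlm a r => ?_, fun a r => ?_⟩
  · ext r c
    simp [M, hQ2 a r c]
  · rw [Matrix.trace]
    simp only [M, Matrix.diag_apply, Matrix.of_apply]
    rw [← Finset.mul_sum, ← Complex.ofReal_sum, hQtr, Complex.ofReal_zero, mul_zero]
  · ext r c
    simp only [Matrix.conjTranspose_apply, Matrix.neg_apply, P, Matrix.of_apply]
    apply Complex.ext
    · simp [h]
      ring
    · simp [hq r c]
  · rw [Matrix.trace]
    simp only [P, Matrix.diag_apply, Matrix.of_apply]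
    apply Complex.ext
    · rw [Complex.re_sum]
      simp [h]
    · have h1 := congrArg Complex.im htr
      rw [Complex.im_sum] at h1 ⊢
      exact h1
  · simp only [M, Matrix.of_apply]
    rw [hQ1]
  · simp only [M, Matrix.of_apply]
    rw [hQl l hlm, Complex.ofReal_zero, mul_zero]
  · simp only [M, P, Matrix.of_apply, hQm]
    apply Complex.ext <;> simp

end Prolongation

/-! ### The special unitary groups: the flag of real parts -/

theorem det_updateRow_one {m : Type*} [Fintype m] [DecidableEq m] (i : m) (z : m → ℂ) :
    ((1 : Matrix m m ℂ).updateRow i z).det = z i := by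
  rw [← Matrix.cramer_transpose_apply, Matrix.transpose_one, Matrix.cramer_one]
  rfl

section ComplexFlag

variable {n k : ℕ} (h : 2 * k ≤ n)

/-- The order of the coordinates of `ℂᵏ ⊕ ℝ^{n-2k}` in which all real parts precede all imaginary
parts. -/
def realFirst (i : Fin n) : Fin n :=
  if h1 : (i : ℕ) < k then ⟨2 * i, by omega⟩ else
    if h2 : (i : ℕ) < 2 * k then ⟨2 * (i - k) + 1, by omega⟩ else i

theorem val_realFirst (i : Fin n) : (realFirst h i : ℕ) = if (i : ℕ) < k then 2 * (i : ℕ) else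
    if (i : ℕ) < 2 * k then 2 * (i - k : ℕ) + 1 else i := by
  simp only [realFirst]
  split_ifs <;> rfl

theorem realFirst_bijective : Function.Bijective (realFirst h) := by
  refine Finite.injective_iff_bijective.1 fun i j hij => ?_
  have h1 := congrArg Fin.val hij
  rw [val_realFirst, val_realFirst] at h1
  ext
  split_ifs at h1 <;> omega

/-- The basis `e_1, …, e_k, ie_1, …, ie_k` of `ℂᵏ`, completed by the standard basis of
`ℝ^{n-2k}`. -/
noncomputable def complexBasis : Module.Basis (Fin n) ℝ (Euc n) :=
  (stdBasis n).reindex (Equiv.ofBijective _ (realFirst_bijective h)).symm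

theorem complexBasis_apply (i j : Fin n) :
    complexBasis h i j = if realFirst h i = j then 1 else 0 := by
  rw [complexBasis, Module.Basis.reindex_apply, Equiv.symm_symm, Equiv.ofBijective_apply,
    stdBasis_apply]

/-- The position of `e_a` in the basis. -/
def realIdx (a : Fin k) : Fin n := ⟨a, by omega⟩

/-- The position of `ie_a` in the basis. -/
def imagIdx (a : Fin k) : Fin n := ⟨k + a, by omega⟩

theorem eq_realIdx_or (i : Fin n) :
    (∃ a : Fin k, i = realIdx h a) ∨ (∃ a : Fin k, i = imagIdx h a) ∨ 2 * k ≤ i := by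
  by_cases h1 : (i : ℕ) < k
  · exact Or.inl ⟨⟨i, h1⟩, rfl⟩
  · by_cases h2 : (i : ℕ) < 2 * k
    · exact Or.inr (Or.inl ⟨⟨i - k, by omega⟩, Fin.ext (by simp only [imagIdx]; omega)⟩)
    · exact Or.inr (Or.inr (not_lt.1 h2))

theorem complexCoord_realIdx (a : Fin k) :
    complexCoord h (complexBasis h (realIdx h a)) = Pi.single a 1 := by
  have h1 : realFirst h (realIdx h a) = ⟨2 * a, by omega⟩ := by
    exact dif_pos a.2
  funext j
  apply Complex.ext
  · simp only [complexCoord, complexBasis_apply, h1, Fin.mk.injEq]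
    by_cases hj : j = a
    · simp [hj]
    · have : (j : ℕ) ≠ a := fun e => hj (Fin.ext e)
      rw [if_neg (by omega), Pi.single_eq_of_ne hj]
      rfl
  · simp only [complexCoord, complexBasis_apply, h1, Fin.mk.injEq]
    rw [if_neg (by omega)]
    by_cases hj : j = a
    · simp [hj]
    · simp [Pi.single_eq_of_ne hj]

theorem complexCoord_imagIdx (a : Fin k) :
    complexCoord h (complexBasis h (imagIdx h a)) = Pi.single a Complex.I := by
  have h1 : realFirst h (imagIdx h a) = ⟨2 * a + 1, by omega⟩ := by
    rw [realFirst, dif_neg (by simp [imagIdx]), dif_pos (by simp only [imagIdx]; omega)]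
    ext
    simp [imagIdx]
  funext j
  apply Complex.ext
  · simp only [complexCoord, complexBasis_apply, h1, Fin.mk.injEq]
    rw [if_neg (by omega)]
    by_cases hj : j = a
    · simp [hj]
    · simp [Pi.single_eq_of_ne hj]
  · simp only [complexCoord, complexBasis_apply, h1, Fin.mk.injEq]
    by_cases hj : j = a
    · simp [hj]
    · have : (j : ℕ) ≠ a := fun e => hj (Fin.ext e)
      rw [if_neg (by omega), Pi.single_eq_of_ne hj]
      rfl

theorem mulVec_single_one_apply (M : Matrix (Fin k) (Fin k) ℂ) (a r : Fin k) :
    M.mulVec (Pi.single a 1) r = M r a := by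
  simp

theorem mulVec_single_I_apply (M : Matrix (Fin k) (Fin k) ℂ) (a r : Fin k) :
    M.mulVec (Pi.single a Complex.I) r = Complex.I * M r a := by
  rw [Matrix.mulVec_single]
  simp [mul_comm]

variable {h} {B : Euc n →L[ℝ] Euc n}

theorem im_symm_of_polar {j : ℕ}
    (hB : B ∈ polarKernel (invariants (SU k h)) (flag (complexBasis h) j)) {a c : Fin k} (ha : (a : ℕ) < j) (hc : (c : ℕ) < j) :
    (complexCoord h (B (complexBasis h (realIdx h a))) c).im =
      (complexCoord h (B (complexBasis h (realIdx h c))) a).im := by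
  have h1 := kaehler_polar hB (mem_flag _ (realIdx h a) ha) (mem_flag _ (realIdx h c) hc)
  rw [complexCoord_realIdx, complexCoord_realIdx, ← Pi.single_star] at h1
  simp at h1
  linarith

/-- The polar directions of the span of `e_1, …, e_k, ie_1, …, ie_m` are trace-free, complex linear
where this makes sense, and symmetric with respect to the Kähler form. -/
theorem polar_of_lt {m : ℕ}
    (hB : B ∈ polarKernel (invariants (SU k h)) (flag (complexBasis h) (k + m))) :
    (∑ a, complexCoord h (B (complexBasis h (realIdx h a))) a = 0) ∧
    (∀ r : Fin k, (r : ℕ) < m → ∀ l, complexCoord h (B (complexBasis h (imagIdx h r))) l =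
      Complex.I * complexCoord h (B (complexBasis h (realIdx h r))) l) ∧
    ∀ l : Fin k, (l : ℕ) < m → ∀ a,
      (complexCoord h (B (complexBasis h (realIdx h a))) l).re =
        -(complexCoord h (B (complexBasis h (realIdx h l))) a).re := by
  have hre : ∀ a : Fin k, complexBasis h (realIdx h a) ∈ flag (complexBasis h) (k + m) :=
    fun a => mem_flag _ _ (by simp only [realIdx]; omega)
  have him : ∀ r : Fin k, (r : ℕ) < m →
      complexBasis h (imagIdx h r) ∈ flag (complexBasis h) (k + m) :=
    fun r hr => mem_flag _ _ (by simp only [imagIdx]; omega)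
  have hone : (Matrix.of fun a b => complexCoord h (complexBasis h (realIdx h a)) b) = 1 := by
    ext a b
    rw [Matrix.of_apply, complexCoord_realIdx, Matrix.one_apply, Pi.single_apply]
    simp only [eq_comm]
  have hlin : ∀ r : Fin k, (r : ℕ) < m → ∀ l, complexCoord h (B (complexBasis h (imagIdx h r))) l =
      Complex.I * complexCoord h (B (complexBasis h (realIdx h r))) l := by
    intro r hr l
    -- the volume form on `e_1, …, e_k` with `e_l` replaced by `x`
    have key : ∀ x ∈ flag (complexBasis h) (k + m), complexCoord h (B x) l +
        ∑ i ∈ Finset.univ.erase l, (((1 : Matrix (Fin k) (Fin k) ℂ).updateRow i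
          (complexCoord h (B (complexBasis h (realIdx h i))))).updateRow l
            (complexCoord h x)).det = 0 := by
      intro x hx
      have h1 := volume_polar hB (v := Function.update (fun i => complexBasis h (realIdx h i)) l x)
        fun i => by
          rcases eq_or_ne i l with rfl | hi
          · simpa using hx
          · simpa [hi] using hre i
      have h2 : (Matrix.of fun a b => complexCoord h
          (Function.update (fun i => complexBasis h (realIdx h i)) l x a) b) =
          (1 : Matrix (Fin k) (Fin k) ℂ).updateRow l (complexCoord h x) := by
        rw [← hone]
        ext a b
        rcases eq_or_ne a l with rfl | ha
        · simp
        · simp [ha]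
      rw [h2, ← Finset.add_sum_erase _ _ (Finset.mem_univ l)] at h1
      rw [← h1]
      congr 1
      · rw [Function.update_self, Matrix.updateRow_idem, det_updateRow_one]
      · refine Finset.sum_congr rfl fun i hi => ?_
        have hil := Finset.ne_of_mem_erase hi
        rw [Function.update_of_ne hil, Matrix.updateRow_comm _ hil]
    have h1 := key _ (him r hr)
    have h2 := key _ (hre r)
    have h3 : (Pi.single r Complex.I : Fin k → ℂ) = Complex.I • Pi.single r 1 := by
      rw [← Pi.single_smul', smul_eq_mul, mul_one]
    rw [complexCoord_realIdx] at h2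
    rw [complexCoord_imagIdx, h3] at h1
    simp only [Matrix.det_updateRow_smul] at h1
    rw [← Finset.mul_sum] at h1
    linear_combination h1 - Complex.I * h2
  refine ⟨?_, hlin, fun l hl a => ?_⟩
  · have h1 := volume_polar hB (v := fun i => complexBasis h (realIdx h i)) hre
    simp only [hone, det_updateRow_one] at h1
    exact h1
  · have h1 := kaehler_polar hB (hre a) (him l hl)
    rw [complexCoord_imagIdx, complexCoord_realIdx, ← Pi.single_star] at h1
    simp [hlin l hl] at h1
    linarith

/-- The hypothesis of `isRegularFlag_of_tableau` for `SU(k)`, in terms of complex matrices. -/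
theorem exists_tableau_of_matrices {j : Fin n}
    (hB : B ∈ polarKernel (invariants (SU k h)) (flag (complexBasis h) j))
    (N : Fin n → Matrix (Fin k) (Fin k) ℂ)
    (hN : ∀ a, (N a).conjTranspose = -N a ∧ (N a).trace = 0)
    (h1 : ∀ a c, a < j → c < j → ∀ r, (N a).mulVec (complexCoord h (complexBasis h c)) r =
      (N c).mulVec (complexCoord h (complexBasis h a)) r)
    (h2 : ∀ a < j, ∀ r, (N j).mulVec (complexCoord h (complexBasis h a)) r -
      (N a).mulVec (complexCoord h (complexBasis h j)) r =
        complexCoord h (B (complexBasis h a)) r) :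
    ∃ Γ : Fin n → Euc n →L[ℝ] Euc n, (∀ a, Γ a ∈ suLie h) ∧
      (∀ a c, a < j → c < j → Γ a (complexBasis h c) = Γ c (complexBasis h a)) ∧
      ∀ a < j, Γ j (complexBasis h a) - Γ a (complexBasis h j) = B (complexBasis h a) := by
  refine ⟨fun a => complexEndo h (N a), fun a => ⟨N a, (hN a).1, (hN a).2, rfl⟩,
    fun a c ha hc => ?_, fun a ha => ?_⟩
  · refine euc_ext h ?_ fun i hi => ?_
    · rw [complexCoord_complexEndo, complexCoord_complexEndo]
      exact funext (h1 a c ha hc)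
    · rw [complexEndo_apply_of_le h _ _ hi, complexEndo_apply_of_le h _ _ hi]
  · refine euc_ext h ?_ fun i hi => ?_
    · rw [complexCoord_sub, complexCoord_complexEndo, complexCoord_complexEndo]
      exact funext (h2 a ha)
    · rw [PiLp.sub_apply, complexEndo_apply_of_le h _ _ hi, complexEndo_apply_of_le h _ _ hi,
        coord_polar hB (mem_flag _ a ha) hi, sub_zero]

theorem isRegularFlag_su (h : 2 * k ≤ n) (hn : n ≤ 2 * k + 1) :
    IsRegularFlag (invariants (SU k h)) (complexBasis h) := by
  refine isRegularFlag_of_tableau _ (suLie h) (fun X hX p α hα => act_eq_zero_of_mem_suLie h hX hα)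
    fun j B hB => ?_
  let β : Fin k → Fin k → ℂ := fun a => complexCoord h (B (complexBasis h (realIdx h a)))
  rcases eq_realIdx_or h j with ⟨j, rfl⟩ | ⟨m, rfl⟩ | hj
  · obtain ⟨M, hM, hM1, hM2⟩ := exists_su_real j β fun a c ha hc => im_symm_of_polar hB ha hc
    have hlt : ∀ a : Fin n, a < realIdx h j → ∃ a' < j, a = realIdx h a' :=
      fun a ha => ⟨⟨a, lt_trans ha j.2⟩, ha, rfl⟩
    let N : Fin n → Matrix (Fin k) (Fin k) ℂ := fun a => if ha : (a : ℕ) < k then M ⟨a, ha⟩ else 0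
    have hN : ∀ a : Fin k, N (realIdx h a) = M a := fun a => dif_pos a.2
    refine exists_tableau_of_matrices hB N (fun a => ?_) (fun a c ha hc r => ?_) fun a ha r => ?_
    · by_cases ha : (a : ℕ) < k
      · simp only [N, dif_pos ha]
        exact hM _
      · simp [N, dif_neg ha]
    · obtain ⟨a, ha', rfl⟩ := hlt a ha
      obtain ⟨c, hc', rfl⟩ := hlt c hc
      rw [hN, hN, complexCoord_realIdx, complexCoord_realIdx, mulVec_single_one_apply,
        mulVec_single_one_apply, hM1 a c ha' hc']
    · obtain ⟨a, ha', rfl⟩ := hlt a ha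
      rw [hN, hN, complexCoord_realIdx, complexCoord_realIdx, mulVec_single_one_apply,
        mulVec_single_one_apply, hM2 a ha']
  · obtain ⟨htr, hlin, hp⟩ := polar_of_lt hB
    obtain ⟨M, P, hM, hP, hPtr, hM1, hM2, hMP⟩ := exists_su_imaginary m β
      (fun a c => im_symm_of_polar hB (by simp only [imagIdx]; omega)
        (by simp only [imagIdx]; omega)) htr hp
    have hlt : ∀ a : Fin n, a < imagIdx h m →
        (∃ a', a = realIdx h a') ∨ ∃ a' < m, a = imagIdx h a' := by
      intro a ha
      rcases eq_realIdx_or h a with h1 | ⟨c, rfl⟩ | h1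
      · exact Or.inl h1
      · exact Or.inr ⟨c, by simpa [imagIdx] using ha, rfl⟩
      · simp only [imagIdx, Fin.lt_def] at ha
        omega
    let N : Fin n → Matrix (Fin k) (Fin k) ℂ := fun a =>
      if ha : (a : ℕ) < k then M ⟨a, ha⟩ else if a = imagIdx h m then P else 0
    have hN : ∀ a : Fin k, N (realIdx h a) = M a := fun a => dif_pos a.2
    have hNj : N (imagIdx h m) = P := by
      simp only [N]
      rw [dif_neg (by simp [imagIdx]), if_pos trivial]
    have hN0 : ∀ a < m, N (imagIdx h a) = 0 := by
      intro a ha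
      have h1 : (a : ℕ) ≠ m := fun e => ha.ne (Fin.ext e)
      simp only [N]
      rw [dif_neg (by simp [imagIdx]), if_neg (by simpa [imagIdx] using h1)]
    refine exists_tableau_of_matrices hB N (fun a => ?_) (fun a c ha hc r => ?_) fun a ha r => ?_
    · by_cases ha : (a : ℕ) < k
      · simp only [N, dif_pos ha]
        exact hM _
      · simp only [N, dif_neg ha]
        split_ifs
        · exact ⟨hP, hPtr⟩
        · simp
    · rcases hlt a ha with ⟨a, rfl⟩ | ⟨a, ha', rfl⟩ <;>
        rcases hlt c hc with ⟨c, rfl⟩ | ⟨c, hc', rfl⟩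
      · rw [hN, hN, complexCoord_realIdx, complexCoord_realIdx, mulVec_single_one_apply,
          mulVec_single_one_apply, hM1]
      · rw [hN, hN0 c hc', complexCoord_imagIdx, mulVec_single_I_apply, hM2 c hc', mul_zero,
          Matrix.zero_mulVec, Pi.zero_apply]
      · rw [hN, hN0 a ha', complexCoord_imagIdx, mulVec_single_I_apply, hM2 a ha', mul_zero,
          Matrix.zero_mulVec, Pi.zero_apply]
      · rw [hN0 a ha', hN0 c hc', Matrix.zero_mulVec, Matrix.zero_mulVec]
    · rcases hlt a ha with ⟨a, rfl⟩ | ⟨a, ha', rfl⟩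
      · rw [hN, hNj, complexCoord_realIdx, complexCoord_imagIdx, mulVec_single_one_apply,
          mulVec_single_I_apply, hMP]
      · have h1 := hMP a r
        rw [hM1, hM2 a ha', mul_zero, sub_zero] at h1
        rw [hN0 a ha', hNj, complexCoord_imagIdx, mulVec_single_I_apply, Matrix.zero_mulVec,
          Pi.zero_apply, sub_zero, h1]
        exact (hlin a ha' r).symm
  · have hjk : (j : ℕ) = k + k := by omega
    rw [hjk] at hB
    obtain ⟨htr, hlin, hp⟩ := polar_of_lt hB
    have hq : ∀ a c, (β a c).im = (β c a).im := fun a c =>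
      im_symm_of_polar hB (by omega) (by omega)
    rw [← hjk] at hB
    let P : Matrix (Fin k) (Fin k) ℂ := Matrix.of fun r a => β a r
    have hP : P.conjTranspose = -P := by
      ext r c
      apply Complex.ext
      · simpa [P] using hp c c.2 r
      · simpa [P] using hq r c
    have hN : ∀ a < j, (if a = j then P else 0) = 0 := fun a ha => if_neg ha.ne
    refine exists_tableau_of_matrices hB (fun a => if a = j then P else 0) (fun a => ?_)
      (fun a c ha hc r => ?_) fun a ha r => ?_
    · split_ifs
      · exact ⟨hP, htr⟩
      · simp
    · rw [hN a ha, hN c hc, Matrix.zero_mulVec, Matrix.zero_mulVec]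
    · beta_reduce
      rw [hN a ha, if_pos rfl, Matrix.zero_mulVec, Pi.zero_apply, sub_zero]
      rcases eq_realIdx_or h a with ⟨a, rfl⟩ | ⟨a, rfl⟩ | h1
      · rw [complexCoord_realIdx, mulVec_single_one_apply]
        rfl
      · rw [complexCoord_imagIdx, mulVec_single_I_apply, hlin a a.2]
        rfl
      · have h2 : (a : ℕ) < j := ha
        omega

end ComplexFlag
end DGAGeometry

theorem mainTheorem8 :
    (DGAGeometry.InvolutiveOnAllManifolds.{u} (DGAGeometry.invariants DGAGeometry.Sp2Sp1)
        (fun _ => 0) ∧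
      DGAGeometry.InvolutiveOnAllManifolds.{u} (DGAGeometry.invariants DGAGeometry.Spin7)
        (fun _ => 0) ∧
      DGAGeometry.InvolutiveOnAllManifolds.{u} (DGAGeometry.lineSpan DGAGeometry.rho)
        (fun _ => 0) ∧
      DGAGeometry.InvolutiveOnAllManifolds.{u} (DGAGeometry.lineSpan DGAGeometry.starRho)
        (fun _ => 0)) ∧
    DGAGeometry.InvolutiveForAllOperators.{u} (DGAGeometry.invariants DGAGeometry.G2) ∧
    (∀ k : ℕ, 1 ≤ k →
      DGAGeometry.InvolutiveForAllOperators.{u}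
        (DGAGeometry.invariants (DGAGeometry.SU k (le_refl (2 * k))))) ∧
    (∀ k : ℕ, 1 ≤ k →
      DGAGeometry.InvolutiveForAllOperators.{u}
        (DGAGeometry.invariants (DGAGeometry.SU k (Nat.le_succ (2 * k))))) := by
  open DGAGeometry in
  exact ⟨⟨involutiveOnAllManifolds_zero isRegularFlag_sp2Sp1,
      involutiveOnAllManifolds_zero isRegularFlag_spin7,
      involutiveOnAllManifolds_zero isRegularFlag_rho,
      involutiveOnAllManifolds_zero isRegularFlag_starRho⟩,
    involutiveForAllOperators_of_isRegularFlag isRegularFlag_g2,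
    fun _ _ => involutiveForAllOperators_of_isRegularFlag (isRegularFlag_su _ (Nat.le_succ _)),
    fun _ _ => involutiveForAllOperators_of_isRegularFlag (isRegularFlag_su _ le_rfl)⟩
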